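/- Let $p>1$, $\lambda>0$, let $\alpha=(\alpha_i)_{i\in\mathbb Z}$ be a bounded sequence of positive numbers, $g\in\ell^2=\ell^2(\mathbb Z)$, and let $\Phi:\mathbb R\to\mathbb R$ be differentiable with $\Phi(0)=0$ and, for some constants $c_1,c_2>0$, $$\tfrac{(p+1)^2}{4}c_2|u|^{p-1}\le\Phi'(u)\le c_1(1+|u|^{p-1})\qquad(u\in\mathbb R).$$ Functions of sequences are taken coordinatewise (so $\Phi(u)=(\Phi(u_i))_i$, $|u|^{p-1}u=(|u_i|^{p-1}u_i)_i$, $e^{\alpha r}u=(e^{\alpha_i r}u_i)_i$), and $(Au)_i=-u_{i-1}+2u_i-u_{i+1}$. Let $C_0(\mathbb R,\mathbb R)$ be the space of continuous $\omega:\mathbb R\to\mathbb R$ with $\omega(0)=0$, with the compact-open topology, its Borel $\sigma$-algebra and the two-sided Wiener measure $\mathbb P$. Let $\theta_t\omega=\omega(\cdot+t)-\omega(t)$ and $z(\omega)=-\int_{-\infty}^0e^{\tau}\omega(\tau)\,d\tau$. Let $\Omega$ be the set of all $\omega\in C_0(\mathbb R,\mathbb R)$ such that $\tau\mapsto e^\tau\,\theta_t\omega(\tau)$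 is integrable on $(-\infty,0]$ for every $t\in\mathbb R$, $t\mapsto z(\theta_t\omega)$ is continuous, $\lim_{t\to+\infty}e^{-\gamma t}|z(\theta_{-t}\omega)|=0$ for every $\gamma>0$, and $$\lim_{t\to\pm\infty}\frac{|z(\theta_t\omega)|}{|t|}=0,\qquad \lim_{t\to\pm\infty}\frac1t\int_0^tz(\theta_s\omega)\,ds=0 .$$ The set $\Omega$ is invariant under every $\theta_t$; equip it with the trace $\mathcal F$ of the Borel $\sigma$-algebra and with the restriction of $\mathbb P$. Then $\Omega$ is measurable with $\mathbb P(\Omega)=1$, $(\Omega,\mathcal F,\mathbb P,(\theta_t)_{t\in\mathbb R})$ is a metric dynamical system (that is, $\mathbb P$ is a probability measure on $\Omega$, $(t,\omega)\mapsto\theta_t\omega$ is measurable, $\theta_0=\mathrm{id}$, $\theta_{s+t}=\theta_t\theta_s$, and each $\theta_t$ preserves $\mathbb P$), and the following holds. (a) For every $\omega\in\Omega$ and $v_0\in\ell^2$ the random differential equation in $\ell^2$ $$\frac{dv}{dt}=-e^{-\alpha z(\theta_t\omega)}A\big(\Phi(e^{\alpha z(\theta_t\omega)}v)\big)+(\alpha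 z(\theta_t\omega)-\lambda)v-\lambda e^{\alpha(p-1)z(\theta_t\omega)}|v|^{p-1}v+e^{-\alpha z(\theta_t\omega)}g,\qquad v(0)=v_0,$$ has a solution $v(\cdot,\omega,v_0)$ on $[0,\infty)$, and it is the only solution on $[0,T]$ for every $T>0$. (b) The solution map $\varphi(t,\omega,v_0)=v(t,\omega,v_0)$ is a continuous random dynamical system on $\ell^2$ over $(\Omega,\mathcal F,\mathbb P,(\theta_t)_{t\in\mathbb R})$: $\varphi$ is jointly measurable on $[0,\infty)\times\Omega\times\ell^2$ with respect to $\mathcal B([0,\infty))\otimes\mathcal F\otimes\mathcal B(\ell^2)$, and for all $\omega\in\Omega$ and $s,t\ge0$ the map $\varphi(t,\omega,\cdot)$ is continuous, $\varphi(0,\omega,\cdot)=\mathrm{id}$, and $\varphi(s+t,\omega,\cdot)=\varphi(t,\theta_s\omega,\cdot)\circ\varphi(s,\omega,\cdot)$. (c) There is a map $u:[0,\infty)\times\Omega\times\ell^2\to\ell^2$ with $$\varphi(t,\omega,v_0)=e^{-\alpha z(\theta_t\omega)}\,u\big(t,\omega,e^{\alpha z(\omega)}v_0\big)\qquad(t\ge0,\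 \omega\in\Omega,\ v_0\in\ell^2)$$ such that, with $w(t)(\omega)=\omega(t)$ and $\mathcal F_t=\sigma(\omega(r):r\le t)$, for every $\mathcal F_0$-measurable $u_0:\Omega\to\ell^2$ the process $u(t)=u(t,\omega,u_0(\omega))$ is $(\mathcal F_t)$-adapted, has continuous paths in $\ell^2$, and almost surely satisfies for all $t\ge0$ the Stratonovich equation $$u(t)=u_0+\int_0^t\big[-A(\Phi(u(s)))-\lambda\big(u(s)+|u(s)|^{p-1}u(s)\big)+g\big]ds+\alpha\int_0^tu(s)\circ dw(s),$$ where the Stratonovich integral is the $\ell^2$-valued limit in probability of the trapezoidal sums $\sum_k\frac{u(t_k)+u(t_{k+1})}2\,(w(t_{k+1})-w(t_k))$ along deterministic partitions of $[0,t]$ whose mesh tends to $0$. -/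

import Mathlib

open MeasureTheory ProbabilityTheory Filter Topology Set
open scoped NNReal ENNReal

/-! ### Path space, Wiener measure, Wiener shift -/

/-- `C(ℝ, ℝ)` has the compact-open topology; we give it the Borel σ-algebra. -/
noncomputable instance instMeasurableSpaceRealPaths : MeasurableSpace C(ℝ, ℝ) := borel _

instance instBorelSpaceRealPaths : BorelSpace C(ℝ, ℝ) := ⟨rfl⟩

/-- The space `C₀(ℝ, ℝ)` of continuous paths `ω` with `ω(0) = 0`, with the topology and the
Borel σ-algebra induced from `C(ℝ, ℝ)`. -/
abbrev PathSpace : Type := {ω : C(ℝ, ℝ) // ω 0 = 0}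

/-- `P` is the (two-sided) Wiener measure on `C₀(ℝ, ℝ)`: the probability measure under which
the coordinate process has independent increments, and `ω(t) - ω(s)` is centred Gaussian with
variance `t - s` whenever `s ≤ t`. -/
structure IsWienerMeasure (P : Measure PathSpace) : Prop where
  isProbabilityMeasure : IsProbabilityMeasure P
  hasIndepIncrements : HasIndepIncrements (fun (t : ℝ) (ω : PathSpace) => ω.1 t) P
  hasLaw_increment : ∀ s t : ℝ, s ≤ t →
    HasLaw (fun ω : PathSpace => ω.1 t - ω.1 s) (gaussianReal 0 (Real.toNNReal (t - s))) P

/-- The Wiener shift `θ_t ω = ω(· + t) - ω(t)`. -/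
def wienerShift (t : ℝ) (ω : PathSpace) : PathSpace :=
  ⟨⟨fun s => ω.1 (s + t) - ω.1 t, by fun_prop⟩, by simp⟩

theorem wienerShift_wienerShift (s t : ℝ) (ω : PathSpace) :
    wienerShift s (wienerShift t ω) = wienerShift (s + t) ω := by
  apply Subtype.ext
  ext r
  simp [wienerShift, add_assoc]

/-- The Ornstein-Uhlenbeck variable `z(ω) = -∫_{-∞}^0 e^τ ω(τ) dτ`; the Ornstein-Uhlenbeck
process is `t ↦ z(θ_t ω)`. -/
noncomputable def ouVar (ω : PathSpace) : ℝ :=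
  -∫ τ in Iic (0 : ℝ), Real.exp τ * ω.1 τ

/-- The paths for which the Ornstein-Uhlenbeck process is well defined and continuous, is
tempered, is sublinear at `±∞`, and has time averages tending to `0` at `±∞`. -/
structure IsRegularPath (ω : PathSpace) : Prop where
  integrableOn : ∀ t : ℝ,
    IntegrableOn (fun τ : ℝ => Real.exp τ * (wienerShift t ω).1 τ) (Iic 0)
  continuous : Continuous fun t : ℝ => ouVar (wienerShift t ω)
  tempered : ∀ γ : ℝ, 0 < γ →
    Tendsto (fun t : ℝ => Real.exp (-γ * t) * |ouVar (wienerShift (-t) ω)|) atTop (𝓝 0)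
  sublinear_atTop :
    Tendsto (fun t : ℝ => |ouVar (wienerShift t ω)| / |t|) atTop (𝓝 0)
  sublinear_atBot :
    Tendsto (fun t : ℝ => |ouVar (wienerShift t ω)| / |t|) atBot (𝓝 0)
  average_atTop :
    Tendsto (fun t : ℝ => 1 / t * ∫ s in (0 : ℝ)..t, ouVar (wienerShift s ω)) atTop (𝓝 0)
  average_atBot :
    Tendsto (fun t : ℝ => 1 / t * ∫ s in (0 : ℝ)..t, ouVar (wienerShift s ω)) atBot (𝓝 0)

theorem tendsto_abs_shift_div {f : ℝ → ℝ} (r : ℝ) {l : Filter ℝ}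
    (hl : Tendsto (fun t : ℝ => t + r) l l) (hinv : Tendsto (fun t : ℝ => t⁻¹) l (𝓝 0))
    (hne : ∀ᶠ t in l, t ≠ 0) (h : Tendsto (fun t => |f t| / |t|) l (𝓝 0)) :
    Tendsto (fun t => |f (t + r)| / |t|) l (𝓝 0) := by
  have h1 : Tendsto (fun t : ℝ => |1 + r * t⁻¹|) l (𝓝 |1 + r * 0|) :=
    (tendsto_const_nhds.add (hinv.const_mul r)).abs
  have h2 := (h.comp hl).mul h1
  rw [zero_mul] at h2
  refine h2.congr' ?_
  filter_upwards [hne, hl.eventually hne] with t ht ht'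
  have e : 1 + r * t⁻¹ = (t + r) / t := by field_simp
  have a1 : |t| ≠ 0 := abs_ne_zero.2 ht
  have a2 : |t + r| ≠ 0 := abs_ne_zero.2 ht'
  simp only [Function.comp, e, abs_div]
  field_simp

theorem tendsto_average_shift {f : ℝ → ℝ} (hf : Continuous f) (r : ℝ) {l : Filter ℝ}
    (hl : Tendsto (fun t : ℝ => t + r) l l) (hinv : Tendsto (fun t : ℝ => t⁻¹) l (𝓝 0))
    (hne : ∀ᶠ t in l, t ≠ 0)
    (h : Tendsto (fun t : ℝ => 1 / t * ∫ s in (0 : ℝ)..t, f s) l (𝓝 0)) :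
    Tendsto (fun t : ℝ => 1 / t * ∫ s in (0 : ℝ)..t, f (s + r)) l (𝓝 0) := by
  have h1 : Tendsto (fun t : ℝ => 1 + r * t⁻¹) l (𝓝 (1 + r * 0)) :=
    tendsto_const_nhds.add (hinv.const_mul r)
  have h2 := ((h.comp hl).mul h1).sub (hinv.mul_const (∫ s in (0 : ℝ)..r, f s))
  rw [zero_mul, zero_mul, sub_zero] at h2
  refine h2.congr' ?_
  filter_upwards [hne, hl.eventually hne] with t ht ht'
  have e : (∫ s in (0 : ℝ)..t, f (s + r))
      = (∫ s in (0 : ℝ)..(t + r), f s) - ∫ s in (0 : ℝ)..r, f s := by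
    rw [intervalIntegral.integral_comp_add_right, zero_add,
      intervalIntegral.integral_interval_sub_left (hf.intervalIntegrable _ _)
        (hf.intervalIntegrable _ _)]
  simp only [Function.comp, e]
  field_simp

theorem IsRegularPath.shift {ω : PathSpace} (h : IsRegularPath ω) (r : ℝ) :
    IsRegularPath (wienerShift r ω) := by
  have hT : Tendsto (fun t : ℝ => t + r) atTop atTop := tendsto_atTop_add_const_right _ _ tendsto_id
  have hB : Tendsto (fun t : ℝ => t + r) atBot atBot := tendsto_atBot_add_const_right _ _ tendsto_id
  refine ⟨fun t => ?_, ?_, fun γ hγ => ?_, ?_, ?_, ?_, ?_⟩ <;>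
    simp only [wienerShift_wienerShift]
  · exact h.integrableOn _
  · exact h.continuous.comp (continuous_add_const r)
  · have hS : Tendsto (fun t : ℝ => t - r) atTop atTop :=
      tendsto_atTop_add_const_right _ (-r) tendsto_id
    have h1 := ((h.tempered γ hγ).comp hS).const_mul (Real.exp (-γ * r))
    rw [mul_zero] at h1
    refine h1.congr fun t => ?_
    simp only [Function.comp]
    rw [← mul_assoc, ← Real.exp_add]
    congr 2
    · ring_nf
    · congr 3; ring
  · exact tendsto_abs_shift_div (f := fun t => ouVar (wienerShift t ω)) r hT
      tendsto_inv_atTop_zero (eventually_ne_atTop 0) h.sublinear_atTop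
  · exact tendsto_abs_shift_div (f := fun t => ouVar (wienerShift t ω)) r hB
      tendsto_inv_atBot_zero (eventually_ne_atBot 0) h.sublinear_atBot
  · exact tendsto_average_shift h.continuous r hT
      tendsto_inv_atTop_zero (eventually_ne_atTop 0) h.average_atTop
  · exact tendsto_average_shift h.continuous r hB
      tendsto_inv_atBot_zero (eventually_ne_atBot 0) h.average_atBot

/-- The sample space `Ω`: the shift-invariant set of regular paths, with the trace of the Borel
σ-algebra of `C₀(ℝ, ℝ)`. -/
def regularPaths : Set PathSpace := {ω | IsRegularPath ω}

/-- The Wiener shift on the sample space. -/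
def regularShift (t : ℝ) (ω : regularPaths) : regularPaths :=
  ⟨wienerShift t ω.1, IsRegularPath.shift ω.2 t⟩

/-- The restriction of a measure on `C₀(ℝ, ℝ)` to the sample space. -/
noncomputable def regularMeasure (P : Measure PathSpace) : Measure regularPaths :=
  P.comap Subtype.val

/-- The Ornstein-Uhlenbeck process `z(θ_t ω)` on the sample space. -/
noncomputable def ouPath (ω : regularPaths) (t : ℝ) : ℝ := ouVar (regularShift t ω).1

/-- The driving Wiener process `w(t)(ω) = ω(t)`, `t ≥ 0`. -/
def brownianPath (t : ℝ≥0) (ω : regularPaths) : ℝ := ω.1.1 t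

/-- The σ-algebra generated by `ω(r)`, `r ≤ t` (with `r` ranging over all reals `≤ t`). -/
@[reducible] def wienerPast (t : ℝ≥0) : MeasurableSpace regularPaths :=
  ⨆ r : Iic (t : ℝ), MeasurableSpace.comap (fun ω : regularPaths => ω.1.1 r.1) inferInstance

/-! ### Random dynamical systems -/

/-- `(Ω, 𝓕, P, (θ_t)_{t ∈ ℝ})` is a metric dynamical system. -/
structure IsMetricDynamicalSystem {Ω : Type*} [MeasurableSpace Ω] (P : Measure Ω)
    (θ : ℝ → Ω → Ω) : Prop where
  isProbabilityMeasure : IsProbabilityMeasure P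
  measurable_shift : Measurable fun q : ℝ × Ω => θ q.1 q.2
  shift_zero : θ 0 = id
  shift_add : ∀ s t : ℝ, θ (s + t) = θ t ∘ θ s
  measurePreserving : ∀ t : ℝ, MeasurePreserving (θ t) P P

/-- `φ` is a continuous random dynamical system on `H` over the metric dynamical system
`(Ω, 𝓕, P, θ)`. -/
structure IsContinuousRDS {Ω H : Type*} [MeasurableSpace Ω] [TopologicalSpace H]
    [MeasurableSpace H] (P : Measure Ω) (θ : ℝ → Ω → Ω) (φ : ℝ≥0 → Ω → H → H) : Prop
    extends IsMetricDynamicalSystem P θ where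
  measurable : Measurable fun q : ℝ≥0 × Ω × H => φ q.1 q.2.1 q.2.2
  continuous : ∀ (t : ℝ≥0) (ω : Ω), Continuous (φ t ω)
  zero : ∀ ω : Ω, φ 0 ω = id
  cocycle : ∀ (s t : ℝ≥0) (ω : Ω), φ (s + t) ω = φ t (θ s ω) ∘ φ s ω

/-! ### The lattice equations -/

/-- The phase space `ℓ²(ℤ)`, with its Borel σ-algebra. -/
abbrev EllTwo : Type := lp (fun _ : ℤ => ℝ) 2

noncomputable instance instMeasurableSpaceEllTwo : MeasurableSpace EllTwo := borel _

instance instBorelSpaceEllTwo : BorelSpace EllTwo := ⟨rfl⟩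

/-- Bounded real sequences indexed by `ℤ`. -/
abbrev EllInfty : Type := lp (fun _ : ℤ => ℝ) ∞

/-- The operator `(A x)_i = -x_{i-1} + 2 x_i - x_{i+1}`. -/
def latticeA (x : ℤ → ℝ) (i : ℤ) : ℝ := -x (i - 1) + 2 * x i - x (i + 1)

/-- The operator `x ↦ e^{α r} x = (e^{α_i r} x_i)_i` on `ℓ²(ℤ)`, for a bounded sequence `α`. -/
noncomputable def expMul (α : EllInfty) (r : ℝ) (x : EllTwo) : EllTwo :=
  ⟨fun i => Real.exp (α i * r) * x i, by
    have hx : Memℓp (fun i => Real.exp (‖α‖ * |r|) * ‖x i‖) 2 := (lp.memℓp x).norm.const_mul _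
    refine hx.mono fun i => ?_
    have h1 : α i * r ≤ ‖α‖ * |r| := by
      have := lp.norm_apply_le_norm ENNReal.top_ne_zero α i
      calc α i * r ≤ |α i * r| := le_abs_self _
        _ = |α i| * |r| := abs_mul _ _
        _ ≤ ‖α‖ * |r| := by gcongr; exact this
    rw [norm_mul, Real.norm_of_nonneg (Real.exp_pos _).le]
    gcongr⟩

/-- The `i`-th coordinate of the right-hand side of the random equation
`v' = -e^{-αz} A(Φ(e^{αz} v)) + (αz - λ) v - λ e^{α(p-1)z} |v|^{p-1} v + e^{-αz} g`. -/
noncomputable def randomField (p lam : ℝ) (Φ : ℝ → ℝ) (α : EllInfty) (g : EllTwo)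
    (z : ℝ) (v : EllTwo) (i : ℤ) : ℝ :=
  -Real.exp (-α i * z) * latticeA (fun j => Φ (Real.exp (α j * z) * v j)) i
    + (α i * z - lam) * v i
    - lam * Real.exp (α i * (p - 1) * z) * (|v i| ^ (p - 1) * v i)
    + Real.exp (-α i * z) * g i

/-- `v` solves, on the time interval `I`, the random equation with noise path `z` and initial
value `v₀`, as a differential equation in `ℓ²(ℤ)`. -/
structure IsRandomSolution (p lam : ℝ) (Φ : ℝ → ℝ) (α : EllInfty) (g : EllTwo)
    (z : ℝ → ℝ) (v₀ : EllTwo) (I : Set ℝ) (v : ℝ → EllTwo) : Prop where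
  initial : v 0 = v₀
  ode : ∀ t ∈ I, ∃ v' : EllTwo,
    (∀ i : ℤ, v' i = randomField p lam Φ α g (z t) (v t) i) ∧ HasDerivWithinAt v v' I t

/-- The `i`-th coordinate of the drift `-A(Φ(u)) - λ(u + |u|^{p-1} u) + g` of the stochastic
equation. -/
noncomputable def stochasticDrift (p lam : ℝ) (Φ : ℝ → ℝ) (g : EllTwo) (u : EllTwo)
    (i : ℤ) : ℝ :=
  -latticeA (fun j => Φ (u j)) i - lam * (u i + |u i| ^ (p - 1) * u i) + g i

/-- `J` is the Stratonovich integral `∫₀ᵗ X ∘ dw`: along every sequence of partitions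
`0 = π_0 ≤ ⋯ ≤ π_N = t` with mesh tending to `0`, the trapezoidal sums
`∑ (X(π_k) + X(π_{k+1})) / 2 * (w(π_{k+1}) - w(π_k))` converge to `J` in probability. -/
def IsStratonovichIntegral {Ω H : Type*} [MeasurableSpace Ω] [NormedAddCommGroup H]
    [NormedSpace ℝ H] (P : Measure Ω) (w : ℝ≥0 → Ω → ℝ) (X : ℝ≥0 → Ω → H) (t : ℝ≥0)
    (J : Ω → H) : Prop :=
  ∀ (N : ℕ → ℕ) (π : ℕ → ℕ → ℝ≥0),
    (∀ n, Monotone (π n)) → (∀ n, π n 0 = 0) → (∀ n, π n (N n) = t) →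
    (∀ ε : ℝ, 0 < ε → ∀ᶠ n in atTop, ∀ k < N n, (π n (k + 1) : ℝ) - π n k < ε) →
    TendstoInMeasure P
      (fun n ω => ∑ k ∈ Finset.range (N n),
        (w (π n (k + 1)) ω - w (π n k) ω) • ((1 / 2 : ℝ) • (X (π n k) ω + X (π n (k + 1)) ω)))
      atTop J

/-- The `ℓ²(ℤ)`-valued process `u` solves the stochastic lattice equation
`u(t) = u₀ + ∫₀ᵗ [-A(Φ(u)) - λ(u + |u|^{p-1} u) + g] ds + α ∫₀ᵗ u ∘ dw`:
it is adapted to `𝓕`, has continuous paths, and satisfies the equation almost surely for all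
`t ≥ 0`, the last integral being the `ℓ²(ℤ)`-valued Stratonovich integral. -/
structure IsStratonovichSolution {Ω : Type*} [MeasurableSpace Ω] (P : Measure Ω)
    (𝓕 : ℝ≥0 → MeasurableSpace Ω) (w : ℝ≥0 → Ω → ℝ) (p lam : ℝ) (Φ : ℝ → ℝ)
    (α : EllInfty) (g : EllTwo) (u₀ : Ω → EllTwo) (u : ℝ≥0 → Ω → EllTwo) : Prop where
  adapted : ∀ t, Measurable[𝓕 t] (u t)
  continuous : ∀ ω, Continuous fun t => u t ω
  equation : ∃ S : ℝ≥0 → Ω → EllTwo, (∀ t, IsStratonovichIntegral P w u t (S t)) ∧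
    ∀ᵐ ω ∂P, ∀ (t : ℝ≥0) (i : ℤ), u t ω i = u₀ ω i
      + (∫ s in (0 : ℝ)..t, stochasticDrift p lam Φ g (u s.toNNReal ω) i) + α i * S t ω i

/-!
The noise enters the Stratonovich equation linearly and through the commuting multipliers
`e^{α r}`, so the substitution `u = e^{α w} h` (Doss-Sussmann) turns it, path by path, into the
ordinary differential equation `h' = e^{-α w} B(e^{α w} h)` in `ℓ²(ℤ)`, where
`B(u) = -A Φ(u) - λ (u + |u|^{p-1} u) + g` is locally Lipschitz. Its solution map `conjFlow` is
defined for every continuous path `w`. For a regular path, the Langevin equation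
`w(t) = z(θ_t ω) - z(ω) + ∫₀ᵗ z(θ_s ω) ds` shows that `v = e^{-α z} u` is `h` multiplied by an
exponential that is differentiable in time, and the product rule gives the random equation. The
same computation read backwards gives uniqueness, and the cocycle property is the flow property of
the Stratonovich equation along the shifted path (`LatticeSystem.pathFlow_add`).

*Global existence.* The nonlinearities are truncated at level `n`, which makes `B` globally
Lipschitz, so Picard iteration applies and also yields measurability in the path. What has to be
shown is a bound on bounded time intervals that does not depend on `n`
(`LatticeSystem.exists_norm_truncFlow_le`). The multipliers `e^{α r}` do not commute with the
coupling `A`, and `w` is not differentiable, so neither `u` nor `h` satisfies a direct energy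
estimate. The remedy is to approximate `w` uniformly by a polynomial `m` and to estimate
`q = e^{α m} h`: this function is differentiable, and in the energy identity the drift is weighted
by `e^{-2 α (w - m)}`, which is as close to `1` as desired. With weight `1` the coupling term has a
sign, since `Φ` is increasing; the error made by the weight is controlled by the damping, because
`|Φ(u)| ≤ c (|u| + |u|^p)` has the same growth as the damping
(`LatticeSystem.inner_mulOp_truncDrift_le`).

*The sample space.* Since `z(θ_t ω) = ω(t) - e^{-t} ∫_{-∞}^t e^s ω(s) ds`, a path is regular if and
only if it grows sublinearly (`isRegularPath_iff`), and this is a countable family of measurable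
conditions. Almost every Brownian path grows sublinearly, by a maximal inequality obtained from
fourth moments and dyadic chaining, and the Borel-Cantelli lemma
(`IsWienerMeasure.ae_isSublinear`). The shift preserves the Wiener measure because
finite-dimensional laws are determined by increments (`IsWienerMeasure.map_wienerShift`).

*The Stratonovich integral.* With `K' = e^{α ·}` and `K(0) = 0`, the integral of `u = e^{α w} h`
against `w` is `K(w_t) h(t) - ∫₀ᵗ K(w_s) h'(s) ds`. After summation by parts, the trapezoidal sums
differ from this by a pathwise constant times the sum of the cubed increments of `w` plus the
oscillation of `w` over the partition (`exists_norm_trapezoid_sum_sub_le`), because the trapezoidal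
rule for `e^{α ·}` has a cubic error. The oscillation tends to `0` by uniform continuity and the
cubic variation tends to `0` in `L¹`.
-/

/-! ### Operators on `ℓ²(ℤ)` -/

/-- `ℓ²(ℤ)` is separable, since finitely supported sequences are dense. Separability makes Borel
measurability in `ℓ²(ℤ)` compatible with sums, products and Bochner integrals. -/
instance instSecondCountableTopologyEllTwo : SecondCountableTopology EllTwo := by
  let b : HilbertBasis ℤ ℝ EllTwo := default
  have h1 : TopologicalSpace.IsSeparable (Submodule.span ℝ (range b) : Set EllTwo) :=
    (countable_range b).isSeparable.span
  have h2 := h1.closure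
  rw [← Submodule.topologicalClosure_coe, b.dense_span, Submodule.top_coe] at h2
  have : TopologicalSpace.SeparableSpace EllTwo := TopologicalSpace.isSeparable_univ_iff.1 h2
  exact UniformSpace.secondCountable_of_separable EllTwo

theorem EllTwo.ext_apply {x y : EllTwo} (h : ∀ i, x i = y i) : x = y := lp.ext (funext h)

theorem EllTwo.abs_apply_le_norm (x : EllTwo) (i : ℤ) : |x i| ≤ ‖x‖ :=
  lp.norm_apply_le_norm two_ne_zero x i

/-- Evaluation at the `i`-th coordinate. -/
noncomputable def EllTwo.coord (i : ℤ) : EllTwo →L[ℝ] ℝ :=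
  LinearMap.mkContinuous ⟨⟨fun x => x i, fun _ _ => rfl⟩, fun _ _ => rfl⟩ 1 fun x => by
    rw [one_mul]; exact EllTwo.abs_apply_le_norm x i

@[simp] theorem EllTwo.coord_apply (i : ℤ) (x : EllTwo) : EllTwo.coord i x = x i := rfl

theorem EllTwo.memℓp_mul (a : EllInfty) (x : EllTwo) : Memℓp (fun i => a i * x i) 2 := by
  refine ((lp.memℓp x).norm.const_mul ‖a‖).mono fun i => ?_
  rw [norm_mul]
  exact mul_le_mul_of_nonneg_right (lp.norm_apply_le_norm ENNReal.top_ne_zero a i) (norm_nonneg _)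

/-- The coordinatewise action of a bounded sequence on `ℓ²(ℤ)`. -/
noncomputable def mulOp : EllInfty →L[ℝ] EllTwo →L[ℝ] EllTwo :=
  LinearMap.mkContinuous₂
    (LinearMap.mk₂ ℝ (fun (a : EllInfty) (x : EllTwo) => (⟨_, EllTwo.memℓp_mul a x⟩ : EllTwo))
      (fun a b x => EllTwo.ext_apply fun i => add_mul (a i) (b i) (x i))
      (fun c a x => EllTwo.ext_apply fun i => mul_assoc c (a i) (x i))
      (fun a x y => EllTwo.ext_apply fun i => mul_add (a i) (x i) (y i))
      (fun c a x => EllTwo.ext_apply fun i => mul_left_comm (a i) c (x i)))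
    1 fun a x => by
      rw [one_mul]
      have h : ‖‖a‖ • x‖ = ‖a‖ * ‖x‖ := by rw [norm_smul, norm_norm]
      rw [← h]
      refine lp.norm_mono two_ne_zero fun i => ?_
      change ‖a i * x i‖ ≤ ‖‖a‖ * x i‖
      rw [norm_mul, norm_mul, norm_norm]
      exact mul_le_mul_of_nonneg_right (lp.norm_apply_le_norm ENNReal.top_ne_zero a i)
        (norm_nonneg _)

@[simp] theorem mulOp_apply_coe (a : EllInfty) (x : EllTwo) (i : ℤ) :
    mulOp a x i = a i * x i := rfl

theorem norm_mulOp_apply_le (a : EllInfty) (x : EllTwo) : ‖mulOp a x‖ ≤ ‖a‖ * ‖x‖ := by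
  have h : ‖mulOp a‖ ≤ 1 * ‖a‖ :=
    mulOp.le_of_opNorm_le (LinearMap.mkContinuous₂_norm_le _ zero_le_one _) a
  calc _ ≤ ‖mulOp a‖ * ‖x‖ := (mulOp a).le_opNorm x
    _ ≤ _ := by rw [one_mul] at h; gcongr

theorem mulOp_mul_apply (a b : EllInfty) (x : EllTwo) :
    mulOp (a * b) x = mulOp a (mulOp b x) :=
  EllTwo.ext_apply fun i => mul_assoc (a i) (b i) (x i)

theorem mulOp_one_apply (x : EllTwo) : mulOp 1 x = x :=
  EllTwo.ext_apply fun i => one_mul (x i)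

/-- The bounded sequence `e^{r α}`, as an exponential in the Banach algebra `ℓ^∞(ℤ)`. -/
noncomputable def expSeq (α : EllInfty) (r : ℝ) : EllInfty := NormedSpace.exp (r • α)

/-- Evaluation of a bounded sequence at `i`, as a ring homomorphism. -/
noncomputable def EllInfty.coordHom (i : ℤ) : EllInfty →+* ℝ where
  toFun a := a i
  map_zero' := rfl
  map_one' := rfl
  map_add' _ _ := rfl
  map_mul' _ _ := rfl

theorem EllInfty.continuous_coordHom (i : ℤ) : Continuous (EllInfty.coordHom i) :=
  (lp.lipschitzWith_one_eval ∞ i).continuous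

theorem expSeq_apply (α : EllInfty) (r : ℝ) (i : ℤ) : expSeq α r i = Real.exp (α i * r) := by
  let : NormedAlgebra ℚ EllInfty := NormedAlgebra.restrictScalars ℚ ℝ EllInfty
  have h := NormedSpace.map_exp (EllInfty.coordHom i) (EllInfty.continuous_coordHom i) (r • α)
  rw [← Real.exp_eq_exp_ℝ] at h
  change expSeq α r i = Real.exp (r * α i) at h
  rw [h, mul_comm]

theorem EllInfty.ext_apply {a b : EllInfty} (h : ∀ i, a i = b i) : a = b := lp.ext (funext h)

theorem expSeq_add (α : EllInfty) (r s : ℝ) : expSeq α (r + s) = expSeq α r * expSeq α s :=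
  EllInfty.ext_apply fun i => by
    rw [lp.infty_coeFn_mul, Pi.mul_apply, expSeq_apply, expSeq_apply, expSeq_apply, mul_add,
      Real.exp_add]

theorem expSeq_zero (α : EllInfty) : expSeq α 0 = 1 := by
  rw [expSeq, zero_smul, NormedSpace.exp_zero]

theorem hasDerivAt_expSeq (α : EllInfty) (r : ℝ) :
    HasDerivAt (expSeq α) (α * expSeq α r) r := by
  rw [mul_comm]; exact hasDerivAt_exp_smul_const α r

theorem continuous_expSeq (α : EllInfty) : Continuous (expSeq α) :=
  continuous_iff_continuousAt.2 fun r => (hasDerivAt_expSeq α r).continuousAt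

theorem norm_expSeq_le (α : EllInfty) (r : ℝ) : ‖expSeq α r‖ ≤ Real.exp (‖α‖ * |r|) := by
  refine lp.norm_le_of_forall_le (Real.exp_pos _).le fun i => ?_
  rw [expSeq_apply, Real.norm_of_nonneg (Real.exp_pos _).le]
  refine Real.exp_le_exp.2 ((le_abs_self _).trans ?_)
  rw [abs_mul]
  exact mul_le_mul_of_nonneg_right (lp.norm_apply_le_norm ENNReal.top_ne_zero α i) (abs_nonneg _)

theorem expMul_eq_mulOp (α : EllInfty) (r : ℝ) (x : EllTwo) :
    expMul α r x = mulOp (expSeq α r) x :=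
  EllTwo.ext_apply fun i => by rw [mulOp_apply_coe, expSeq_apply]; rfl

theorem expMul_apply (α : EllInfty) (r : ℝ) (x : EllTwo) (i : ℤ) :
    expMul α r x i = Real.exp (α i * r) * x i := rfl

theorem expMul_add (α : EllInfty) (r s : ℝ) (x : EllTwo) :
    expMul α (r + s) x = expMul α r (expMul α s x) := by
  simp only [expMul_eq_mulOp, expSeq_add, mulOp_mul_apply]

theorem expMul_zero (α : EllInfty) (x : EllTwo) : expMul α 0 x = x := by
  rw [expMul_eq_mulOp, expSeq_zero, mulOp_one_apply]

theorem expMul_neg_expMul (α : EllInfty) (r : ℝ) (x : EllTwo) :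
    expMul α (-r) (expMul α r x) = x := by
  rw [← expMul_add, neg_add_cancel, expMul_zero]

theorem expMul_expMul_neg (α : EllInfty) (r : ℝ) (x : EllTwo) :
    expMul α r (expMul α (-r) x) = x := by
  rw [← expMul_add, add_neg_cancel, expMul_zero]

theorem expMul_sub (α : EllInfty) (r : ℝ) (x y : EllTwo) :
    expMul α r x - expMul α r y = expMul α r (x - y) := by
  simp only [expMul_eq_mulOp, map_sub]

theorem norm_expMul_le (α : EllInfty) (r : ℝ) (x : EllTwo) :
    ‖expMul α r x‖ ≤ Real.exp (‖α‖ * |r|) * ‖x‖ := by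
  rw [expMul_eq_mulOp]
  exact (norm_mulOp_apply_le _ _).trans
    (mul_le_mul_of_nonneg_right (norm_expSeq_le α r) (norm_nonneg x))

theorem continuous_uncurry_expMul (α : EllInfty) :
    Continuous fun q : ℝ × EllTwo => expMul α q.1 q.2 := by
  simp only [expMul_eq_mulOp]
  exact (mulOp.continuous.comp ((continuous_expSeq α).comp continuous_fst)).clm_apply
    continuous_snd

theorem Continuous.expMul {X : Type*} [TopologicalSpace X] (α : EllInfty) {r : X → ℝ}
    {x : X → EllTwo} (hr : Continuous r) (hx : Continuous x) :
    Continuous fun t => expMul α (r t) (x t) :=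
  (continuous_uncurry_expMul α).comp (hr.prodMk hx)

theorem Measurable.expMul {X : Type*} [MeasurableSpace X] (α : EllInfty) {r : X → ℝ}
    {x : X → EllTwo} (hr : Measurable r) (hx : Measurable x) :
    Measurable fun t => expMul α (r t) (x t) :=
  (continuous_uncurry_expMul α).measurable.comp (hr.prodMk hx)

/-- The product rule for `e^{α r(t)} x(t)`. -/
theorem HasDerivWithinAt.expMul (α : EllInfty) {r : ℝ → ℝ} {x : ℝ → EllTwo} {r' t : ℝ}
    {x' : EllTwo} {s : Set ℝ} (hr : HasDerivWithinAt r r' s t) (hx : HasDerivWithinAt x x' s t) :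
    HasDerivWithinAt (fun t => expMul α (r t) (x t))
      (expMul α (r t) (x' + r' • mulOp α (x t))) s t := by
  simp only [expMul_eq_mulOp]
  have h1 : HasDerivWithinAt (fun t => expSeq α (r t)) (r' • (α * expSeq α (r t))) s t :=
    (hasDerivAt_expSeq α (r t)).scomp_hasDerivWithinAt t hr
  have h2 := (mulOp.hasFDerivAt.comp_hasDerivWithinAt t h1).clm_apply hx
  refine h2.congr_deriv ?_
  rw [map_smul, smul_apply, mulOp_mul_apply, map_add, map_smul, add_comm,
    ← mulOp_mul_apply, ← mulOp_mul_apply, mul_comm]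
  rfl

/-- The translation `(x_i) ↦ (x_{i+k})` of `ℓ²(ℤ)`. -/
noncomputable def shiftSeq (k : ℤ) (x : EllTwo) : EllTwo :=
  ⟨fun i => x (i + k), by
    have h := (lp.memℓp x).summable (by simp)
    exact memℓp_gen (((Equiv.addRight k).summable_iff (f := fun i => ‖x i‖ ^ (2 : ℝ≥0∞).toReal)).2 h)⟩

@[simp] theorem shiftSeq_apply (k : ℤ) (x : EllTwo) (i : ℤ) : shiftSeq k x i = x (i + k) := rfl

theorem norm_shiftSeq (k : ℤ) (x : EllTwo) : ‖shiftSeq k x‖ = ‖x‖ := by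
  rw [lp.norm_eq_tsum_rpow (by simp), lp.norm_eq_tsum_rpow (by simp)]
  congr 1
  exact (Equiv.addRight k).tsum_eq (fun i => ‖x i‖ ^ (2 : ℝ≥0∞).toReal)

/-- The operator `(A x)_i = -x_{i-1} + 2 x_i - x_{i+1}` on `ℓ²(ℤ)`. -/
noncomputable def latticeOp (x : EllTwo) : EllTwo :=
  (2 : ℝ) • x - shiftSeq (-1) x - shiftSeq 1 x

theorem latticeOp_apply (x : EllTwo) (i : ℤ) : latticeOp x i = latticeA x i := by
  change 2 * x i - x (i + -1) - x (i + 1) = -x (i - 1) + 2 * x i - x (i + 1)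
  rw [← sub_eq_add_neg]; ring

theorem latticeOp_sub (x y : EllTwo) : latticeOp x - latticeOp y = latticeOp (x - y) :=
  EllTwo.ext_apply fun i => by
    change latticeOp x i - latticeOp y i = latticeOp (x - y) i
    simp only [latticeOp_apply, latticeA]
    change _ = -(x (i - 1) - y (i - 1)) + 2 * (x i - y i) - (x (i + 1) - y (i + 1))
    ring

theorem norm_latticeOp_le (x : EllTwo) : ‖latticeOp x‖ ≤ 4 * ‖x‖ := by
  have h1 : ‖(2 : ℝ) • x‖ = 2 * ‖x‖ := by rw [norm_smul]; simp
  have h2 := norm_sub_le ((2 : ℝ) • x - shiftSeq (-1) x) (shiftSeq 1 x)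
  have h3 := norm_sub_le ((2 : ℝ) • x) (shiftSeq (-1) x)
  rw [norm_shiftSeq] at h2 h3
  rw [latticeOp]
  linarith

/-- The Nemytskii operator `(x_i) ↦ (f(x_i))` of a Lipschitz function `f` with `f 0 = 0`. -/
noncomputable def nemytskii {K : ℝ≥0} {f : ℝ → ℝ} (hf : LipschitzWith K f) (h0 : f 0 = 0)
    (x : EllTwo) : EllTwo :=
  ⟨fun i => f (x i), ((lp.memℓp x).norm.const_mul (K : ℝ)).mono fun i => by
    have := hf.dist_le_mul (x i) 0
    rwa [h0, dist_zero_right, dist_zero_right] at this⟩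

theorem lipschitzWith_nemytskii {K : ℝ≥0} {f : ℝ → ℝ} (hf : LipschitzWith K f) (h0 : f 0 = 0) :
    LipschitzWith K (nemytskii hf h0) := by
  refine LipschitzWith.of_dist_le_mul fun x y => ?_
  have h : ‖(K : ℝ) • (x - y)‖ = K * ‖x - y‖ := by
    rw [norm_smul, Real.norm_of_nonneg K.coe_nonneg]
  rw [dist_eq_norm, dist_eq_norm, ← h]
  refine lp.norm_mono two_ne_zero fun i => ?_
  change ‖f (x i) - f (y i)‖ ≤ ‖(K : ℝ) * (x i - y i)‖
  have := hf.dist_le_mul (x i) (y i)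
  rwa [norm_mul, Real.norm_of_nonneg K.coe_nonneg, ← dist_eq_norm, ← dist_eq_norm]

theorem EllTwo.hasSum_inner (x y : EllTwo) : HasSum (fun i => x i * y i) (inner ℝ x y) := by
  refine (lp.hasSum_inner x y).congr_fun ?_
  intro i; exact mul_comm _ _

/-! ### Picard iteration for globally Lipschitz fields -/

section Picard

variable {H : Type*} [NormedAddCommGroup H] [NormedSpace ℝ H]

/-- A time-dependent vector field that is jointly continuous and, for times in a bounded interval
`[0, T]`, uniformly Lipschitz on the whole space. -/
structure IsGlobalField (G : ℝ → H → H) : Prop where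
  continuous : Continuous fun q : ℝ × H => G q.1 q.2
  lipschitz : ∀ T : ℝ, ∃ K : ℝ≥0, ∀ t ∈ Icc 0 T, LipschitzWith K (G t)

/-- The Picard iterates for `x' = G(t, x)`, `x(0) = x₀`. -/
noncomputable def picardIter (G : ℝ → H → H) (x₀ : H) : ℕ → ℝ → H
  | 0, _ => x₀
  | n + 1, t => x₀ + ∫ s in (0 : ℝ)..t, G s (picardIter G x₀ n s)

/-- The solution of `x' = G(t, x)`, `x(0) = x₀` for `t ≥ 0`, as the limit of the Picard iterates;
it is frozen at its initial value for `t ≤ 0`. -/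
noncomputable def picardFlow (G : ℝ → H → H) (x₀ : H) (t : ℝ) : H :=
  limUnder atTop fun n => picardIter G x₀ n (max t 0)

variable {G : ℝ → H → H}

theorem IsGlobalField.continuous_picardIter (hG : IsGlobalField G) (x₀ : H) (n : ℕ) :
    Continuous (picardIter G x₀ n) := by
  induction n with
  | zero => exact continuous_const
  | succ n ih =>
    have h : Continuous fun s => G s (picardIter G x₀ n s) :=
      hG.continuous.comp (continuous_id.prodMk ih)
    exact continuous_const.add
      (intervalIntegral.continuous_primitive (fun a b => h.intervalIntegrable a b) 0)

/-- The iterates contract by a factor `1 / 2` in the norm weighted by `e^{-2 K t}`. -/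
theorem IsGlobalField.exists_dist_picardIter_le (hG : IsGlobalField G) (x₀ : H) (T : ℝ) :
    ∃ C : ℝ, ∀ n : ℕ, ∀ t ∈ Icc 0 T,
      dist (picardIter G x₀ n t) (picardIter G x₀ (n + 1) t) ≤ C * (1 / 2) ^ n := by
  obtain ⟨K, hK⟩ := hG.lipschitz T
  obtain ⟨C, hC⟩ := (isCompact_Icc (a := (0 : ℝ)) (b := T)).exists_bound_of_continuousOn
    ((hG.continuous_picardIter x₀ 0).sub (hG.continuous_picardIter x₀ 1)).continuousOn
  have key : ∀ n : ℕ, ∀ t ∈ Icc 0 T,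
      ‖picardIter G x₀ n t - picardIter G x₀ (n + 1) t‖
        ≤ |C| * (1 / 2) ^ n * Real.exp (2 * K * t) := by
    intro n
    induction n with
    | zero =>
      intro t ht
      have h1 : (1 : ℝ) ≤ Real.exp (2 * K * t) :=
        Real.one_le_exp (mul_nonneg (by positivity) ht.1)
      refine (hC t ht).trans ((le_abs_self C).trans ?_)
      rw [pow_zero, mul_one]
      exact le_mul_of_one_le_right (abs_nonneg C) h1
    | succ n ih =>
      intro t ht
      have hc : ∀ m, Continuous fun s => G s (picardIter G x₀ m s) := fun m =>
        hG.continuous.comp (continuous_id.prodMk (hG.continuous_picardIter x₀ m))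
      have e : picardIter G x₀ (n + 1) t - picardIter G x₀ (n + 1 + 1) t
          = ∫ s in (0 : ℝ)..t, (G s (picardIter G x₀ n s) - G s (picardIter G x₀ (n + 1) s)) := by
        rw [intervalIntegral.integral_sub ((hc n).intervalIntegrable _ _)
          ((hc (n + 1)).intervalIntegrable _ _)]
        change (x₀ + _) - (x₀ + _) = _
        abel
      have hd : ∀ s ∈ uIcc 0 t, HasDerivAt
          (fun s => |C| * (1 / 2) ^ (n + 1) * Real.exp (2 * K * s))
          (|C| * (1 / 2) ^ (n + 1) * (Real.exp (2 * K * s) * (2 * K * 1))) s := fun s _ =>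
        (((hasDerivAt_id s).const_mul (2 * (K : ℝ))).exp).const_mul _
      have hi : IntervalIntegrable (fun s => |C| * (1 / 2) ^ (n + 1) *
          (Real.exp (2 * K * s) * (2 * K * 1))) volume 0 t :=
        Continuous.intervalIntegrable (by fun_prop) _ _
      rw [e]
      calc _ ≤ ∫ s in (0 : ℝ)..t, |C| * (1 / 2) ^ (n + 1) * (Real.exp (2 * K * s) * (2 * K * 1)) := by
            refine intervalIntegral.norm_integral_le_of_norm_le ht.1 (ae_of_all _ fun s hs => ?_) hi
            have hs' : s ∈ Icc 0 T := ⟨hs.1.le, hs.2.trans ht.2⟩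
            have h1 := (hK s hs').dist_le_mul (picardIter G x₀ n s) (picardIter G x₀ (n + 1) s)
            rw [dist_eq_norm, dist_eq_norm] at h1
            have h2 := mul_le_mul_of_nonneg_left (ih s hs') K.coe_nonneg
            refine h1.trans (h2.trans (le_of_eq ?_))
            rw [pow_succ]; ring
        _ = |C| * (1 / 2) ^ (n + 1) * Real.exp (2 * K * t) - |C| * (1 / 2) ^ (n + 1) := by
            rw [intervalIntegral.integral_eq_sub_of_hasDerivAt hd hi]; simp
        _ ≤ _ := sub_le_self _ (by positivity)
  refine ⟨|C| * Real.exp (2 * K * T), fun n t ht => ?_⟩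
  rw [dist_eq_norm]
  refine (key n t ht).trans ?_
  rw [mul_right_comm]
  gcongr
  exact ht.2

theorem picardFlow_of_nonpos (x₀ : H) {t : ℝ} (ht : t ≤ 0) :
    picardFlow G x₀ t = x₀ := by
  have h : ∀ n, picardIter G x₀ n (max t 0) = x₀ := by
    rw [max_eq_right ht]
    rintro (_ | n)
    · rfl
    · simp [picardIter]
  rw [picardFlow]
  simp only [h]
  exact tendsto_const_nhds.limUnder_eq

variable [CompleteSpace H]

theorem IsGlobalField.tendsto_picardIter (hG : IsGlobalField G) (x₀ : H) {t : ℝ} (ht : 0 ≤ t) :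
    Tendsto (fun n => picardIter G x₀ n t) atTop (𝓝 (picardFlow G x₀ t)) := by
  obtain ⟨C, hC⟩ := hG.exists_dist_picardIter_le x₀ t
  rw [picardFlow, max_eq_left ht]
  exact (cauchySeq_of_le_geometric (1 / 2) C (by norm_num)
    fun n => hC n t ⟨ht, le_rfl⟩).tendsto_limUnder

theorem IsGlobalField.exists_dist_picardFlow_le (hG : IsGlobalField G) (x₀ : H) (T : ℝ) :
    ∃ C : ℝ, ∀ n : ℕ, ∀ t ∈ Icc 0 T,
      dist (picardIter G x₀ n t) (picardFlow G x₀ t) ≤ C * (1 / 2) ^ n := by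
  obtain ⟨C, hC⟩ := hG.exists_dist_picardIter_le x₀ T
  refine ⟨2 * C, fun n t ht => ?_⟩
  have h := dist_le_of_le_geometric_of_tendsto (1 / 2) C (by norm_num)
    (fun n => hC n t ht) (hG.tendsto_picardIter x₀ ht.1) n
  refine h.trans (le_of_eq ?_)
  ring

theorem IsGlobalField.continuous_picardFlow (hG : IsGlobalField G) (x₀ : H) :
    Continuous (picardFlow G x₀) := by
  have h1 : ∀ T, ContinuousOn (picardFlow G x₀) (Icc 0 T) := fun T => by
    obtain ⟨C, hC⟩ := hG.exists_dist_picardFlow_le x₀ T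
    have h0 : Tendsto (fun n : ℕ => C * (1 / 2 : ℝ) ^ n) atTop (𝓝 0) := by
      simpa using (tendsto_pow_atTop_nhds_zero_of_lt_one (r := (1 / 2 : ℝ)) (by norm_num)
        (by norm_num)).const_mul C
    have hu : TendstoUniformlyOn (picardIter G x₀) (picardFlow G x₀) atTop (Icc 0 T) := by
      refine Metric.tendstoUniformlyOn_iff.2 fun ε hε => ?_
      filter_upwards [h0.eventually (gt_mem_nhds hε)] with n hn t ht
      rw [dist_comm]
      exact (hC n t ht).trans_lt hn
    exact hu.continuousOn (Frequently.of_forall fun n => (hG.continuous_picardIter x₀ n).continuousOn)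
  have h2 : ContinuousOn (picardFlow G x₀) (Ici 0) := fun t ht =>
    (h1 (t + 1) t ⟨ht, by linarith⟩).mono_of_mem_nhdsWithin
      (mem_nhdsWithin.2 ⟨Iio (t + 1), isOpen_Iio, by simp, fun s hs => ⟨hs.2, hs.1.le⟩⟩)
  have h3 : picardFlow G x₀ = picardFlow G x₀ ∘ fun t => max t 0 := by
    funext t
    simp [picardFlow]
  rw [h3]
  exact h2.comp_continuous (by fun_prop) fun t => le_max_right t 0

theorem IsGlobalField.picardFlow_eq (hG : IsGlobalField G) (x₀ : H) {t : ℝ} (ht : 0 ≤ t) :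
    picardFlow G x₀ t = x₀ + ∫ s in (0 : ℝ)..t, G s (picardFlow G x₀ s) := by
  obtain ⟨C, hC⟩ := hG.exists_dist_picardFlow_le x₀ t
  obtain ⟨K, hK⟩ := hG.lipschitz t
  have hc : ∀ {f : ℝ → H}, Continuous f → Continuous fun s => G s (f s) := fun hf =>
    hG.continuous.comp (continuous_id.prodMk hf)
  have hf := hc (hG.continuous_picardFlow x₀)
  have h1 : Tendsto (fun n => picardIter G x₀ (n + 1) t) atTop
      (𝓝 (x₀ + ∫ s in (0 : ℝ)..t, G s (picardFlow G x₀ s))) := by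
    rw [tendsto_iff_dist_tendsto_zero]
    have h0 : Tendsto (fun n : ℕ => K * (C * (1 / 2 : ℝ) ^ n) * |t - 0|) atTop (𝓝 0) := by
      simpa using (((tendsto_pow_atTop_nhds_zero_of_lt_one (r := (1 / 2 : ℝ)) (by norm_num)
        (by norm_num)).const_mul C).const_mul (K : ℝ)).mul_const |t - 0|
    refine squeeze_zero (fun _ => dist_nonneg) (fun n => ?_) h0
    rw [picardIter, dist_add_left, dist_eq_norm, ← intervalIntegral.integral_sub
      ((hc (hG.continuous_picardIter x₀ n)).intervalIntegrable _ _) (hf.intervalIntegrable _ _)]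
    refine intervalIntegral.norm_integral_le_of_norm_le_const fun s hs => ?_
    rw [uIoc_of_le ht] at hs
    have hs' : s ∈ Icc 0 t := ⟨hs.1.le, hs.2⟩
    rw [← dist_eq_norm]
    exact ((hK s hs').dist_le_mul _ _).trans
      (mul_le_mul_of_nonneg_left (hC n s hs') K.coe_nonneg)
  exact tendsto_nhds_unique ((hG.tendsto_picardIter x₀ ht).comp (tendsto_add_atTop_nat 1)) h1

theorem IsGlobalField.hasDerivWithinAt_picardFlow (hG : IsGlobalField G) (x₀ : H) {t : ℝ}
    (ht : 0 ≤ t) :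
    HasDerivWithinAt (picardFlow G x₀) (G t (picardFlow G x₀ t)) (Ici 0) t := by
  have hf : Continuous fun s => G s (picardFlow G x₀ s) :=
    hG.continuous.comp (continuous_id.prodMk (hG.continuous_picardFlow x₀))
  have h := (intervalIntegral.integral_hasDerivAt_right (hf.intervalIntegrable 0 t)
    (hf.stronglyMeasurableAtFilter _ _) hf.continuousAt).const_add x₀
  exact h.hasDerivWithinAt.congr (fun s hs => hG.picardFlow_eq x₀ hs) (hG.picardFlow_eq x₀ ht)

/-- Solutions of the initial value problem on `[0, T]` are unique. -/
theorem IsGlobalField.eq_picardFlow (hG : IsGlobalField G) (x₀ : H) {T : ℝ} {f : ℝ → H}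
    (h0 : f 0 = x₀) (hf : ∀ t ∈ Icc 0 T, HasDerivWithinAt f (G t (f t)) (Icc 0 T) t) {t : ℝ}
    (ht : t ∈ Icc 0 T) : f t = picardFlow G x₀ t := by
  obtain ⟨K, hK⟩ := hG.lipschitz T
  refine ODE_solution_unique_of_mem_Icc_right (v := G) (s := fun _ => univ) (K := K)
    (fun s hs => (hK s ⟨hs.1, hs.2.le⟩).lipschitzOnWith)
    (fun s hs => (hf s hs).continuousWithinAt) (fun s hs => ?_) (fun _ _ => mem_univ _)
    (hG.continuous_picardFlow x₀).continuousOn (fun s hs => ?_) (fun _ _ => mem_univ _) ?_ ht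
  · exact (hf s ⟨hs.1, hs.2.le⟩).mono_of_mem_nhdsWithin
      (mem_nhdsWithin.2 ⟨Iio T, isOpen_Iio, hs.2, fun r hr => ⟨hs.1.trans hr.2, hr.1.le⟩⟩)
  · exact (hG.hasDerivWithinAt_picardFlow x₀ hs.1).mono (Ici_subset_Ici.2 hs.1)
  · rw [h0, picardFlow_of_nonpos x₀ le_rfl]

/-- The flow depends continuously on the initial value. -/
theorem IsGlobalField.continuous_picardFlow_initial (hG : IsGlobalField G) {t : ℝ} (ht : 0 ≤ t) :
    Continuous fun x₀ => picardFlow G x₀ t := by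
  obtain ⟨K, hK⟩ := hG.lipschitz t
  have h : LipschitzWith (Real.exp (K * t)).toNNReal fun x₀ => picardFlow G x₀ t := by
    refine LipschitzWith.of_dist_le_mul fun x y => ?_
    rw [Real.coe_toNNReal _ (Real.exp_pos _).le, mul_comm]
    have h := dist_le_of_trajectories_ODE_of_mem (v := G) (s := fun _ => univ) (K := K)
      (f := picardFlow G x) (g := picardFlow G y) (a := 0) (b := t) (δ := dist x y)
      (fun s hs => (hK s ⟨hs.1, hs.2.le⟩).lipschitzOnWith)
      (hG.continuous_picardFlow x).continuousOn
      (fun s hs => (hG.hasDerivWithinAt_picardFlow x hs.1).mono (Ici_subset_Ici.2 hs.1))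
      (fun _ _ => mem_univ _) (hG.continuous_picardFlow y).continuousOn
      (fun s hs => (hG.hasDerivWithinAt_picardFlow y hs.1).mono (Ici_subset_Ici.2 hs.1))
      (fun _ _ => mem_univ _)
      (by rw [picardFlow_of_nonpos x le_rfl, picardFlow_of_nonpos y le_rfl]) t ⟨ht, le_rfl⟩
    rwa [sub_zero] at h
  exact h.continuous

variable [MeasurableSpace H] [BorelSpace H] [SecondCountableTopology H]

/-- The flow of a field driven by a parameter-dependent continuous path depends measurably on the
parameter. -/
theorem measurable_picardFlow {X : Type*} [MeasurableSpace X] {F : ℝ → H → H} {w : X → ℝ → ℝ}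
    {x₀ : X → H} (hF : Continuous fun q : ℝ × H => F q.1 q.2)
    (hG : ∀ x, IsGlobalField fun t => F (w x t)) (hw : ∀ x, Continuous (w x))
    (hwm : ∀ t, Measurable fun x => w x t) (hx₀ : Measurable x₀) {t : ℝ} (ht : 0 ≤ t) :
    Measurable fun x => picardFlow (fun s => F (w x s)) (x₀ x) t := by
  have h : ∀ n t, Measurable fun x => picardIter (fun s => F (w x s)) (x₀ x) n t := by
    intro n
    induction n with
    | zero => exact fun _ => hx₀
    | succ n ih =>
      intro t
      have h1 : Measurable fun q : ℝ × X => w q.2 q.1 :=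
        measurable_uncurry_of_continuous_of_measurable (u := fun t x => w x t) hw hwm
      have h2 : Measurable fun q : ℝ × X =>
          picardIter (fun s => F (w q.2 s)) (x₀ q.2) n q.1 :=
        measurable_uncurry_of_continuous_of_measurable
          (u := fun t x => picardIter (fun s => F (w x s)) (x₀ x) n t)
          (fun x => (hG x).continuous_picardIter _ n) ih
      have h3 : StronglyMeasurable fun q : X × ℝ =>
          F (w q.1 q.2) (picardIter (fun s => F (w q.1 s)) (x₀ q.1) n q.2) :=
        (hF.measurable.comp ((h1.prodMk h2).comp measurable_swap)).stronglyMeasurable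
      simp only [picardIter, intervalIntegral]
      exact hx₀.add (h3.integral_prod_right'.measurable.sub h3.integral_prod_right'.measurable)
  exact measurable_of_tendsto_metrizable (fun n => h n t)
    (tendsto_pi_nhds.2 fun x => (hG x).tendsto_picardIter (x₀ x) ht)

end Picard

/-! ### The truncated drift -/

/-- The data of the lattice equation, with a nondecreasing nonlinearity. -/
structure LatticeSystem where
  /-- the exponent of the damping -/
  p : ℝ
  /-- the strength of the damping -/
  lam : ℝ
  /-- the growth constant of `Φ'` -/
  c : ℝ
  /-- the nonlinearity -/
  Φ : ℝ → ℝ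
  /-- the noise intensities -/
  α : EllInfty
  /-- the forcing -/
  g : EllTwo
  one_lt_p : 1 < p
  lam_pos : 0 < lam
  c_pos : 0 < c
  differentiable : Differentiable ℝ Φ
  map_zero : Φ 0 = 0
  deriv_nonneg : ∀ u, 0 ≤ deriv Φ u
  deriv_le : ∀ u, deriv Φ u ≤ c * (1 + |u| ^ (p - 1))

/-- The truncation of a real number to `[-n, n]`. -/
noncomputable def clampNat (n : ℕ) (u : ℝ) : ℝ := max (-(n : ℝ)) (min n u)

theorem clampNat_of_abs_le {n : ℕ} {u : ℝ} (h : |u| ≤ n) : clampNat n u = u := by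
  rw [clampNat, min_eq_right (le_of_abs_le h), max_eq_right (neg_le_of_abs_le h)]

theorem abs_clampNat (n : ℕ) (u : ℝ) : |clampNat n u| = min (n : ℝ) |u| := by
  have hn : (0 : ℝ) ≤ n := n.cast_nonneg
  rcases le_total |u| n with h | h
  · rw [clampNat_of_abs_le h, min_eq_right h]
  · rw [min_eq_left h, clampNat]
    rcases le_abs'.1 h with h1 | h1
    · rw [min_eq_right (by linarith), max_eq_left h1, abs_neg, abs_of_nonneg hn]
    · rw [min_eq_left h1, max_eq_right (by linarith), abs_of_nonneg hn]

theorem abs_clampNat_le (n : ℕ) (u : ℝ) : |clampNat n u| ≤ n := by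
  rw [abs_clampNat]; exact min_le_left _ _

theorem monotone_clampNat (n : ℕ) : Monotone (clampNat n) := fun _ _ h =>
  max_le_max (le_refl (-(n : ℝ))) (min_le_min (le_refl (n : ℝ)) h)

theorem clampNat_zero (n : ℕ) : clampNat n 0 = 0 := clampNat_of_abs_le (by simp)

theorem lipschitzWith_clampNat (n : ℕ) : LipschitzWith 1 (clampNat n) :=
  (LipschitzWith.id.const_min _).const_max _

/-- A function that is Lipschitz on `[-n, n]` becomes globally Lipschitz after truncation. -/
theorem LipschitzOnWith.comp_clampNat {f : ℝ → ℝ} {K : ℝ≥0} {n : ℕ}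
    (hf : LipschitzOnWith K f (Icc (-(n : ℝ)) n)) : LipschitzWith K fun u => f (clampNat n u) := by
  refine LipschitzWith.of_dist_le_mul fun x y => ?_
  refine (hf.dist_le_mul _ (abs_le.1 (abs_clampNat_le n x)) _
    (abs_le.1 (abs_clampNat_le n y))).trans ?_
  have := (lipschitzWith_clampNat n).dist_le_mul x y
  rw [NNReal.coe_one, one_mul] at this
  gcongr

/-- The damping nonlinearity `u + |u|^{p-1} u`. -/
noncomputable def damping (p u : ℝ) : ℝ := u + |u| ^ (p - 1) * u

theorem abs_damping (p u : ℝ) : |damping p u| = |u| * (1 + |u| ^ (p - 1)) := by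
  have h : 0 ≤ |u| ^ (p - 1) := Real.rpow_nonneg (abs_nonneg u) _
  rw [damping, show u + |u| ^ (p - 1) * u = u * (1 + |u| ^ (p - 1)) by ring, abs_mul,
    abs_of_nonneg (a := 1 + |u| ^ (p - 1)) (by linarith)]

theorem lipschitzOnWith_rpow {p : ℝ} (hp : 1 < p) (R : ℝ) :
    LipschitzOnWith (p * R ^ (p - 1)).toNNReal (fun x : ℝ => x ^ p) (Icc 0 R) := by
  refine (convex_Icc 0 R).lipschitzOnWith_of_nnnorm_hasDerivWithin_le
    (fun x _ => (Real.hasDerivAt_rpow_const (Or.inr hp.le)).hasDerivWithinAt) fun x hx => ?_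
  have h1 : 0 ≤ p * x ^ (p - 1) := mul_nonneg (by linarith) (Real.rpow_nonneg hx.1 _)
  rw [← NNReal.coe_le_coe, coe_nnnorm, Real.norm_of_nonneg h1]
  refine le_trans ?_ (Real.le_coe_toNNReal _)
  gcongr
  · exact hx.1
  · exact hx.2

/-- The damping in terms of positive and negative parts, which are composed with the power function
of the half line only. -/
theorem damping_eq {p : ℝ} (hp : 1 < p) (u : ℝ) :
    damping p u = u + (max u 0 ^ p - max (-u) 0 ^ p) := by
  have h0 : (0 : ℝ) ^ p = 0 := Real.zero_rpow (by linarith)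
  have hpos : ∀ v : ℝ, 0 ≤ v → v ^ (p - 1) * v = v ^ p := fun v hv => by
    rcases hv.eq_or_lt with rfl | hv
    · rw [mul_zero, h0]
    · rw [Real.rpow_sub_one hv.ne', div_mul_cancel₀ _ hv.ne']
  rw [damping]
  rcases le_total 0 u with h | h
  · rw [max_eq_left h, max_eq_right (by linarith), abs_of_nonneg h, hpos u h, h0, sub_zero]
  · rw [max_eq_right h, max_eq_left (by linarith), abs_of_nonpos h, h0, ← hpos (-u) (by linarith)]
    ring

theorem exists_lipschitzWith_damping {p : ℝ} (hp : 1 < p) (n : ℕ) :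
    ∃ K : ℝ≥0, LipschitzWith K fun u => damping p (clampNat n u) := by
  have hr := lipschitzOnWith_rpow hp n
  have h1 : LipschitzOnWith ((p * (n : ℝ) ^ (p - 1)).toNNReal * 1) (fun u : ℝ => max u 0 ^ p)
      (Icc (-(n : ℝ)) n) :=
    hr.comp (LipschitzWith.id.max_const 0).lipschitzOnWith
      fun u hu => ⟨le_max_right _ _, max_le hu.2 n.cast_nonneg⟩
  have h2 : LipschitzOnWith ((p * (n : ℝ) ^ (p - 1)).toNNReal * 1) (fun u : ℝ => max (-u) 0 ^ p)
      (Icc (-(n : ℝ)) n) :=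
    hr.comp (LipschitzWith.id.neg.max_const 0).lipschitzOnWith
      fun u hu => ⟨le_max_right _ _, max_le (by simpa using neg_le.1 hu.1) n.cast_nonneg⟩
  have h3 := (LipschitzWith.id.lipschitzOnWith (s := Icc (-(n : ℝ)) n)).add (h1.sub h2)
  have e : damping p = fun u => id u + (max u 0 ^ p - max (-u) 0 ^ p) := funext (damping_eq hp)
  rw [← e] at h3
  exact ⟨_, h3.comp_clampNat⟩

namespace LatticeSystem

variable (S : LatticeSystem)

theorem monotone_nonlinearity : Monotone S.Φ :=
  monotone_of_deriv_nonneg S.differentiable S.deriv_nonneg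

theorem lipschitzOnWith_nonlinearity (R : ℝ) :
    LipschitzOnWith (S.c * (1 + R ^ (S.p - 1))).toNNReal S.Φ (Icc (-R) R) := by
  refine (convex_Icc (-R) R).lipschitzOnWith_of_nnnorm_deriv_le
    (fun x _ => S.differentiable x) fun x hx => ?_
  rw [← NNReal.coe_le_coe, coe_nnnorm, Real.norm_of_nonneg (S.deriv_nonneg x)]
  refine le_trans ?_ (Real.le_coe_toNNReal _)
  refine (S.deriv_le x).trans ?_
  have := S.c_pos
  have h1 : |x| ^ (S.p - 1) ≤ R ^ (S.p - 1) :=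
    Real.rpow_le_rpow (abs_nonneg x) (abs_le.2 hx) (by linarith [S.one_lt_p])
  gcongr

theorem abs_nonlinearity_le (u : ℝ) : |S.Φ u| ≤ S.c * |damping S.p u| := by
  have h := (S.lipschitzOnWith_nonlinearity |u|).dist_le_mul u (abs_le.1 le_rfl) 0
    ⟨by simp, by simp⟩
  have h1 : 0 ≤ |u| ^ (S.p - 1) := Real.rpow_nonneg (abs_nonneg u) _
  rw [S.map_zero, dist_zero_right, dist_zero_right, Real.norm_eq_abs, Real.norm_eq_abs,
    Real.coe_toNNReal _ (mul_nonneg S.c_pos.le (by linarith))] at h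
  rw [abs_damping]
  linarith

/-- The truncated nonlinearity. -/
noncomputable def truncΦ (n : ℕ) (u : ℝ) : ℝ := S.Φ (clampNat n u)

/-- The truncated damping. -/
noncomputable def truncDamping (n : ℕ) (u : ℝ) : ℝ := damping S.p (clampNat n u)

theorem exists_lipschitzWith_truncΦ (n : ℕ) : ∃ K : ℝ≥0, LipschitzWith K (S.truncΦ n) :=
  ⟨_, (S.lipschitzOnWith_nonlinearity n).comp_clampNat⟩

theorem exists_lipschitzWith_truncDamping (n : ℕ) :
    ∃ K : ℝ≥0, LipschitzWith K (S.truncDamping n) :=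
  exists_lipschitzWith_damping S.one_lt_p n

theorem truncΦ_zero (n : ℕ) : S.truncΦ n 0 = 0 := by rw [truncΦ, clampNat_zero, S.map_zero]

theorem truncDamping_zero (n : ℕ) : S.truncDamping n 0 = 0 := by
  rw [truncDamping, clampNat_zero, damping, mul_zero, add_zero]

theorem monotone_truncΦ (n : ℕ) : Monotone (S.truncΦ n) :=
  S.monotone_nonlinearity.comp (monotone_clampNat n)

/-- The damping has the sign of its argument. -/
theorem mul_truncDamping (n : ℕ) (u : ℝ) :
    u * S.truncDamping n u = |u| * |S.truncDamping n u| := by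
  have h : 0 ≤ |clampNat n u| ^ (S.p - 1) := Real.rpow_nonneg (abs_nonneg _) _
  have e : S.truncDamping n u = clampNat n u * (1 + |clampNat n u| ^ (S.p - 1)) := by
    rw [truncDamping, damping]; ring
  have hs : 0 ≤ u * clampNat n u := by
    rcases le_total 0 u with hu | hu
    · exact mul_nonneg hu ((clampNat_zero n).symm.le.trans (monotone_clampNat n hu))
    · exact mul_nonneg_of_nonpos_of_nonpos hu ((monotone_clampNat n hu).trans (clampNat_zero n).le)
  rw [← abs_mul, e, ← mul_assoc, abs_of_nonneg (mul_nonneg hs (by linarith))]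

theorem abs_truncDamping_le (n : ℕ) {u v : ℝ} (h : |u| ≤ |v|) :
    |S.truncDamping n u| ≤ |S.truncDamping n v| := by
  have h1 : |clampNat n u| ≤ |clampNat n v| := by
    rw [abs_clampNat, abs_clampNat]; exact min_le_min le_rfl h
  have h2 := Real.rpow_le_rpow (abs_nonneg _) h1 (show 0 ≤ S.p - 1 by linarith [S.one_lt_p])
  have h3 : 0 ≤ |clampNat n u| ^ (S.p - 1) := Real.rpow_nonneg (abs_nonneg _) _
  rw [truncDamping, truncDamping, abs_damping, abs_damping]
  gcongr

/-- Products of a coordinate with the nonlinearity at another coordinate are controlled by the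
damping at both. -/
theorem abs_mul_truncΦ_le (n : ℕ) (u v : ℝ) :
    |u| * |S.truncΦ n v| ≤ S.c * (u * S.truncDamping n u + v * S.truncDamping n v) := by
  have h1 : |S.truncΦ n v| ≤ S.c * |S.truncDamping n v| := S.abs_nonlinearity_le _
  have h2 : |u| * |S.truncDamping n v|
      ≤ u * S.truncDamping n u + v * S.truncDamping n v := by
    rw [S.mul_truncDamping, S.mul_truncDamping]
    rcases le_total |u| |v| with h | h
    · have := mul_le_mul_of_nonneg_right h (abs_nonneg (S.truncDamping n v))
      have := mul_nonneg (abs_nonneg u) (abs_nonneg (S.truncDamping n u))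
      linarith
    · have := mul_le_mul_of_nonneg_left (S.abs_truncDamping_le n h) (abs_nonneg u)
      have := mul_nonneg (abs_nonneg v) (abs_nonneg (S.truncDamping n v))
      linarith
  calc |u| * |S.truncΦ n v| ≤ |u| * (S.c * |S.truncDamping n v|) := by gcongr
    _ = S.c * (|u| * |S.truncDamping n v|) := by ring
    _ ≤ _ := mul_le_mul_of_nonneg_left h2 S.c_pos.le

/-- The coordinatewise application of the truncated nonlinearity. -/
noncomputable def nemΦ (n : ℕ) : EllTwo → EllTwo :=
  nemytskii (S.exists_lipschitzWith_truncΦ n).choose_spec (S.truncΦ_zero n)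

/-- The coordinatewise application of the truncated damping. -/
noncomputable def nemDamping (n : ℕ) : EllTwo → EllTwo :=
  nemytskii (S.exists_lipschitzWith_truncDamping n).choose_spec (S.truncDamping_zero n)

theorem nemΦ_apply (n : ℕ) (x : EllTwo) (i : ℤ) : S.nemΦ n x i = S.truncΦ n (x i) := rfl

theorem nemDamping_apply (n : ℕ) (x : EllTwo) (i : ℤ) :
    S.nemDamping n x i = S.truncDamping n (x i) := rfl

/-- The drift `-A Φ(u) - λ (u + |u|^{p-1} u) + g` with truncated nonlinearities; it is globally
Lipschitz on `ℓ²(ℤ)`. -/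
noncomputable def truncDrift (n : ℕ) (u : EllTwo) : EllTwo :=
  S.g - latticeOp (S.nemΦ n u) - S.lam • S.nemDamping n u

/-- The drift `-A Φ(u) - λ (u + |u|^{p-1} u) + g` as an element of `ℓ²(ℤ)`: any truncation at a
level above `‖u‖` gives the same value. -/
noncomputable def drift (u : EllTwo) : EllTwo := S.truncDrift ⌈‖u‖⌉₊ u

theorem truncDrift_apply {n : ℕ} {u : EllTwo} (h : ‖u‖ ≤ n) (i : ℤ) :
    S.truncDrift n u i = stochasticDrift S.p S.lam S.Φ S.g u i := by
  have hc : ∀ i, clampNat n (u i) = u i := fun i =>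
    clampNat_of_abs_le ((u.abs_apply_le_norm i).trans h)
  change S.g i - latticeOp (S.nemΦ n u) i - S.lam * S.truncDamping n (u i) = _
  rw [latticeOp_apply, stochasticDrift, latticeA, latticeA]
  simp only [nemΦ_apply, truncΦ, truncDamping, damping, hc]
  ring

theorem drift_apply (u : EllTwo) (i : ℤ) :
    S.drift u i = stochasticDrift S.p S.lam S.Φ S.g u i :=
  S.truncDrift_apply (Nat.le_ceil _) i

theorem truncDrift_eq_drift {n : ℕ} {u : EllTwo} (h : ‖u‖ ≤ n) : S.truncDrift n u = S.drift u :=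
  EllTwo.ext_apply fun i => by rw [S.truncDrift_apply h, S.drift_apply]

theorem exists_lipschitzWith_truncDrift (n : ℕ) : ∃ K : ℝ≥0, LipschitzWith K (S.truncDrift n) := by
  set K₁ := (S.exists_lipschitzWith_truncΦ n).choose
  set K₂ := (S.exists_lipschitzWith_truncDamping n).choose
  have h1 : LipschitzWith K₁ (S.nemΦ n) := lipschitzWith_nemytskii _ _
  have h2 : LipschitzWith K₂ (S.nemDamping n) := lipschitzWith_nemytskii _ _
  have h3 : LipschitzWith 4 latticeOp := LipschitzWith.of_dist_le_mul fun x y => by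
    rw [dist_eq_norm, dist_eq_norm, latticeOp_sub]
    exact norm_latticeOp_le _
  exact ⟨_, ((LipschitzWith.const S.g).sub (h3.comp h1)).sub ((lipschitzWith_smul S.lam).comp h2)⟩

end LatticeSystem

/-! ### The energy estimate -/

theorem inner_mulOp_left (a : EllInfty) (x y : EllTwo) :
    inner ℝ (mulOp a x) y = inner ℝ x (mulOp a y) := by
  have h1 := EllTwo.hasSum_inner (mulOp a x) y
  have h2 := EllTwo.hasSum_inner x (mulOp a y)
  refine h1.unique (h2.congr_fun fun i => ?_)
  simp only [mulOp_apply_coe]; ring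

theorem HasSum.comp_add_int {f : ℤ → ℝ} {s : ℝ} (h : HasSum f s) (k : ℤ) :
    HasSum (fun i => f (i + k)) s :=
  (Equiv.hasSum_iff (f := f) (Equiv.addRight k)).2 h

/-- If `f` is coordinatewise increasing in `x`, then `⟨x, A f⟩ ≥ 0`, by summation by parts. -/
theorem inner_latticeOp_nonneg {x f : EllTwo}
    (h : ∀ i j, 0 ≤ (x i - x j) * (f i - f j)) : 0 ≤ inner ℝ x (latticeOp f) := by
  have h0 := EllTwo.hasSum_inner x f
  have h1 : HasSum (fun i => x (i + 1) * f (i + 1)) (inner ℝ x f) :=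
    h0.comp_add_int 1
  have h2 : HasSum (fun i => x i * f (i + 1)) (inner ℝ x (shiftSeq 1 f)) :=
    EllTwo.hasSum_inner x (shiftSeq 1 f)
  have h3 : HasSum (fun i => x (i + 1) * f i) (inner ℝ x (shiftSeq (-1) f)) := by
    refine ((EllTwo.hasSum_inner x (shiftSeq (-1) f)).comp_add_int 1).congr_fun fun i => ?_
    simp
  have h4 := ((h0.add h1).sub h2).sub h3
  have h5 : inner ℝ x (latticeOp f) = inner ℝ x f + inner ℝ x f - inner ℝ x (shiftSeq 1 f)
      - inner ℝ x (shiftSeq (-1) f) := by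
    rw [latticeOp, inner_sub_right, inner_sub_right, inner_smul_right]; ring
  rw [h5]
  refine h4.nonneg fun i => ?_
  have := h i (i + 1)
  linarith

/-- A small weight `b` makes the pairing with `A f` small, if the products `x_i f_j` are controlled
by the products `x_i n_i` and `x_j n_j`. -/
theorem neg_le_inner_mulOp_latticeOp {x f n : EllTwo} {b : EllInfty} {c ε : ℝ}
    (hb : ∀ i, |b i| ≤ ε)
    (hxf : ∀ i j, |x i| * |f j| ≤ c * (x i * n i + x j * n j)) :
    -(8 * c * ε * inner ℝ x n) ≤ inner ℝ (mulOp b x) (latticeOp f) := by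
  have hε0 : 0 ≤ ε := (abs_nonneg _).trans (hb 0)
  have hs0 : HasSum (fun i => x i * n i) (inner ℝ x n) := EllTwo.hasSum_inner x n
  have hs1 : HasSum (fun i => x (i + 1) * n (i + 1)) (inner ℝ x n) :=
    hs0.comp_add_int 1
  have hs2 : HasSum (fun i => x (i + -1) * n (i + -1)) (inner ℝ x n) :=
    hs0.comp_add_int (-1)
  have hs := ((hs0.mul_left 6).add (hs1.add hs2)).mul_left (-(c * ε))
  have e0 : ∀ i, -(c * ε) * (6 * (x i * n i) + (x (i + 1) * n (i + 1) + x (i + -1) * n (i + -1)))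
      ≤ mulOp b x i * latticeOp f i := fun i => by
    have e1 : mulOp b x i * latticeOp f i
        = b i * (2 * (x i * f i) - x i * f (i + -1) - x i * f (i + 1)) := by
      rw [mulOp_apply_coe, latticeOp_apply, latticeA, sub_eq_add_neg i 1]
      ring
    have e2 : |2 * (x i * f i) - x i * f (i + -1) - x i * f (i + 1)|
        ≤ 2 * (|x i| * |f i|) + |x i| * |f (i + -1)| + |x i| * |f (i + 1)| := by
      have t1 := abs_sub (2 * (x i * f i) - x i * f (i + -1)) (x i * f (i + 1))
      have t2 := abs_sub (2 * (x i * f i)) (x i * f (i + -1))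
      rw [abs_mul 2, abs_two, abs_mul (x i) (f i), abs_mul (x i) (f (i + -1))] at t2
      rw [abs_mul (x i) (f (i + 1))] at t1
      linarith
    have e3 : 2 * (|x i| * |f i|) + |x i| * |f (i + -1)| + |x i| * |f (i + 1)|
        ≤ c * (6 * (x i * n i) + (x (i + 1) * n (i + 1) + x (i + -1) * n (i + -1))) := by
      linarith [hxf i i, hxf i (i + -1), hxf i (i + 1)]
    have e4 := mul_le_mul (hb i) (e2.trans e3) (abs_nonneg _) hε0
    rw [← abs_mul, ← e1] at e4
    linarith [neg_abs_le (mulOp b x i * latticeOp f i)]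
  have e5 := hasSum_le e0 hs (EllTwo.hasSum_inner (mulOp b x) (latticeOp f))
  linarith

namespace LatticeSystem

variable (S : LatticeSystem)

/-- The energy estimate: for a weight `a` close to `1`, the error made by weighting the monotone
coupling term is absorbed by the damping. The bound does not depend on the truncation level. -/
theorem inner_mulOp_truncDrift_le (n : ℕ) (x : EllTwo) {a : EllInfty} {ε : ℝ}
    (ha : ∀ i, |a i - 1| ≤ ε) (hε : ε ≤ 1 / 2) (hε' : 16 * S.c * ε ≤ S.lam) :
    inner ℝ (mulOp a x) (S.truncDrift n x) ≤ 2 * ‖x‖ * ‖S.g‖ := by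
  have hε0 : 0 ≤ ε := (abs_nonneg _).trans (ha 0)
  have d0 : ∀ i, 0 ≤ x i * S.nemDamping n x i := fun i => by
    rw [nemDamping_apply, mul_truncDamping]; positivity
  have hxF : ∀ i j, |x i| * |S.nemΦ n x j|
      ≤ S.c * (x i * S.nemDamping n x i + x j * S.nemDamping n x j) := fun i j =>
    S.abs_mul_truncΦ_le n (x i) (x j)
  have h1 : 0 ≤ inner ℝ x (latticeOp (S.nemΦ n x)) := inner_latticeOp_nonneg fun i j => by
    rcases le_total (x i) (x j) with h | h
    · exact mul_nonneg_of_nonpos_of_nonpos (sub_nonpos.2 h)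
        (sub_nonpos.2 (S.monotone_truncΦ n h))
    · exact mul_nonneg (sub_nonneg.2 h) (sub_nonneg.2 (S.monotone_truncΦ n h))
  rw [truncDrift]
  generalize S.nemΦ n x = F at *
  generalize S.nemDamping n x = N at *
  set D := inner ℝ x N with hD
  have hsD : HasSum (fun i => x i * N i) D := EllTwo.hasSum_inner x N
  have hD0 : 0 ≤ D := hsD.nonneg d0
  have h2 : -(8 * S.c * ε * D) ≤ inner ℝ (mulOp (a - 1) x) (latticeOp F) :=
    neg_le_inner_mulOp_latticeOp (fun i => ha i) hxF
  have h3 : 1 / 2 * D ≤ inner ℝ (mulOp a x) N := by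
    refine hasSum_le (fun i => ?_) (hsD.mul_left (1 / 2)) (EllTwo.hasSum_inner (mulOp a x) N)
    rw [mulOp_apply_coe, mul_assoc]
    exact mul_le_mul_of_nonneg_right (by linarith [(abs_le.1 (ha i)).1]) (d0 i)
  have h4 : ‖a‖ ≤ 2 := lp.norm_le_of_forall_le (by norm_num) fun i => by
    have := abs_le.1 (ha i)
    rw [Real.norm_eq_abs, abs_le]; constructor <;> linarith
  have h5 : inner ℝ (mulOp a x) S.g ≤ 2 * ‖x‖ * ‖S.g‖ :=
    (real_inner_le_norm _ _).trans (mul_le_mul_of_nonneg_right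
      ((norm_mulOp_apply_le a x).trans (mul_le_mul_of_nonneg_right h4 (norm_nonneg x)))
      (norm_nonneg _))
  have h6 : mulOp a x = x + mulOp (a - 1) x := EllTwo.ext_apply fun i => by
    change a i * x i = x i + (a i - 1) * x i
    ring
  have h7 : inner ℝ (mulOp a x) (latticeOp F)
      = inner ℝ x (latticeOp F) + inner ℝ (mulOp (a - 1) x) (latticeOp F) := by
    rw [h6, inner_add_left]
  have h8 : inner ℝ (mulOp a x) (S.g - latticeOp F - S.lam • N) = inner ℝ (mulOp a x) S.g
      - inner ℝ (mulOp a x) (latticeOp F) - S.lam * inner ℝ (mulOp a x) N := by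
    rw [inner_sub_right, inner_sub_right, inner_smul_right]
  rw [h8, h7]
  have h9 := mul_le_mul_of_nonneg_left h3 S.lam_pos.le
  have h10 := mul_le_mul_of_nonneg_right hε' hD0
  linarith

/-! ### The conjugated equation `h' = e^{-α w} B(e^{α w} h)` -/

/-- The drift conjugated by `e^{α r}`, with truncated nonlinearities. -/
noncomputable def truncField (n : ℕ) (r : ℝ) (h : EllTwo) : EllTwo :=
  expMul S.α (-r) (S.truncDrift n (expMul S.α r h))

theorem continuous_truncField (n : ℕ) :
    Continuous fun q : ℝ × EllTwo => S.truncField n q.1 q.2 := by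
  obtain ⟨K, hK⟩ := S.exists_lipschitzWith_truncDrift n
  exact (continuous_fst.neg).expMul S.α (hK.continuous.comp (continuous_uncurry_expMul S.α))

theorem isGlobalField_truncField (n : ℕ) {w : ℝ → ℝ} (hw : Continuous w) :
    IsGlobalField fun t => S.truncField n (w t) where
  continuous := (S.continuous_truncField n).comp
    ((hw.comp continuous_fst).prodMk continuous_snd)
  lipschitz T := by
    obtain ⟨K, hK⟩ := S.exists_lipschitzWith_truncDrift n
    obtain ⟨M, hM⟩ := (isCompact_Icc (a := (0 : ℝ)) (b := T)).exists_bound_of_continuousOn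
      hw.continuousOn
    refine ⟨(Real.exp (‖S.α‖ * M)).toNNReal * K * (Real.exp (‖S.α‖ * M)).toNNReal,
      fun t ht => ?_⟩
    have hE : ∀ r : ℝ, |r| ≤ M → ∀ x : EllTwo, ‖expMul S.α r x‖ ≤ Real.exp (‖S.α‖ * M) * ‖x‖ :=
      fun r hr x => (norm_expMul_le S.α r x).trans (by gcongr)
    refine LipschitzWith.of_dist_le_mul fun x y => ?_
    rw [dist_eq_norm, truncField, truncField, expMul_sub]
    refine (hE _ (by rw [abs_neg]; exact hM t ht) _).trans ?_
    rw [NNReal.coe_mul, NNReal.coe_mul, Real.coe_toNNReal _ (Real.exp_pos _).le, mul_assoc, mul_assoc]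
    refine mul_le_mul_of_nonneg_left ?_ (Real.exp_pos _).le
    rw [← dist_eq_norm]
    refine (hK.dist_le_mul _ _).trans (mul_le_mul_of_nonneg_left ?_ K.coe_nonneg)
    rw [dist_eq_norm, expMul_sub, dist_eq_norm]
    exact hE _ (hM t ht) _

/-- The weights `e^{α r}` are close to `1` for small `r`. -/
theorem abs_expSeq_sub_one_le {α : EllInfty} {ε r : ℝ} (hε : ε ≤ 1) (hr : ‖α‖ * |r| ≤ ε / 2)
    (i : ℤ) : |expSeq α r i - 1| ≤ ε := by
  have h : |α i * r| ≤ ε / 2 := by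
    rw [abs_mul]
    exact (mul_le_mul_of_nonneg_right (lp.norm_apply_le_norm ENNReal.top_ne_zero α i)
      (abs_nonneg r)).trans hr
  rw [expSeq_apply]
  refine (Real.abs_exp_sub_one_le (h.trans (by linarith))).trans ?_
  linarith

/-- A bound for the truncated solutions that is uniform in the truncation level. The driving path
is first replaced by a nearby polynomial `m`, which makes `q = e^{α m} h` differentiable; the
remaining weights `e^{α (w - m)}` are close to `1`, so that the energy estimate applies to `q`. -/
theorem exists_norm_truncFlow_le {w : ℝ → ℝ} (hw : Continuous w) (T ρ : ℝ) :
    ∃ M : ℝ, ∀ (n : ℕ) (x : EllTwo), ‖x‖ ≤ ρ → ∀ t ∈ Icc 0 T,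
      ‖expMul S.α (w t) (picardFlow (fun s => S.truncField n (w s)) x t)‖ ≤ M := by
  have hc := S.c_pos
  have hα := norm_nonneg S.α
  -- the deviation of the weights from `1` that the damping can absorb
  set ε : ℝ := min (1 / 2) (S.lam / (16 * S.c)) with hε
  have hε0 : 0 < ε := lt_min (by norm_num) (div_pos S.lam_pos (by positivity))
  have hε1 : ε ≤ 1 / 2 := min_le_left _ _
  have hε2 : 16 * S.c * ε ≤ S.lam := by
    have : ε ≤ S.lam / (16 * S.c) := min_le_right _ _
    rwa [le_div_iff₀' (by positivity)] at this
  set δ : ℝ := ε / (4 * (‖S.α‖ + 1)) with hδ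
  have hδ0 : 0 < δ := by positivity
  have hαδ : ‖S.α‖ * δ ≤ ε / 4 := by
    rw [hδ, mul_div_assoc', div_le_div_iff₀ (by positivity) (by norm_num)]
    nlinarith
  obtain ⟨m, hm⟩ := exists_polynomial_near_of_continuousOn 0 T w hw.continuousOn δ hδ0
  obtain ⟨L, hL⟩ := (isCompact_Icc (a := (0 : ℝ)) (b := T)).exists_bound_of_continuousOn
    (m.derivative.continuous.continuousOn)
  set Λ : ℝ := |L| * ‖S.α‖ with hΛ
  have hΛ0 : 0 ≤ Λ := by positivity
  -- `K` is the growth rate and `Y` bounds the initial value in the Gronwall argument for `‖q‖²`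
  set K : ℝ := 2 + 2 * Λ with hK
  set Y : ℝ := (Real.exp (‖S.α‖ * |m.eval 0|) * ρ) ^ 2 + 4 * ‖S.g‖ ^ 2 with hY
  refine ⟨2 * Real.sqrt (Y * Real.exp (K * T)), fun n x hx => ?_⟩
  set h := picardFlow (fun s => S.truncField n (w s)) x with hh
  have hG := S.isGlobalField_truncField n hw
  have hd : ∀ t, 0 ≤ t → HasDerivWithinAt h (S.truncField n (w t) (h t)) (Ici 0) t := fun t ht =>
    hG.hasDerivWithinAt_picardFlow x ht
  set q : ℝ → EllTwo := fun t => expMul S.α (m.eval t) (h t) with hq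
  have hqd : ∀ t, 0 ≤ t → HasDerivWithinAt q (expMul S.α (m.eval t)
      (S.truncField n (w t) (h t) + m.derivative.eval t • mulOp S.α (h t))) (Ici 0) t :=
    fun t ht => HasDerivWithinAt.expMul S.α (m.hasDerivAt t).hasDerivWithinAt (hd t ht)
  have hη : ∀ t ∈ Icc 0 T, ‖S.α‖ * |w t - m.eval t| ≤ ε / 4 := fun t ht => by
    refine le_trans (mul_le_mul_of_nonneg_left ?_ hα) hαδ
    rw [abs_sub_comm]
    exact (hm t ht).le
  have hxq : ∀ t, expMul S.α (w t) (h t) = expMul S.α (w t - m.eval t) (q t) := fun t => by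
    rw [hq, ← expMul_add, sub_add_cancel]
  have hnorm : ∀ t ∈ Icc 0 T, ‖expMul S.α (w t) (h t)‖ ≤ 2 * ‖q t‖ := fun t ht => by
    rw [hxq]
    refine (norm_expMul_le _ _ _).trans (mul_le_mul_of_nonneg_right ?_ (norm_nonneg _))
    refine (Real.exp_le_exp.2 ((hη t ht).trans (show ε / 4 ≤ 1 / 2 by linarith))).trans ?_
    have := Real.exp_bound' (x := 1 / 2) (by norm_num) (by norm_num) (n := 2) (by norm_num)
    norm_num [Finset.sum_range_succ] at this
    linarith
  have hinner : ∀ t ∈ Icc 0 T, 2 * inner ℝ (q t) (expMul S.α (m.eval t)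
      (S.truncField n (w t) (h t) + m.derivative.eval t • mulOp S.α (h t)))
        ≤ K * (‖q t‖ ^ 2 + 4 * ‖S.g‖ ^ 2) := fun t ht => by
    set y := expMul S.α (w t) (h t) with hy
    set η := w t - m.eval t with hηd
    -- `q' = e^{-α η} B(y) + m' α q` with `y = e^{α w} h`, and pairing the first term with
    -- `q = e^{-α η} y` produces the weight `e^{-2 α η}`
    have e1 : expMul S.α (m.eval t)
        (S.truncField n (w t) (h t) + m.derivative.eval t • mulOp S.α (h t))
        = mulOp (expSeq S.α (-η)) (S.truncDrift n y) + m.derivative.eval t • mulOp S.α (q t) := by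
      have a1 : expMul S.α (m.eval t) (S.truncField n (w t) (h t))
          = mulOp (expSeq S.α (-η)) (S.truncDrift n y) := by
        rw [truncField, ← expMul_add, ← expMul_eq_mulOp, hηd]
        congr 1; ring
      have a2 : expMul S.α (m.eval t) (mulOp S.α (h t)) = mulOp S.α (q t) := by
        change _ = mulOp S.α (expMul S.α (m.eval t) (h t))
        rw [expMul_eq_mulOp, expMul_eq_mulOp, ← mulOp_mul_apply, ← mulOp_mul_apply, mul_comm]
      rw [← a1, ← a2, expMul_eq_mulOp, expMul_eq_mulOp, expMul_eq_mulOp, map_add, map_smul]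
    have e2 : q t = mulOp (expSeq S.α (-η)) y := by
      rw [hy, hxq, ← expMul_eq_mulOp, expMul_neg_expMul]
    have e3 : inner ℝ (q t) (mulOp (expSeq S.α (-η)) (S.truncDrift n y)) ≤ 2 * ‖y‖ * ‖S.g‖ := by
      rw [← inner_mulOp_left, e2, ← mulOp_mul_apply, ← expSeq_add]
      refine S.inner_mulOp_truncDrift_le n y (ε := ε) (fun i => ?_) hε1 hε2
      refine abs_expSeq_sub_one_le (by linarith) ?_ i
      have h1 : |-η + -η| ≤ 2 * |η| := by
        rw [← neg_add, abs_neg]; exact (abs_add_le _ _).trans (by linarith)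
      have h2 := hη t ht
      calc _ ≤ ‖S.α‖ * (2 * |η|) := by gcongr
        _ ≤ ε / 2 := by linarith
    have e4 : inner ℝ (q t) (m.derivative.eval t • mulOp S.α (q t)) ≤ Λ * ‖q t‖ ^ 2 := by
      refine (real_inner_le_norm _ _).trans ?_
      rw [norm_smul]
      have h1 : ‖m.derivative.eval t‖ ≤ |L| := (hL t ht).trans (le_abs_self L)
      have h2 := norm_mulOp_apply_le S.α (q t)
      calc _ ≤ ‖q t‖ * (|L| * (‖S.α‖ * ‖q t‖)) := by gcongr
        _ = _ := by rw [hΛ]; ring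
    have e5 : 2 * ‖y‖ * ‖S.g‖ ≤ 4 * ‖q t‖ * ‖S.g‖ := by
      have := mul_le_mul_of_nonneg_right (hnorm t ht) (norm_nonneg S.g)
      linarith
    rw [e1, inner_add_right, hK]
    nlinarith [sq_nonneg (‖q t‖ - 2 * ‖S.g‖), mul_nonneg hΛ0 (sq_nonneg ‖S.g‖)]
  set Z : ℝ → ℝ := fun t => (‖q t‖ ^ 2 + 4 * ‖S.g‖ ^ 2) * Real.exp (-(K * t)) with hZ
  have hZd : ∀ t, 0 ≤ t → HasDerivWithinAt Z
      ((2 * inner ℝ (q t) (expMul S.α (m.eval t)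
        (S.truncField n (w t) (h t) + m.derivative.eval t • mulOp S.α (h t)))) *
        Real.exp (-(K * t)) + (‖q t‖ ^ 2 + 4 * ‖S.g‖ ^ 2) *
          (Real.exp (-(K * t)) * (-(K * 1)))) (Ici 0) t := fun t ht =>
    ((hqd t ht).norm_sq.add_const _).mul
      ((((hasDerivAt_id t).const_mul K).neg.exp).hasDerivWithinAt)
  have hanti : AntitoneOn Z (Icc 0 T) := by
    refine antitoneOn_of_hasDerivWithinAt_nonpos (convex_Icc 0 T) (fun t ht =>
      ((hZd t ht.1).continuousWithinAt).mono Icc_subset_Ici_self) (fun t ht =>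
        (hZd t (interior_subset ht).1).mono (interior_subset.trans Icc_subset_Ici_self))
        fun t ht => ?_
    have h1 := mul_le_mul_of_nonneg_right (hinner t (interior_subset ht))
      (Real.exp_pos (-(K * t))).le
    linarith
  intro t ht
  have hT : (0 : ℝ) ∈ Icc 0 T := ⟨le_rfl, ht.1.trans ht.2⟩
  have h1 := hanti hT ht ht.1
  have h2 : Z 0 ≤ Y := by
    simp only [hZ, hq, mul_zero, neg_zero, Real.exp_zero, mul_one, hY]
    have h3 : h 0 = x := picardFlow_of_nonpos x le_rfl
    rw [h3]
    have := (norm_expMul_le S.α (m.eval 0) x).trans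
      (mul_le_mul_of_nonneg_left hx (Real.exp_pos _).le)
    gcongr
  have h3 : ‖q t‖ ^ 2 ≤ Y * Real.exp (K * T) := by
    have h4 : (‖q t‖ ^ 2 + 4 * ‖S.g‖ ^ 2) * Real.exp (-(K * t)) ≤ Y := h1.trans h2
    have hY0 : 0 ≤ Y := by rw [hY]; positivity
    calc ‖q t‖ ^ 2 ≤ ‖q t‖ ^ 2 + 4 * ‖S.g‖ ^ 2 := by linarith [sq_nonneg ‖S.g‖]
      _ = (‖q t‖ ^ 2 + 4 * ‖S.g‖ ^ 2) * Real.exp (-(K * t)) * Real.exp (K * t) := by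
        rw [mul_assoc, ← Real.exp_add, neg_add_cancel, Real.exp_zero, mul_one]
      _ ≤ Y * Real.exp (K * t) := by gcongr
      _ ≤ _ := by
        have : 0 ≤ K := by rw [hK]; linarith
        gcongr
        exact ht.2
  refine (hnorm t ht).trans ?_
  have := Real.le_sqrt_of_sq_le h3
  linarith

/-- The drift conjugated by `e^{α r}`. -/
noncomputable def field (r : ℝ) (h : EllTwo) : EllTwo :=
  expMul S.α (-r) (S.drift (expMul S.α r h))

/-- The solution of `h' = e^{-α w} B(e^{α w} h)`, `h(0) = x`, as the limit of the solutions with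
truncated nonlinearities, which are eventually constant in the truncation level. -/
noncomputable def conjFlow (w : ℝ → ℝ) (x : EllTwo) (t : ℝ) : EllTwo :=
  limUnder atTop fun n : ℕ => picardFlow (fun s => S.truncField n (w s)) x t

theorem truncField_eq_field {n : ℕ} {r : ℝ} {h : EllTwo} (hn : ‖expMul S.α r h‖ ≤ n) :
    S.truncField n r h = S.field r h := by
  rw [truncField, field, S.truncDrift_eq_drift hn]

/-- On bounded times and bounded initial values, the solution is that of the equation truncated at
any sufficiently high level. -/
theorem exists_forall_conjFlow_eq {w : ℝ → ℝ} (hw : Continuous w) (T ρ : ℝ) :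
    ∃ n₀ : ℕ, ∀ n ≥ n₀, ∀ x : EllTwo, ‖x‖ ≤ ρ → ∀ t ≤ T,
      S.conjFlow w x t = picardFlow (fun s => S.truncField n (w s)) x t ∧
        (0 ≤ t → ‖expMul S.α (w t) (S.conjFlow w x t)‖ ≤ n) := by
  obtain ⟨M, hM⟩ := S.exists_norm_truncFlow_le hw T ρ
  have key : ∀ n ≥ ⌈M⌉₊, ∀ x : EllTwo, ‖x‖ ≤ ρ → ∀ t ≤ T,
      picardFlow (fun s => S.truncField n (w s)) x t
        = picardFlow (fun s => S.truncField ⌈M⌉₊ (w s)) x t := by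
    intro n hn x hx t ht
    rcases le_total t 0 with h0 | h0
    · rw [picardFlow_of_nonpos x h0, picardFlow_of_nonpos x h0]
    refine (S.isGlobalField_truncField ⌈M⌉₊ hw).eq_picardFlow x (T := T)
      (picardFlow_of_nonpos x le_rfl) (fun s hs => ?_) ⟨h0, ht⟩
    have h1 := hM n x hx s hs
    have h2 := (S.isGlobalField_truncField n hw).hasDerivWithinAt_picardFlow x hs.1
    rw [S.truncField_eq_field (h1.trans ((Nat.le_ceil M).trans (Nat.cast_le.2 hn)))] at h2
    rw [S.truncField_eq_field (h1.trans (Nat.le_ceil M))]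
    exact h2.mono Icc_subset_Ici_self
  have key2 : ∀ x : EllTwo, ‖x‖ ≤ ρ → ∀ t ≤ T, S.conjFlow w x t
      = picardFlow (fun s => S.truncField ⌈M⌉₊ (w s)) x t := fun x hx t ht =>
    (tendsto_const_nhds.congr' ((eventually_ge_atTop ⌈M⌉₊).mono
      fun n hn => (key n hn x hx t ht).symm)).limUnder_eq
  refine ⟨⌈M⌉₊, fun n hn x hx t ht => ⟨?_, fun h0 => ?_⟩⟩
  · rw [key2 x hx t ht, key n hn x hx t ht]
  · rw [key2 x hx t ht]
    exact (hM _ x hx t ⟨h0, ht⟩).trans ((Nat.le_ceil M).trans (Nat.cast_le.2 hn))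

theorem conjFlow_of_nonpos (w : ℝ → ℝ) (x : EllTwo) {t : ℝ} (ht : t ≤ 0) :
    S.conjFlow w x t = x := by
  rw [conjFlow]
  simp only [picardFlow_of_nonpos x ht]
  exact tendsto_const_nhds.limUnder_eq

theorem continuous_conjFlow {w : ℝ → ℝ} (hw : Continuous w) (x : EllTwo) :
    Continuous (S.conjFlow w x) := by
  refine continuous_iff_continuousAt.2 fun t => ?_
  obtain ⟨n, hn⟩ := S.exists_forall_conjFlow_eq hw (t + 1) ‖x‖
  refine ((S.isGlobalField_truncField n hw).continuous_picardFlow x).continuousAt.congr ?_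
  filter_upwards [Iio_mem_nhds (show t < t + 1 by linarith)] with s hs
  exact (hn n le_rfl x le_rfl s (le_of_lt hs)).1.symm

theorem hasDerivWithinAt_conjFlow {w : ℝ → ℝ} (hw : Continuous w) (x : EllTwo) {t : ℝ}
    (ht : 0 ≤ t) :
    HasDerivWithinAt (S.conjFlow w x) (S.field (w t) (S.conjFlow w x t)) (Ici 0) t := by
  obtain ⟨n, hn⟩ := S.exists_forall_conjFlow_eq hw (t + 1) ‖x‖
  have h1 := hn n le_rfl x le_rfl t (by linarith)
  have h2 := (S.isGlobalField_truncField n hw).hasDerivWithinAt_picardFlow x ht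
  rw [← h1.1, S.truncField_eq_field (h1.2 ht)] at h2
  refine h2.congr_of_eventuallyEq ?_ h1.1
  filter_upwards [mem_nhdsWithin_of_mem_nhds (Iio_mem_nhds (show t < t + 1 by linarith))] with s hs
  exact (hn n le_rfl x le_rfl s (le_of_lt hs)).1

/-- Solutions of the conjugated equation on `[0, T]` are unique. -/
theorem eq_conjFlow {w : ℝ → ℝ} (hw : Continuous w) (x : EllTwo) {T : ℝ} {f : ℝ → EllTwo}
    (h0 : f 0 = x)
    (hf : ∀ t ∈ Icc 0 T, HasDerivWithinAt f (S.field (w t) (f t)) (Icc 0 T) t) {t : ℝ}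
    (ht : t ∈ Icc 0 T) : f t = S.conjFlow w x t := by
  have hfc : ContinuousOn f (Icc 0 T) := fun s hs => (hf s hs).continuousWithinAt
  obtain ⟨M, hM⟩ := isCompact_Icc.exists_bound_of_continuousOn
    ((continuous_uncurry_expMul S.α).comp_continuousOn (hw.continuousOn.prodMk hfc))
  obtain ⟨n₀, hn₀⟩ := S.exists_forall_conjFlow_eq hw T ‖x‖
  have hn := hn₀ (max n₀ ⌈M⌉₊) (le_max_left _ _) x le_rfl t ht.2
  rw [hn.1]
  refine (S.isGlobalField_truncField _ hw).eq_picardFlow x h0 (fun s hs => ?_) ht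
  rw [S.truncField_eq_field]
  · exact hf s hs
  · exact (hM s hs).trans ((Nat.le_ceil M).trans (Nat.cast_le.2 (le_max_right _ _)))

theorem continuous_conjFlow_initial {w : ℝ → ℝ} (hw : Continuous w) (t : ℝ) :
    Continuous fun x => S.conjFlow w x t := by
  rcases le_total t 0 with ht | ht
  · simp only [S.conjFlow_of_nonpos w _ ht]
    exact continuous_id
  refine continuous_iff_continuousAt.2 fun x => ?_
  obtain ⟨n, hn⟩ := S.exists_forall_conjFlow_eq hw t (‖x‖ + 1)
  refine ((S.isGlobalField_truncField n hw).continuous_picardFlow_initial ht).continuousAt.congr ?_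
  filter_upwards [continuous_norm.continuousAt.eventually_lt_const
    (show ‖x‖ < ‖x‖ + 1 by linarith)] with y hy
  exact (hn n le_rfl y hy.le t le_rfl).1.symm

/-- The solution depends measurably on a parameter, if the driving path and the initial value do. -/
theorem measurable_conjFlow {X : Type*} [MeasurableSpace X] {w : X → ℝ → ℝ} {x₀ : X → EllTwo}
    (hw : ∀ x, Continuous (w x)) (hwm : ∀ t, Measurable fun x => w x t) (hx₀ : Measurable x₀)
    (t : ℝ) : Measurable fun x => S.conjFlow (w x) (x₀ x) t := by
  rcases le_total t 0 with ht | ht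
  · simp only [S.conjFlow_of_nonpos _ _ ht]
    exact hx₀
  refine measurable_of_tendsto_metrizable (fun n : ℕ => measurable_picardFlow
    (S.continuous_truncField n) (fun x => S.isGlobalField_truncField n (hw x)) hw hwm hx₀ ht)
    (tendsto_pi_nhds.2 fun x => ?_)
  obtain ⟨n₀, hn₀⟩ := S.exists_forall_conjFlow_eq (hw x) t ‖x₀ x‖
  exact tendsto_const_nhds.congr' ((eventually_ge_atTop n₀).mono
    fun n hn => (hn₀ n hn (x₀ x) le_rfl t le_rfl).1)

/-- The solution at time `t` only depends on the driving path on `[0, t]`. -/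
theorem conjFlow_congr {w w' : ℝ → ℝ} (hw : Continuous w) (hw' : Continuous w') (x : EllTwo)
    {t : ℝ} (h : ∀ s ∈ Icc 0 t, w s = w' s) : S.conjFlow w x t = S.conjFlow w' x t := by
  rcases le_total t 0 with ht | ht
  · rw [S.conjFlow_of_nonpos _ _ ht, S.conjFlow_of_nonpos _ _ ht]
  refine S.eq_conjFlow hw' x (T := t) (S.conjFlow_of_nonpos _ _ le_rfl) (fun s hs => ?_) ⟨ht, le_rfl⟩
  rw [← h s hs]
  exact (S.hasDerivWithinAt_conjFlow hw x hs.1).mono Icc_subset_Ici_self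

/-- The solution of the Stratonovich equation driven by the path `w`: `u = e^{α w} h`, where `h`
solves the conjugated equation. -/
noncomputable def pathFlow (w : ℝ → ℝ) (x : EllTwo) (t : ℝ) : EllTwo :=
  expMul S.α (w t) (S.conjFlow w x t)

theorem pathFlow_zero {w : ℝ → ℝ} (h0 : w 0 = 0) (x : EllTwo) : S.pathFlow w x 0 = x := by
  rw [pathFlow, h0, expMul_zero, S.conjFlow_of_nonpos w x le_rfl]

theorem continuous_pathFlow {w : ℝ → ℝ} (hw : Continuous w) (x : EllTwo) :
    Continuous (S.pathFlow w x) := hw.expMul S.α (S.continuous_conjFlow hw x)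

theorem continuous_pathFlow_initial {w : ℝ → ℝ} (hw : Continuous w) (t : ℝ) :
    Continuous fun x => S.pathFlow w x t :=
  continuous_const.expMul S.α (S.continuous_conjFlow_initial hw t)

theorem measurable_pathFlow {X : Type*} [MeasurableSpace X] {w : X → ℝ → ℝ} {x₀ : X → EllTwo}
    (hw : ∀ x, Continuous (w x)) (hwm : ∀ t, Measurable fun x => w x t) (hx₀ : Measurable x₀)
    (t : ℝ) : Measurable fun x => S.pathFlow (w x) (x₀ x) t :=
  (hwm t).expMul S.α (S.measurable_conjFlow hw hwm hx₀ t)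

/-- The flow property along the shifted path `r ↦ w(r + s) - w(s)`. -/
theorem pathFlow_add {w : ℝ → ℝ} (hw : Continuous w) (x : EllTwo) {s t : ℝ}
    (hs : 0 ≤ s) (ht : 0 ≤ t) :
    S.pathFlow w x (s + t) = S.pathFlow (fun r => w (r + s) - w s) (S.pathFlow w x s) t := by
  have hw' : Continuous fun r => w (r + s) - w s := by fun_prop
  have key : expMul S.α (w s) (S.conjFlow w x (t + s))
      = S.conjFlow (fun r => w (r + s) - w s) (S.pathFlow w x s) t := by
    refine S.eq_conjFlow hw' _ (T := t) (f := fun r => expMul S.α (w s) (S.conjFlow w x (r + s)))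
      (by rw [zero_add]; rfl) (fun r hr => ?_) ⟨ht, le_rfl⟩
    have h1 : HasDerivWithinAt (fun r => S.conjFlow w x (r + s))
        (S.field (w (r + s)) (S.conjFlow w x (r + s))) (Icc 0 t) r := by
      have h := (S.hasDerivWithinAt_conjFlow hw x (add_nonneg hr.1 hs)).scomp r
        ((hasDerivAt_id r).add_const s).hasDerivWithinAt (s := Icc 0 t)
        (fun a ha => add_nonneg ha.1 hs)
      rwa [one_smul] at h
    have h2 := (hasDerivWithinAt_const r (Icc 0 t) (w s)).expMul S.α h1
    refine h2.congr_deriv ?_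
    rw [zero_smul, add_zero, field, field, ← expMul_add, ← expMul_add, sub_add_cancel]
    congr 1
    ring
  rw [pathFlow, pathFlow, ← key, ← expMul_add, add_comm s t, sub_add_cancel]

end LatticeSystem

/-! ### The Borel σ-algebra of the path space -/

/-- Evaluation at the rationals identifies `C(ℝ, ℝ)`, as a measurable space, with a subspace of a
countable product, because `C(ℝ, ℝ)` is Polish. -/
theorem measurableEmbedding_evalRat :
    MeasurableEmbedding fun (f : C(ℝ, ℝ)) (q : ℚ) => f (q : ℝ) := by
  refine Continuous.measurableEmbedding (by fun_prop) fun f g h => ?_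
  have h2 : (f : ℝ → ℝ) = g :=
    Continuous.ext_on Rat.isDenseEmbedding_coe_real.dense f.continuous g.continuous (by
      rintro _ ⟨q, rfl⟩
      exact congrFun h q)
  exact DFunLike.coe_injective h2

theorem measurable_pathSpace_eval (t : ℝ) : Measurable fun ω : PathSpace => ω.1 t :=
  (continuous_eval_const t).measurable.comp measurable_subtype_coe

theorem continuous_wienerShift :
    Continuous fun q : ℝ × PathSpace => wienerShift q.1 q.2 := by
  refine Continuous.subtype_mk ?_ _
  refine ContinuousMap.continuous_of_continuous_uncurry _ ?_
  have h : Continuous fun q : (ℝ × PathSpace) × ℝ =>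
      q.1.2.1 (q.2 + q.1.1) - q.1.2.1 q.1.1 := by
    have h1 : Continuous fun q : (ℝ × PathSpace) × ℝ => q.1.2.1 :=
      continuous_subtype_val.comp (continuous_snd.comp continuous_fst)
    exact (ContinuousEval.continuous_eval.comp (h1.prodMk (by fun_prop))).sub
      (ContinuousEval.continuous_eval.comp (h1.prodMk (by fun_prop)))
  exact h

theorem measurable_regularShift :
    Measurable fun q : ℝ × regularPaths => regularShift q.1 q.2 := by
  have : SecondCountableTopology PathSpace := TopologicalSpace.Subtype.secondCountableTopology _
  refine Measurable.subtype_mk ?_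
  exact continuous_wienerShift.measurable.comp
    (measurable_fst.prodMk (measurable_subtype_coe.comp measurable_snd))

theorem measurable_wienerShift (t : ℝ) : Measurable (wienerShift t) :=
  (continuous_wienerShift.comp (Continuous.prodMk_right t)).measurable

/-! ### Shift invariance of the Wiener measure -/

/-- The successive increments of a function along `t`. -/
def incr {n : ℕ} (t : Fin (n + 1) → ℝ) (f : ℝ → ℝ) (i : Fin n) : ℝ :=
  f (t i.succ) - f (t i.castSucc)

/-- The value at `t j` of a function is recovered from its increments. -/
theorem sum_incr {n : ℕ} (t : Fin (n + 1) → ℝ) (f : ℝ → ℝ) (j : Fin (n + 1)) :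
    ∑ i : Fin n, (if i.castSucc < j then incr t f i else 0) = f (t j) - f (t 0) := by
  induction j using Fin.induction with
  | zero => simp
  | succ j ih =>
    have h : ∀ i : Fin n, (if i.castSucc < j.succ then incr t f i else 0)
        = (if i.castSucc < j.castSucc then incr t f i else 0) + if i = j then incr t f i else 0 := by
      intro i
      rcases lt_trichotomy i j with h | h | h
      · have h1 : i.castSucc < j.succ := Fin.castSucc_lt_succ_iff.2 h.le
        simp [h1, h, h.ne]
      · subst h
        simp
      · have h1 : ¬ i.castSucc < j.succ := by
          rw [Fin.castSucc_lt_succ_iff]; exact not_le.2 h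
        simp [h1, h.not_gt, h.ne']
    simp only [h, Finset.sum_add_distrib, ih, Finset.sum_ite_eq', Finset.mem_univ, if_true]
    rw [incr]; ring

theorem IsWienerMeasure.map_incr {P : Measure PathSpace} (hP : IsWienerMeasure P) {n : ℕ}
    {t : Fin (n + 1) → ℝ} (ht : Monotone t) :
    P.map (fun ω => incr t fun r => ω.1 r) = Measure.pi fun i : Fin n =>
      gaussianReal 0 (Real.toNNReal (t i.succ - t i.castSucc)) := by
  have := hP.isProbabilityMeasure
  have h1 := (iIndepFun_iff_map_fun_eq_pi_map fun i =>
    ((measurable_pathSpace_eval _).sub (measurable_pathSpace_eval _)).aemeasurable).1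
      (hP.hasIndepIncrements n t ht)
  have h2 : ∀ i : Fin n, P.map (fun ω => ω.1 (t i.succ) - ω.1 (t i.castSucc))
      = gaussianReal 0 (Real.toNNReal (t i.succ - t i.castSucc)) := fun i =>
    (hP.hasLaw_increment _ _ (ht (Fin.castSucc_lt_succ).le)).map_eq
  exact h1.trans (congrArg Measure.pi (funext h2))

/-- The Wiener shift preserves the Wiener measure: both laws have the same finite-dimensional
distributions, since these are determined by the increments between sorted times. -/
theorem IsWienerMeasure.map_wienerShift {P : Measure PathSpace} (hP : IsWienerMeasure P) (s : ℝ) :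
    P.map (wienerShift s) = P := by
  have := hP.isProbabilityMeasure
  have hm := measurable_wienerShift s
  have hemb : MeasurableEmbedding fun (ω : PathSpace) (q : ℚ) => ω.1 (q : ℝ) := by
    refine measurableEmbedding_evalRat.comp (MeasurableEmbedding.subtype_coe ?_)
    exact (isClosed_eq (continuous_eval_const 0) continuous_const).measurableSet
  have key : P.map (fun ω (q : ℚ) => (wienerShift s ω).1 q) = P.map fun ω (q : ℚ) => ω.1 (q : ℝ) := by
    refine (map_eq_iff_forall_finset_map_restrict_eq
      (X := fun (q : ℚ) ω => (wienerShift s ω).1 q) (Y := fun (q : ℚ) ω => ω.1 (q : ℝ))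
      (measurable_pi_lambda _ fun q : ℚ => (measurable_pathSpace_eval (q : ℝ)).comp hm).aemeasurable
      (measurable_pi_lambda _ fun q : ℚ => measurable_pathSpace_eval (q : ℝ)).aemeasurable).2 fun I => ?_
    classical
    set J : Finset ℝ := insert 0 (I.image fun q : ℚ => (q : ℝ)) with hJ
    obtain ⟨n, hn⟩ : ∃ n, J.card = n + 1 :=
      Nat.exists_eq_succ_of_ne_zero (Finset.card_ne_zero_of_mem (Finset.mem_insert_self 0 _))
    set t : Fin (n + 1) → ℝ := fun i => J.orderEmbOfFin hn i with ht
    have htm : Monotone t := (J.orderEmbOfFin hn).monotone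
    have hsurj : ∀ r ∈ J, ∃ j, t j = r := fun r hr => by
      have : r ∈ range (J.orderEmbOfFin hn) := by rw [Finset.range_orderEmbOfFin]; exact hr
      exact this
    obtain ⟨k, hk⟩ := hsurj 0 (Finset.mem_insert_self 0 _)
    choose j hj using fun q : I => hsurj (q.1 : ℝ)
      (Finset.mem_insert_of_mem (Finset.mem_image_of_mem _ q.2))
    set G : (Fin n → ℝ) → I → ℝ := fun d q =>
      (∑ i : Fin n, if i.castSucc < j q then d i else 0) - ∑ i : Fin n, if i.castSucc < k then d i else 0
      with hG
    have hGm : Measurable G := by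
      refine measurable_pi_lambda _ fun q => ?_
      refine Measurable.sub ?_ ?_ <;>
      · refine Finset.measurable_sum _ fun i _ => ?_
        split_ifs
        · exact measurable_pi_apply i
        · exact measurable_const
    have hrec : ∀ f : ℝ → ℝ, f 0 = 0 → (fun q : I => f (q.1 : ℝ)) = G (incr t f) := fun f h0 => by
      funext q
      simp only [hG]
      rw [sum_incr, sum_incr, hk, h0, hj]
      ring
    have h1 : ∀ ω : PathSpace, (I.restrict fun q : ℚ => ω.1 (q : ℝ))
        = G (incr t fun r => ω.1 r) := fun ω => hrec (fun r => ω.1 r) ω.2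
    simp only [h1]
    have hmi : ∀ t : Fin (n + 1) → ℝ, Measurable fun ω : PathSpace => incr t fun r => ω.1 r := fun t =>
      measurable_pi_lambda _ fun i => (measurable_pathSpace_eval _).sub (measurable_pathSpace_eval _)
    have e1 : (fun ω => G (incr t fun r => ω.1 r)) = G ∘ fun ω : PathSpace => incr t fun r => ω.1 r := rfl
    have e2 : (fun ω => G (incr t fun r => (wienerShift s ω).1 r))
        = G ∘ fun ω : PathSpace => incr (fun i => t i + s) fun r => ω.1 r := by
      funext ω
      change G _ = G _
      congr 1
      funext i
      change (ω.1 (t i.succ + s) - ω.1 s) - (ω.1 (t i.castSucc + s) - ω.1 s)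
        = ω.1 (t i.succ + s) - ω.1 (t i.castSucc + s)
      ring
    rw [e1, e2, ← Measure.map_map hGm (hmi _), ← Measure.map_map hGm (hmi _), hP.map_incr htm,
      hP.map_incr fun a b hab => add_le_add_left (htm hab) s]
    simp only [add_sub_add_right_eq_sub]
  have h2 := hemb.comap_map (P.map (wienerShift s))
  rw [Measure.map_map hemb.measurable hm] at h2
  exact h2.symm.trans ((congrArg _ key).trans (hemb.comap_map P))

/-! ### The Ornstein-Uhlenbeck process and regular paths -/

/-- Sublinear growth on the real line. -/
def IsSublinear (f : ℝ → ℝ) : Prop := ∀ ε : ℝ, 0 < ε → ∃ C : ℝ, ∀ t, |f t| ≤ ε * |t| + C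

theorem IsSublinear.sub {f g : ℝ → ℝ} (hf : IsSublinear f) (hg : IsSublinear g) :
    IsSublinear fun t => f t - g t := fun ε hε => by
  obtain ⟨C, hC⟩ := hf (ε / 2) (by positivity)
  obtain ⟨D, hD⟩ := hg (ε / 2) (by positivity)
  exact ⟨C + D, fun t => (abs_sub _ _).trans (by linarith [hC t, hD t])⟩

theorem isSublinear_const (c : ℝ) : IsSublinear fun _ => c := fun ε hε =>
  ⟨|c|, fun t => by have := mul_nonneg hε.le (abs_nonneg t); linarith⟩

theorem IsSublinear.tendsto {f : ℝ → ℝ} (hf : IsSublinear f) {l : Filter ℝ}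
    (hl : Tendsto (fun t : ℝ => |t|) l atTop) : Tendsto (fun t => |f t| / |t|) l (𝓝 0) := by
  refine Metric.tendsto_nhds.2 fun ε hε => ?_
  obtain ⟨C, hC⟩ := hf (ε / 2) (by positivity)
  filter_upwards [hl.eventually_gt_atTop 0, hl.eventually_gt_atTop (C / (ε / 2))] with t h1 h2
  rw [dist_zero_right, Real.norm_of_nonneg (by positivity), div_lt_iff₀ h1]
  rw [div_lt_iff₀ (by positivity)] at h2
  linarith [hC t]

theorem Continuous.isSublinear {f : ℝ → ℝ} (hf : Continuous f)
    (h1 : Tendsto (fun t => |f t| / |t|) atTop (𝓝 0))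
    (h2 : Tendsto (fun t => |f t| / |t|) atBot (𝓝 0)) : IsSublinear f := fun ε hε => by
  obtain ⟨a, ha⟩ := eventually_atTop.1 ((h1.eventually (gt_mem_nhds hε)).and
    (eventually_gt_atTop 0))
  obtain ⟨b, hb⟩ := eventually_atBot.1 ((h2.eventually (gt_mem_nhds hε)).and
    (eventually_lt_atBot 0))
  obtain ⟨C, hC⟩ := (isCompact_Icc (a := b) (b := a)).exists_bound_of_continuousOn hf.continuousOn
  refine ⟨|C|, fun t => ?_⟩
  have key : ∀ t : ℝ, t ≠ 0 → |f t| / |t| < ε → |f t| ≤ ε * |t| + |C| := fun t h0 h => by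
    rw [div_lt_iff₀ (abs_pos.2 h0)] at h
    linarith [abs_nonneg C]
  rcases le_total a t with h | h
  · exact key t (ha t h).2.ne' (ha t h).1
  rcases le_total t b with h' | h'
  · exact key t (hb t h').2.ne (hb t h').1
  · have := hC t ⟨h', h⟩
    rw [Real.norm_eq_abs] at this
    have := mul_nonneg hε.le (abs_nonneg t)
    linarith [le_abs_self C]

/-- The exponentially weighted average `e^{-t} ∫_{-∞}^t e^s f(s) ds` of the past of `f`. -/
noncomputable def expAverage (f : ℝ → ℝ) (t : ℝ) : ℝ :=
  Real.exp (-t) * ∫ s in Iic t, Real.exp s * f s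

theorem integrableOn_exp_mul_Iic_of_zero {f : ℝ → ℝ} (hf : Continuous f)
    (hi : IntegrableOn (fun s => Real.exp s * f s) (Iic 0)) (t : ℝ) :
    IntegrableOn (fun s => Real.exp s * f s) (Iic t) := by
  have h : IntegrableOn (fun s => Real.exp s * f s) (Icc 0 t) :=
    (Continuous.continuousOn (by fun_prop)).integrableOn_Icc
  refine (hi.union h).mono_set fun s hs => ?_
  rcases le_total s 0 with h0 | h0
  · exact Or.inl h0
  · exact Or.inr ⟨h0, hs⟩

theorem hasDerivAt_expAverage {f : ℝ → ℝ} (hf : Continuous f)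
    (hi : IntegrableOn (fun s => Real.exp s * f s) (Iic 0)) (t : ℝ) :
    HasDerivAt (expAverage f) (f t - expAverage f t) t := by
  have hg : Continuous fun s => Real.exp s * f s := by fun_prop
  have e : (fun t => ∫ s in Iic t, Real.exp s * f s)
      = fun t => (∫ s in Iic (0 : ℝ), Real.exp s * f s) + ∫ s in (0 : ℝ)..t, Real.exp s * f s := by
    funext t
    rw [← intervalIntegral.integral_Iic_sub_Iic hi (integrableOn_exp_mul_Iic_of_zero hf hi t)]
    ring
  have h1 : HasDerivAt (fun t => ∫ s in Iic t, Real.exp s * f s) (Real.exp t * f t) t := by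
    rw [e]
    exact (intervalIntegral.integral_hasDerivAt_right (hg.intervalIntegrable 0 t)
      (hg.stronglyMeasurableAtFilter _ _) hg.continuousAt).const_add _
  have h2 : HasDerivAt (fun t : ℝ => Real.exp (-t)) (Real.exp (-t) * (-1)) t :=
    (hasDerivAt_neg t).exp
  refine (h2.mul h1).congr_deriv ?_
  rw [expAverage, ← mul_assoc, ← Real.exp_add, neg_add_cancel, Real.exp_zero]
  ring

theorem integrableOn_exp_mul_comp_add {f : ℝ → ℝ} {t : ℝ}
    (hi : IntegrableOn (fun s => Real.exp s * f s) (Iic t)) :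
    IntegrableOn (fun s => Real.exp s * f (s + t)) (Iic 0) ∧
      ∫ s in Iic (0 : ℝ), Real.exp s * f (s + t) = expAverage f t := by
  have hmp := measurePreserving_add_right (volume : Measure ℝ) t
  have hemb := (MeasurableEquiv.addRight t).measurableEmbedding
  have hpre : (fun s : ℝ => s + t) ⁻¹' Iic t = Iic 0 := by ext s; simp
  have e : (fun s => Real.exp s * f (s + t))
      = fun s => Real.exp (-t) * (Real.exp (s + t) * f (s + t)) := by
    funext s
    rw [← mul_assoc, ← Real.exp_add]
    congr 2; ring
  rw [e, expAverage, integral_const_mul, ← hpre]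
  exact ⟨((hmp.integrableOn_comp_preimage hemb).2 hi).const_mul _,
    by rw [hmp.setIntegral_preimage_emb hemb (fun s => Real.exp s * f s)]⟩

theorem integrableOn_exp_wienerShift {ω : PathSpace}
    (hi : IntegrableOn (fun s => Real.exp s * ω.1 s) (Iic 0)) (t : ℝ) :
    IntegrableOn (fun s => Real.exp s * (wienerShift t ω).1 s) (Iic 0) ∧
      ouVar (wienerShift t ω) = ω.1 t - expAverage (fun s => ω.1 s) t := by
  have h := integrableOn_exp_mul_comp_add
    (integrableOn_exp_mul_Iic_of_zero ω.1.continuous hi t)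
  have e : (fun s => Real.exp s * (wienerShift t ω).1 s)
      = fun s => Real.exp s * ω.1 (s + t) - Real.exp s * ω.1 t := by
    funext s
    change Real.exp s * (ω.1 (s + t) - ω.1 t) = _
    ring
  have h2 : IntegrableOn (fun s => Real.exp s * ω.1 t) (Iic 0) :=
    (integrableOn_exp_Iic 0).mul_const _
  rw [ouVar, e]
  refine ⟨h.1.sub h2, ?_⟩
  rw [integral_sub h.1 h2, integral_mul_const, integral_exp_Iic_zero, h.2]
  ring

theorem IsRegularPath.integrableOn_self {ω : PathSpace} (h : IsRegularPath ω) :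
    IntegrableOn (fun s => Real.exp s * ω.1 s) (Iic 0) := by
  have e : (fun s => Real.exp s * (wienerShift 0 ω).1 s) = fun s => Real.exp s * ω.1 s := by
    funext s
    change Real.exp s * (ω.1 (s + 0) - ω.1 0) = _
    rw [ω.2, add_zero, sub_zero]
  exact e ▸ h.integrableOn 0

/-- The average `m` of the past solves `m' = ω - m`, and the Ornstein-Uhlenbeck process is
`z = ω - m`; hence `m` is a primitive of `z`. -/
theorem integral_ouVar {ω : PathSpace}
    (hi : IntegrableOn (fun s => Real.exp s * ω.1 s) (Iic 0)) (t : ℝ) :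
    ∫ s in (0 : ℝ)..t, ouVar (wienerShift s ω)
      = expAverage (fun s => ω.1 s) t - expAverage (fun s => ω.1 s) 0 := by
  have hd := hasDerivAt_expAverage ω.1.continuous hi
  have hc : Continuous (expAverage fun s => ω.1 s) :=
    continuous_iff_continuousAt.2 fun t => (hd t).continuousAt
  simp only [(integrableOn_exp_wienerShift hi _).2]
  exact intervalIntegral.integral_eq_sub_of_hasDerivAt (fun s _ => hd s)
    ((ω.1.continuous.sub hc).intervalIntegrable _ _)

/-- The Langevin equation `dω = dz + z dt` in integrated form. -/
theorem IsRegularPath.eq_ouVar {ω : PathSpace} (h : IsRegularPath ω) (t : ℝ) :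
    ω.1 t = ouVar (wienerShift t ω) - ouVar (wienerShift 0 ω)
      + ∫ s in (0 : ℝ)..t, ouVar (wienerShift s ω) := by
  rw [integral_ouVar h.integrableOn_self, (integrableOn_exp_wienerShift h.integrableOn_self t).2,
    (integrableOn_exp_wienerShift h.integrableOn_self 0).2, ω.2]
  ring

theorem integrableOn_exp_mul_abs : IntegrableOn (fun s : ℝ => Real.exp s * |s|) (Iic 0) := by
  have h := (integrableOn_exp_mul_Iic (a := 1 / 2) (by norm_num) 0).const_mul 2
  refine h.mono' (Continuous.aestronglyMeasurable (by fun_prop)) ?_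
  filter_upwards [ae_restrict_mem measurableSet_Iic] with s hs
  rw [Real.norm_of_nonneg (by positivity), abs_of_nonpos hs]
  have h1 : -(1 / 2) * s + 1 ≤ Real.exp (-(1 / 2) * s) := Real.add_one_le_exp _
  have h2 : Real.exp s = Real.exp (1 / 2 * s) * Real.exp (1 / 2 * s) := by
    rw [← Real.exp_add]; congr 1; ring
  have h3 : Real.exp (1 / 2 * s) * Real.exp (-(1 / 2) * s) = 1 := by
    rw [← Real.exp_add, ← Real.exp_zero]; congr 1; ring
  have h4 := (Real.exp_pos (1 / 2 * s)).le
  calc Real.exp s * -s ≤ Real.exp s * (2 * Real.exp (-(1 / 2) * s)) := by gcongr; linarith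
    _ = 2 * Real.exp (1 / 2 * s) * (Real.exp (1 / 2 * s) * Real.exp (-(1 / 2) * s)) := by
      rw [h2]; ring
    _ = 2 * Real.exp (1 / 2 * s) := by rw [h3, mul_one]

theorem IsSublinear.integrableOn {f : ℝ → ℝ} (hf : Continuous f) (h : IsSublinear f) :
    IntegrableOn (fun s => Real.exp s * f s) (Iic 0) := by
  obtain ⟨C, hC⟩ := h 1 one_pos
  refine (integrableOn_exp_mul_abs.add ((integrableOn_exp_Iic 0).mul_const C)).mono'
    (Continuous.aestronglyMeasurable (by fun_prop)) (ae_of_all _ fun s => ?_)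
  rw [norm_mul, Real.norm_of_nonneg (Real.exp_pos s).le, Real.norm_eq_abs, Pi.add_apply, ← mul_add]
  have := hC s
  rw [one_mul] at this
  exact mul_le_mul_of_nonneg_left this (Real.exp_pos s).le

theorem IsSublinear.expAverage {f : ℝ → ℝ} (hf : Continuous f) (h : IsSublinear f) :
    IsSublinear (expAverage f) := fun ε hε => by
  obtain ⟨C, hC⟩ := h ε hε
  refine ⟨ε * (∫ s in Iic (0 : ℝ), Real.exp s * |s|) + C, fun t => ?_⟩
  rw [← (integrableOn_exp_mul_comp_add
    (integrableOn_exp_mul_Iic_of_zero hf (h.integrableOn hf) t)).2, ← Real.norm_eq_abs]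
  have h1 := integrableOn_exp_mul_abs.const_mul ε
  have h2 := (integrableOn_exp_Iic 0).mul_const (ε * |t| + C)
  calc _ ≤ ∫ s in Iic (0 : ℝ), (ε * (Real.exp s * |s|) + Real.exp s * (ε * |t| + C)) := by
        refine norm_integral_le_of_norm_le (h1.add h2) (ae_of_all _ fun s => ?_)
        rw [norm_mul, Real.norm_of_nonneg (Real.exp_pos s).le, Real.norm_eq_abs]
        have e : ε * (Real.exp s * |s|) + Real.exp s * (ε * |t| + C)
            = Real.exp s * (ε * (|s| + |t|) + C) := by ring
        rw [e]
        refine mul_le_mul_of_nonneg_left ((hC _).trans ?_) (Real.exp_pos s).le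
        have := mul_le_mul_of_nonneg_left (abs_add_le s t) hε.le
        linarith
    _ = _ := by
        rw [integral_add h1 h2, integral_const_mul, integral_mul_const, integral_exp_Iic_zero]
        ring

/-- A path is regular if and only if it grows sublinearly. -/
theorem isRegularPath_iff {ω : PathSpace} : IsRegularPath ω ↔ IsSublinear fun t => ω.1 t := by
  constructor
  · intro h
    have key : ∀ l : Filter ℝ, Tendsto (fun t : ℝ => |t|) l atTop →
        Tendsto (fun t : ℝ => |ouVar (wienerShift t ω)| / |t|) l (𝓝 0) →
        Tendsto (fun t : ℝ => 1 / t * ∫ s in (0 : ℝ)..t, ouVar (wienerShift s ω)) l (𝓝 0) →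
        Tendsto (fun t => |ω.1 t| / |t|) l (𝓝 0) := fun l hl h1 h2 => by
      have h3 := (h1.add ((isSublinear_const (ouVar (wienerShift 0 ω))).tendsto hl)).add h2.abs
      rw [add_zero, abs_zero, add_zero] at h3
      refine squeeze_zero (fun t => by positivity) (fun t => ?_) h3
      rw [abs_mul, abs_div, abs_one, one_div_mul_eq_div, ← add_div, ← add_div]
      refine div_le_div_of_nonneg_right ?_ (abs_nonneg t)
      rw [h.eq_ouVar t]
      have h4 := abs_sub (ouVar (wienerShift t ω)) (ouVar (wienerShift 0 ω))
      exact (abs_add_le _ _).trans (by linarith)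
    exact ω.1.continuous.isSublinear
      (key _ tendsto_abs_atTop_atTop h.sublinear_atTop h.average_atTop)
      (key _ tendsto_abs_atBot_atTop h.sublinear_atBot h.average_atBot)
  · intro h
    have hi := h.integrableOn ω.1.continuous
    have hav := h.expAverage ω.1.continuous
    have hz := h.sub hav
    have hd := hasDerivAt_expAverage ω.1.continuous hi
    have hc : Continuous (expAverage fun s => ω.1 s) :=
      continuous_iff_continuousAt.2 fun t => (hd t).continuousAt
    have hint : ∀ l : Filter ℝ, Tendsto (fun t : ℝ => |t|) l atTop →
        Tendsto (fun t : ℝ => 1 / t * ∫ s in (0 : ℝ)..t, ouVar (wienerShift s ω)) l (𝓝 0) :=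
      fun l hl => by
        refine (tendsto_zero_iff_abs_tendsto_zero _).2 ?_
        refine ((hav.sub (isSublinear_const (expAverage (fun s => ω.1 s) 0))).tendsto hl).congr
          fun t => ?_
        simp only [Function.comp, integral_ouVar hi]
        rw [abs_mul, abs_div, abs_one, one_div_mul_eq_div]
    refine ⟨fun t => (integrableOn_exp_wienerShift hi t).1, ?_, fun γ hγ => ?_, ?_, ?_,
      hint _ tendsto_abs_atTop_atTop, hint _ tendsto_abs_atBot_atTop⟩
    · simp only [(integrableOn_exp_wienerShift hi _).2]
      exact ω.1.continuous.sub hc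
    · simp only [(integrableOn_exp_wienerShift hi _).2]
      obtain ⟨C, hC⟩ := hz 1 one_pos
      have h1 := (tendsto_rpow_mul_exp_neg_mul_atTop_nhds_zero 1 γ hγ).add
        ((tendsto_rpow_mul_exp_neg_mul_atTop_nhds_zero 0 γ hγ).mul_const C)
      rw [zero_mul, add_zero] at h1
      refine squeeze_zero' (.of_forall fun t => by positivity) ?_ h1
      filter_upwards [eventually_ge_atTop 0] with t ht
      rw [Real.rpow_one, Real.rpow_zero, one_mul, mul_comm t, ← mul_add]
      refine mul_le_mul_of_nonneg_left ((hC (-t)).trans (le_of_eq ?_)) (Real.exp_pos _).le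
      rw [one_mul, abs_neg, abs_of_nonneg ht]
    · simp only [(integrableOn_exp_wienerShift hi _).2]
      exact hz.tendsto tendsto_abs_atTop_atTop
    · simp only [(integrableOn_exp_wienerShift hi _).2]
      exact hz.tendsto tendsto_abs_atBot_atTop

/-- Sublinear growth is a countable condition: it suffices to test rational times, and slopes
`1 / (n + 1)` with integer offsets. -/
theorem measurableSet_regularPaths : MeasurableSet regularPaths := by
  have e : regularPaths = ⋂ n : ℕ, ⋃ C : ℕ, ⋂ q : ℚ,
      {ω : PathSpace | |ω.1 (q : ℝ)| ≤ 1 / ((n : ℝ) + 1) * |(q : ℝ)| + C} := by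
    ext ω
    simp only [mem_iInter, mem_iUnion, mem_ofPred_eq]
    refine isRegularPath_iff.trans ⟨fun h n => ?_, fun h ε hε => ?_⟩
    · obtain ⟨C, hC⟩ := h (1 / ((n : ℝ) + 1)) (by positivity)
      exact ⟨⌈C⌉₊, fun q => (hC q).trans (by linarith [Nat.le_ceil C])⟩
    · obtain ⟨n, hn⟩ := exists_nat_one_div_lt hε
      obtain ⟨C, hC⟩ := h n
      refine ⟨C, fun t => ?_⟩
      have h1 : |ω.1 t| ≤ 1 / ((n : ℝ) + 1) * |t| + C := by
        have hcl : IsClosed {t : ℝ | |ω.1 t| ≤ 1 / ((n : ℝ) + 1) * |t| + C} :=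
          isClosed_le (by fun_prop) (by fun_prop)
        have hd : Dense {t : ℝ | |ω.1 t| ≤ 1 / ((n : ℝ) + 1) * |t| + C} :=
          Rat.isDenseEmbedding_coe_real.dense.mono (by rintro _ ⟨q, rfl⟩; exact hC q)
        exact (hcl.closure_eq ▸ hd.closure_eq ▸ mem_univ t :)
      refine h1.trans ?_
      have := mul_le_mul_of_nonneg_right hn.le (abs_nonneg t)
      linarith
  rw [e]
  refine MeasurableSet.iInter fun n => MeasurableSet.iUnion fun C => MeasurableSet.iInter fun q => ?_
  exact measurableSet_le (measurable_pathSpace_eval _).abs measurable_const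

/-! ### Gaussian increments -/

/-- The absolute moment of order `n` of the standard Gaussian law. -/
noncomputable def gaussianAbsMoment (n : ℕ) : ℝ≥0∞ :=
  ∫⁻ x, ENNReal.ofReal (|x| ^ n) ∂gaussianReal 0 1

theorem gaussianAbsMoment_ne_top {n : ℕ} (hn : n ≠ 0) : gaussianAbsMoment n ≠ ∞ := by
  have h := (memLp_id_gaussianReal (μ := 0) (v := 1) (n : ℝ≥0)).integrable_norm_pow
    (p := n) (by simpa using hn)
  have h2 := h.lintegral_lt_top
  simpa [gaussianAbsMoment] using h2.ne

theorem lintegral_abs_pow_gaussianReal (n : ℕ) (v : ℝ≥0) :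
    ∫⁻ x, ENNReal.ofReal (|x| ^ n) ∂gaussianReal 0 v
      = ENNReal.ofReal (Real.sqrt v ^ n) * gaussianAbsMoment n := by
  have h := gaussianReal_map_const_mul (μ := 0) (v := 1) (Real.sqrt v)
  have h2 : (NNReal.mk (Real.sqrt v ^ 2) (sq_nonneg _) : ℝ≥0) * 1 = v := by
    rw [mul_one]
    exact NNReal.coe_injective (Real.sq_sqrt v.coe_nonneg)
  rw [mul_zero, h2] at h
  rw [← h, lintegral_map (by fun_prop) (by fun_prop), gaussianAbsMoment,
    ← lintegral_const_mul _ (by fun_prop)]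
  refine lintegral_congr fun x => ?_
  rw [abs_mul, mul_pow, abs_of_nonneg (Real.sqrt_nonneg _), ENNReal.ofReal_mul (by positivity)]

theorem IsWienerMeasure.lintegral_abs_sub_pow {P : Measure PathSpace} (hP : IsWienerMeasure P)
    (n : ℕ) {s t : ℝ} (h : s ≤ t) :
    ∫⁻ ω, ENNReal.ofReal (|ω.1 t - ω.1 s| ^ n) ∂P
      = ENNReal.ofReal (Real.sqrt (t - s) ^ n) * gaussianAbsMoment n := by
  have h1 := hP.hasLaw_increment s t h
  have h2 := lintegral_map (μ := P) (f := fun x : ℝ => ENNReal.ofReal (|x| ^ n)) (by fun_prop)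
    ((measurable_pathSpace_eval t).sub (measurable_pathSpace_eval s))
  have h3 : P.map ((fun ω : PathSpace => ω.1 t) - fun ω : PathSpace => ω.1 s)
      = gaussianReal 0 (Real.toNNReal (t - s)) := h1.map_eq
  rw [h3, lintegral_abs_pow_gaussianReal, Real.coe_toNNReal _ (sub_nonneg.2 h)] at h2
  exact h2.symm

theorem IsWienerMeasure.measure_le_abs_sub {P : Measure PathSpace} (hP : IsWienerMeasure P)
    {s t r : ℝ} (h : s ≤ t) (hr : 0 < r) :
    P {ω | r ≤ |ω.1 t - ω.1 s|} ≤ ENNReal.ofReal ((t - s) ^ 2 / r ^ 4) * gaussianAbsMoment 4 := by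
  have hm : Measurable fun ω : PathSpace => ENNReal.ofReal (|ω.1 t - ω.1 s| ^ 4) :=
    ((((measurable_pathSpace_eval t).sub (measurable_pathSpace_eval s)).abs).pow_const 4).ennreal_ofReal
  have h1 := mul_meas_ge_le_lintegral (μ := P) hm (ENNReal.ofReal (r ^ 4))
  rw [hP.lintegral_abs_sub_pow 4 h] at h1
  have h2 : P {ω | r ≤ |ω.1 t - ω.1 s|}
      ≤ P {ω | ENNReal.ofReal (r ^ 4) ≤ ENNReal.ofReal (|ω.1 t - ω.1 s| ^ 4)} :=
    measure_mono fun ω hω => ENNReal.ofReal_le_ofReal (pow_le_pow_left₀ hr.le hω 4)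
  have h3 : Real.sqrt (t - s) ^ 4 = (t - s) ^ 2 := by
    rw [show 4 = 2 * 2 from rfl, pow_mul, Real.sq_sqrt (sub_nonneg.2 h)]
  have hr4 : 0 < r ^ 4 := by positivity
  refine h2.trans ?_
  rw [div_eq_inv_mul, ENNReal.ofReal_mul (by positivity), ENNReal.ofReal_inv_of_pos hr4, mul_assoc,
    ← h3, ← ENNReal.div_eq_inv_mul,
    ENNReal.le_div_iff_mul_le (Or.inl (by simpa using hr4)) (Or.inl ENNReal.ofReal_ne_top), mul_comm]
  exact h1

/-! ### A maximal inequality by dyadic chaining -/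

/-- A continuous function is controlled by its increments over dyadic intervals. -/
theorem abs_sub_le_of_dyadic {f : ℝ → ℝ} (hf : Continuous f) {a T R : ℝ} (hT : 0 < T)
    {r : ℕ → ℝ} (hr : ∀ m, 0 ≤ r m) (hR : ∀ m, ∑ j ∈ Finset.range m, r j ≤ R)
    (h : ∀ m : ℕ, ∀ k < 2 ^ m, |f (a + (k + 1 : ℕ) / 2 ^ m * T) - f (a + k / 2 ^ m * T)| ≤ r m)
    {t : ℝ} (ht : t ∈ Icc a (a + T)) : |f t - f a| ≤ R := by
  have key : ∀ m k : ℕ, k ≤ 2 ^ m →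
      |f (a + k / 2 ^ m * T) - f a| ≤ ∑ j ∈ Finset.range (m + 1), r j := by
    intro m
    induction m with
    | zero =>
      intro k hk
      rcases Nat.le_one_iff_eq_zero_or_eq_one.1 (by simpa using hk) with rfl | rfl
      · simpa using hr 0
      · simpa using h 0 0 (by norm_num)
    | succ m ih =>
      intro k hk
      rw [Finset.sum_range_succ]
      rcases Nat.even_or_odd' k with ⟨l, rfl | rfl⟩
      · have h1 := ih l (by rw [pow_succ] at hk; omega)
        have e : ((2 * l : ℕ) : ℝ) / 2 ^ (m + 1) = l / 2 ^ m := by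
          rw [pow_succ]; push_cast; field_simp
        rw [e]
        linarith [hr (m + 1)]
      · -- an odd point is joined to its left neighbour, which belongs to the coarser grid
        have h1 := ih l (by rw [pow_succ] at hk; omega)
        have h2 := h (m + 1) (2 * l) (by omega)
        have e : ((2 * l : ℕ) : ℝ) / 2 ^ (m + 1) = l / 2 ^ m := by
          rw [pow_succ]; push_cast; field_simp
        rw [e] at h2
        have h3 := abs_sub_le (f (a + (2 * l + 1 : ℕ) / 2 ^ (m + 1) * T)) (f (a + l / 2 ^ m * T)) (f a)
        linarith
  set s := (t - a) / T with hs
  have hs0 : 0 ≤ s := div_nonneg (by linarith [ht.1]) hT.le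
  have hs1 : s ≤ 1 := (div_le_one hT).2 (by linarith [ht.2])
  have hts : a + s * T = t := by rw [hs, div_mul_cancel₀ _ hT.ne']; ring
  have hlim : Tendsto (fun m : ℕ => (⌊s * (2 : ℝ) ^ m⌋₊ : ℝ) / 2 ^ m) atTop (𝓝 s) :=
    (tendsto_nat_floor_mul_div_atTop hs0).comp (tendsto_pow_atTop_atTop_of_one_lt one_lt_two)
  have hlim2 : Tendsto (fun m : ℕ => |f (a + (⌊s * (2 : ℝ) ^ m⌋₊ : ℝ) / 2 ^ m * T) - f a|) atTop
      (𝓝 |f t - f a|) := by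
    rw [← hts]
    exact (((hf.tendsto _).comp ((hlim.mul_const T).const_add a)).sub_const _).abs
  refine le_of_tendsto hlim2 (.of_forall fun m => (key m _ ?_).trans (hR _))
  have h1 : s * (2 : ℝ) ^ m ≤ ((2 ^ m : ℕ) : ℝ) := by
    push_cast
    exact mul_le_of_le_one_left (by positivity) hs1
  exact Nat.floor_le_of_le h1

theorem tsum_ofReal_pow_lt_top {q : ℝ} (h0 : 0 ≤ q) (h1 : q < 1) :
    ∑' m : ℕ, ENNReal.ofReal (q ^ m) ≠ ∞ := by
  simp only [ENNReal.ofReal_pow h0, ENNReal.tsum_geometric]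
  exact ENNReal.inv_ne_top.2 (tsub_pos_iff_lt.2 (by simpa using h1)).ne'

/-- A maximal inequality for Brownian paths. The increments over the `2 ^ m` dyadic intervals of
level `m` are compared with thresholds `(7 / 8) ^ m`, for which the fourth moments are summable. -/
theorem IsWienerMeasure.exists_measure_sup_le {P : Measure PathSpace} (hP : IsWienerMeasure P) :
    ∃ D : ℝ≥0∞, D ≠ ∞ ∧ ∀ a T R : ℝ, 0 < T → 0 < R →
      P {ω | ¬ ∀ t ∈ Icc a (a + T), |ω.1 t - ω.1 a| ≤ R} ≤ ENNReal.ofReal (T ^ 2 / R ^ 4) * D := by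
  -- level `m` contributes `2 ^ m (2 ^ (-m)) ^ 2 (8 / 7) ^ (4 m) = q ^ m`
  set q : ℝ := 1 / 2 * (8 / 7) ^ 4 with hq
  refine ⟨8 ^ 4 * gaussianAbsMoment 4 * ∑' m : ℕ, ENNReal.ofReal (q ^ m),
    ENNReal.mul_ne_top (ENNReal.mul_ne_top (by norm_num) (gaussianAbsMoment_ne_top (by norm_num)))
      (tsum_ofReal_pow_lt_top (by positivity) (by rw [hq]; norm_num)), fun a T R hT hR => ?_⟩
  set r : ℕ → ℝ := fun m => R / 8 * (7 / 8) ^ m with hr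
  have hr0 : ∀ m, 0 < r m := fun m => by simp only [hr]; positivity
  have hsub : {ω : PathSpace | ¬ ∀ t ∈ Icc a (a + T), |ω.1 t - ω.1 a| ≤ R} ⊆
      ⋃ m : ℕ, ⋃ k ∈ Finset.range (2 ^ m), {ω : PathSpace |
        r m ≤ |ω.1 (a + (k + 1 : ℕ) / 2 ^ m * T) - ω.1 (a + k / 2 ^ m * T)|} := by
    intro ω hω
    by_contra hcon
    simp only [mem_iUnion, Finset.mem_range, not_exists, mem_ofPred_eq, not_le] at hcon
    refine hω fun t ht => abs_sub_le_of_dyadic ω.1.continuous hT (fun m => (hr0 m).le) (fun m => ?_)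
      (fun m k hk => (hcon m k hk).le) ht
    simp only [hr]
    rw [← Finset.mul_sum, geom_sum_eq (by norm_num)]
    have h1 : 0 ≤ R * (7 / 8) ^ m := by positivity
    have h2 : R / 8 * (((7 / 8) ^ m - 1) / (7 / 8 - 1)) = R - R * (7 / 8) ^ m := by
      norm_num; ring
    rw [h2]
    linarith
  refine (measure_mono hsub).trans ((measure_iUnion_le _).trans ?_)
  rw [← mul_assoc, ← mul_assoc, ← ENNReal.tsum_mul_left]
  refine ENNReal.tsum_le_tsum fun m => (measure_biUnion_finset_le _ _).trans ?_
  have h1 : ∀ k ∈ Finset.range (2 ^ m), P {ω : PathSpace |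
      r m ≤ |ω.1 (a + (k + 1 : ℕ) / 2 ^ m * T) - ω.1 (a + k / 2 ^ m * T)|}
      ≤ ENNReal.ofReal ((T / 2 ^ m) ^ 2 / r m ^ 4) * gaussianAbsMoment 4 := fun k _ => by
    have e : a + (k + 1 : ℕ) / 2 ^ m * T - (a + k / 2 ^ m * T) = T / 2 ^ m := by
      push_cast; ring
    have h := hP.measure_le_abs_sub (s := a + k / 2 ^ m * T) (t := a + (k + 1 : ℕ) / 2 ^ m * T)
      (sub_nonneg.1 (by rw [e]; positivity)) (hr0 m)
    rwa [e] at h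
  refine (Finset.sum_le_sum h1).trans (le_of_eq ?_)
  rw [Finset.sum_const, Finset.card_range, nsmul_eq_mul, ← mul_assoc]
  have e1 : ((2 ^ m : ℕ) : ℝ≥0∞) = ENNReal.ofReal (2 ^ m) := by
    rw [ENNReal.ofReal_pow (by norm_num)]; norm_num
  have e2 : (8 : ℝ≥0∞) ^ 4 = ENNReal.ofReal (8 ^ 4) := by
    rw [ENNReal.ofReal_pow (by norm_num)]; norm_num
  rw [e1, e2, ← ENNReal.ofReal_mul (by positivity), ← ENNReal.ofReal_mul (by positivity),
    mul_right_comm, ← ENNReal.ofReal_mul (by positivity)]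
  congr 2
  simp only [hr, hq, mul_pow, div_pow]
  have e3 : ∀ b : ℝ, (b ^ m) ^ 4 = (b ^ 4) ^ m := fun b => by rw [← pow_mul, ← pow_mul, mul_comm]
  have e4 : ((2 : ℝ) ^ m) ^ 2 = 2 ^ m * 2 ^ m := sq _
  rw [e3, e3, e4]
  field_simp
  rw [one_pow]

/-- Brownian paths grow sublinearly: by the Borel-Cantelli lemma, the maximal inequality over the
time blocks `[0, 2 ^ k]` and `[-2 ^ k, 0]` gives `|ω| ≤ 2 ε 2 ^ k` on all but finitely many
of them. -/
theorem IsWienerMeasure.ae_isSublinear {P : Measure PathSpace} (hP : IsWienerMeasure P) :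
    ∀ᵐ ω ∂P, IsSublinear fun t => ω.1 t := by
  obtain ⟨D, hD, hsup⟩ := hP.exists_measure_sup_le
  have hBC : ∀ n : ℕ, ∀ᵐ ω ∂P, ∀ᶠ k : ℕ in atTop, ∀ t : ℝ, |t| ≤ 2 ^ k →
      |ω.1 t| ≤ 2 * (1 / ((n : ℝ) + 1) * 2 ^ k) := by
    intro n
    set ε : ℝ := 1 / ((n : ℝ) + 1) with hε
    have hε0 : 0 < ε := by positivity
    have hev : ∀ a : ℕ → ℝ, ∀ᵐ ω ∂P, ∀ᶠ k : ℕ in atTop, ∀ t ∈ Icc (a k) (a k + 2 ^ k),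
        |ω.1 t - ω.1 (a k)| ≤ ε * 2 ^ k := by
      intro a
      have hsum : ∑' k : ℕ, P {ω | ¬ ∀ t ∈ Icc (a k) (a k + 2 ^ k),
          |ω.1 t - ω.1 (a k)| ≤ ε * 2 ^ k} ≠ ∞ := by
        have hle : ∀ k : ℕ, P {ω | ¬ ∀ t ∈ Icc (a k) (a k + 2 ^ k),
            |ω.1 t - ω.1 (a k)| ≤ ε * 2 ^ k}
            ≤ ENNReal.ofReal (1 / ε ^ 4) * D * ENNReal.ofReal ((1 / 4) ^ k) := fun k => by
          refine (hsup (a k) (2 ^ k) (ε * 2 ^ k) (by positivity) (by positivity)).trans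
            (le_of_eq ?_)
          rw [mul_right_comm, ← ENNReal.ofReal_mul (by positivity)]
          congr 2
          have e : ((1 : ℝ) / 4) ^ k * (2 ^ k) ^ 2 = 1 := by
            rw [← pow_mul, mul_comm k 2, pow_mul, ← mul_pow]; norm_num
          have e' : ((1 : ℝ) / 4) ^ k = 1 / (2 ^ k) ^ 2 := by
            rw [eq_div_iff (by positivity), e]
          rw [e', mul_pow]
          field_simp
        refine ne_top_of_le_ne_top ?_ (ENNReal.tsum_le_tsum hle)
        rw [ENNReal.tsum_mul_left]
        exact ENNReal.mul_ne_top (ENNReal.mul_ne_top ENNReal.ofReal_ne_top hD)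
          (tsum_ofReal_pow_lt_top (by norm_num) (by norm_num))
      filter_upwards [ae_eventually_notMem hsum] with ω hω
      filter_upwards [hω] with k hk
      exact not_not.1 hk
    filter_upwards [hev fun _ => 0, hev fun k => -2 ^ k] with ω h1 h2
    filter_upwards [h1, h2] with k hk1 hk2 t ht
    have h0 : ω.1 0 = 0 := ω.2
    simp only [h0, zero_add, sub_zero] at hk1
    have hpos : 0 ≤ ε * 2 ^ k := by positivity
    rw [abs_le] at ht
    rcases le_total 0 t with h | h
    · linarith [hk1 t ⟨h, ht.2⟩]
    · have a1 := hk2 t ⟨ht.1, by linarith⟩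
      have a2 := hk2 0 ⟨by linarith [ht.1], by linarith⟩
      rw [h0] at a2
      have a3 := abs_sub_le (ω.1 t) (ω.1 (-2 ^ k)) 0
      rw [sub_zero, abs_sub_comm (ω.1 (-2 ^ k)) 0] at a3
      linarith
  filter_upwards [ae_all_iff.2 hBC] with ω hω ε hε
  -- `|t|` lies between `2 ^ k` and `2 ^ (k + 1)`, which costs a factor `2`
  obtain ⟨n, hn⟩ := exists_nat_one_div_lt (show 0 < ε / 4 by positivity)
  obtain ⟨k₀, hk₀⟩ := eventually_atTop.1 (hω n)
  have hn0 : 0 < 1 / ((n : ℝ) + 1) := by positivity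
  refine ⟨2 * (1 / ((n : ℝ) + 1) * 2 ^ k₀), fun t => ?_⟩
  have hεt := mul_nonneg hε.le (abs_nonneg t)
  rcases le_total |t| (2 ^ k₀) with h | h
  · linarith [hk₀ k₀ le_rfl t h]
  · obtain ⟨k, hk1, hk2⟩ := exists_nat_pow_near ((one_le_pow₀ one_le_two).trans h) one_lt_two
    have hk : k₀ ≤ k + 1 := by
      by_contra hcon
      have := pow_le_pow_right₀ (one_le_two (α := ℝ)) (show k + 1 ≤ k₀ by omega)
      linarith
    have h1 := hk₀ (k + 1) hk t hk2.le
    have h2 : 2 * (1 / ((n : ℝ) + 1) * 2 ^ (k + 1)) ≤ ε * |t| := by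
      rw [pow_succ]
      have h3 := mul_le_mul hn.le hk1 (by positivity) (by positivity)
      linarith
    have : 0 ≤ 2 * (1 / ((n : ℝ) + 1) * 2 ^ k₀) := by positivity
    linarith

/-! ### The metric dynamical system -/

theorem IsWienerMeasure.measure_regularPaths {P : Measure PathSpace} (hP : IsWienerMeasure P) :
    P regularPaths = 1 := by
  have := hP.isProbabilityMeasure
  refine (prob_compl_eq_zero_iff measurableSet_regularPaths).1 ?_
  exact hP.ae_isSublinear.mono fun ω hω => isRegularPath_iff.2 hω

theorem regularMeasure_apply {P : Measure PathSpace} (s : Set regularPaths) :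
    regularMeasure P s = P (Subtype.val '' s) :=
  (MeasurableEmbedding.subtype_coe measurableSet_regularPaths).comap_apply _ _

theorem IsWienerMeasure.map_val {P : Measure PathSpace} (hP : IsWienerMeasure P) :
    (regularMeasure P).map Subtype.val = P := by
  rw [regularMeasure, (MeasurableEmbedding.subtype_coe measurableSet_regularPaths).map_comap,
    Subtype.range_coe]
  exact Measure.restrict_eq_self_of_ae_mem
    (hP.ae_isSublinear.mono fun ω hω => isRegularPath_iff.2 hω)

theorem IsWienerMeasure.isMetricDynamicalSystem {P : Measure PathSpace} (hP : IsWienerMeasure P) :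
    IsMetricDynamicalSystem (regularMeasure P) regularShift where
  isProbabilityMeasure := ⟨by
    rw [regularMeasure_apply, image_univ, Subtype.range_coe, hP.measure_regularPaths]⟩
  measurable_shift := measurable_regularShift
  shift_zero := by
    funext ω
    refine Subtype.ext (Subtype.ext (ContinuousMap.ext fun r => ?_))
    change ω.1.1 (r + 0) - ω.1.1 0 = ω.1.1 r
    rw [ω.1.2, add_zero, sub_zero]
  shift_add s t := by
    funext ω
    refine Subtype.ext ?_
    rw [add_comm]
    exact (wienerShift_wienerShift t s ω.1).symm
  measurePreserving t := by
    have hm : Measurable (regularShift t) :=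
      measurable_regularShift.comp measurable_prodMk_left
    have hemb := MeasurableEmbedding.subtype_coe measurableSet_regularPaths
    refine ⟨hm, ?_⟩
    have h1 : ((regularMeasure P).map (regularShift t)).map Subtype.val = P := by
      rw [Measure.map_map measurable_subtype_coe hm]
      change (regularMeasure P).map (wienerShift t ∘ Subtype.val) = P
      rw [← Measure.map_map (measurable_wienerShift t) measurable_subtype_coe, hP.map_val,
        hP.map_wienerShift]
    rw [← hemb.comap_map ((regularMeasure P).map (regularShift t)), h1]
    rfl

/-! ### The trapezoidal rule -/

/-- The primitive `∫₀^x e^{s α} ds` of `e^{s α}` in `ℓ^∞(ℤ)`; it replaces `(e^{x α} - 1) / α`, which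
would require a division by `α`. -/
noncomputable def expPrim (α : EllInfty) (x : ℝ) : EllInfty := ∫ s in (0 : ℝ)..x, expSeq α s

theorem hasDerivAt_expPrim (α : EllInfty) (x : ℝ) :
    HasDerivAt (expPrim α) (expSeq α x) x :=
  intervalIntegral.integral_hasDerivAt_right ((continuous_expSeq α).intervalIntegrable _ _)
    ((continuous_expSeq α).stronglyMeasurableAtFilter _ _) (continuous_expSeq α).continuousAt

theorem continuous_expPrim (α : EllInfty) : Continuous (expPrim α) :=
  continuous_iff_continuousAt.2 fun x => (hasDerivAt_expPrim α x).continuousAt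

theorem expPrim_zero (α : EllInfty) : expPrim α 0 = 0 := intervalIntegral.integral_same

theorem mul_expPrim (α : EllInfty) (x : ℝ) : α * expPrim α x = expSeq α x - 1 := by
  have hc : Continuous fun s => α * expSeq α s := continuous_const.mul (continuous_expSeq α)
  rw [← expSeq_zero α, ← intervalIntegral.integral_eq_sub_of_hasDerivAt
    (fun s _ => hasDerivAt_expSeq α s) (hc.intervalIntegrable 0 x)]
  exact ((ContinuousLinearMap.mul ℝ EllInfty α).intervalIntegral_comp_comm
    ((continuous_expSeq α).intervalIntegrable 0 x)).symm

theorem norm_expSeq_le_of_abs_le (α : EllInfty) {r M : ℝ} (hr : |r| ≤ M) :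
    ‖expSeq α r‖ ≤ Real.exp (‖α‖ * M) :=
  (norm_expSeq_le α r).trans (Real.exp_le_exp.2 (mul_le_mul_of_nonneg_left hr (norm_nonneg α)))

theorem norm_expPrim_sub_le (α : EllInfty) {a b M : ℝ} (ha : |a| ≤ M) (hb : |b| ≤ M) :
    ‖expPrim α b - expPrim α a‖ ≤ Real.exp (‖α‖ * M) * |b - a| :=
  (convex_Icc (-M) M).norm_image_sub_le_of_norm_hasDerivWithin_le
    (fun x _ => (hasDerivAt_expPrim α x).hasDerivWithinAt)
    (fun _ hx => norm_expSeq_le_of_abs_le α (abs_le.2 hx)) (abs_le.1 ha) (abs_le.1 hb)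

/-- The trapezoidal rule for `e^{s α}` has a cubic error. -/
theorem norm_trapezoid_sub_expPrim_le (α : EllInfty) {a b M : ℝ} (ha : |a| ≤ M) (hb : |b| ≤ M) :
    ‖((b - a) / 2) • (expSeq α a + expSeq α b) - (expPrim α b - expPrim α a)‖
      ≤ ‖α‖ ^ 2 * Real.exp (‖α‖ * M) / 2 * |b - a| ^ 3 := by
  set C := ‖α‖ ^ 2 * Real.exp (‖α‖ * M) / 2 with hC
  have hM : ∀ s ∈ uIcc a b, |s| ≤ M := fun s hs => by
    have h1 := uIcc_subset_Icc (abs_le.1 ha) (abs_le.1 hb) hs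
    exact abs_le.2 h1
  have hd : ∀ s ∈ uIcc a b, |s - a| ≤ |b - a| := fun s hs => abs_sub_left_of_mem_uIcc hs
  -- `G` is the derivative of the error `F` as a function of the right endpoint, and `G` vanishes to
  -- second order at `a` because `G'(s) = (s - a) / 2 α² e^{α s}`
  set G : ℝ → EllInfty := fun s =>
    (1 / 2 : ℝ) • (expSeq α a - expSeq α s) + ((s - a) / 2) • (α * expSeq α s) with hG
  have hGd : ∀ s, HasDerivAt G (((s - a) / 2) • (α * (α * expSeq α s))) s := fun s => by
    have h1 := ((hasDerivAt_expSeq α s).const_sub (expSeq α a)).const_smul (1 / 2 : ℝ)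
    have h2 := (((hasDerivAt_id s).sub_const a).div_const 2).smul
      ((hasDerivAt_expSeq α s).const_mul α)
    refine (h1.add h2).congr_deriv ?_
    rw [smul_neg]
    simp only [id]
    abel
  have hGb : ∀ s ∈ uIcc a b, ‖G s‖ ≤ C * |b - a| ^ 2 := fun s hs => by
    have h := (convex_uIcc a b).norm_image_sub_le_of_norm_hasDerivWithin_le (C := C * |b - a|)
      (fun x _ => (hGd x).hasDerivWithinAt) (fun x hx => ?_) left_mem_uIcc hs
    · have h0 : G a = 0 := by simp [hG]
      rw [h0, sub_zero] at h
      refine h.trans ?_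
      rw [sq, ← mul_assoc]
      exact mul_le_mul_of_nonneg_left (hd s hs) (by positivity)
    · rw [norm_smul, norm_div, Real.norm_eq_abs, Real.norm_two]
      have h3 : ‖α * (α * expSeq α x)‖ ≤ ‖α‖ * (‖α‖ * Real.exp (‖α‖ * M)) :=
        (norm_mul_le _ _).trans (mul_le_mul_of_nonneg_left ((norm_mul_le _ _).trans
          (mul_le_mul_of_nonneg_left (norm_expSeq_le_of_abs_le α (hM x hx)) (norm_nonneg α)))
          (norm_nonneg α))
      refine (mul_le_mul (by linarith [hd x hx] : |x - a| / 2 ≤ |b - a| / 2) h3 (norm_nonneg _)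
        (by positivity)).trans (le_of_eq ?_)
      rw [hC]; ring
  set F : ℝ → EllInfty := fun s =>
    ((s - a) / 2) • (expSeq α a + expSeq α s) - (expPrim α s - expPrim α a) with hF
  have hFd : ∀ s, HasDerivAt F (G s) s := fun s => by
    have h1 := (((hasDerivAt_id s).sub_const a).div_const 2).smul
      ((hasDerivAt_expSeq α s).const_add (expSeq α a))
    refine (h1.sub ((hasDerivAt_expPrim α s).sub_const _)).congr_deriv ?_
    simp only [hG, id]
    module
  have h := (convex_uIcc a b).norm_image_sub_le_of_norm_hasDerivWithin_le
    (fun x _ => (hFd x).hasDerivWithinAt) hGb left_mem_uIcc right_mem_uIcc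
  have h0 : F a = 0 := by simp [hF]
  rw [h0, sub_zero] at h
  refine h.trans (le_of_eq ?_)
  rw [Real.norm_eq_abs]; ring

/-- Trapezoidal sums for `X = e^{α W} h` with `h` continuously differentiable: after summation by
parts, they differ from `K(W_t) h(t) - K(W_0) h(0) - ∫₀ᵗ K(W_s) h'(s) ds`, where `K' = e^{α ·}`,
by the sum of the cubed increments of `W` and by its oscillation over the partition. -/
theorem exists_norm_trapezoid_sum_sub_le (α : EllInfty) {W : ℝ → ℝ} (hW : Continuous W) {t : ℝ}
    {h h' : ℝ → EllTwo} (hd : ∀ s ∈ Icc 0 t, HasDerivWithinAt h (h' s) (Ici 0) s)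
    (hc : ContinuousOn h' (Icc 0 t)) :
    ∃ C : ℝ, ∀ (N : ℕ) (π : ℕ → ℝ), Monotone π → π 0 = 0 → π N = t → ∀ δ : ℝ, 0 ≤ δ →
      (∀ k < N, ∀ s ∈ Icc (π k) (π (k + 1)), |W (π (k + 1)) - W s| ≤ δ) →
      ‖(∑ k ∈ Finset.range N, (W (π (k + 1)) - W (π k)) •
          ((1 / 2 : ℝ) • (expMul α (W (π k)) (h (π k)) + expMul α (W (π (k + 1))) (h (π (k + 1))))))
        - (mulOp (expPrim α (W t)) (h t) - mulOp (expPrim α (W 0)) (h 0)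
          - ∫ s in (0 : ℝ)..t, mulOp (expPrim α (W s)) (h' s))‖
      ≤ C * ((∑ k ∈ Finset.range N, |W (π (k + 1)) - W (π k)| ^ 3) + δ) := by
  obtain ⟨M, hM⟩ := (isCompact_Icc (a := (0 : ℝ)) (b := t)).exists_bound_of_continuousOn
    hW.continuousOn
  have hhc : ContinuousOn h (Icc 0 t) := fun s hs =>
    ((hd s hs).continuousWithinAt).mono Icc_subset_Ici_self
  obtain ⟨A, hA⟩ := isCompact_Icc.exists_bound_of_continuousOn hhc
  obtain ⟨B, hB⟩ := isCompact_Icc.exists_bound_of_continuousOn hc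
  set E := Real.exp (‖α‖ * M) with hE
  set C₁ := ‖α‖ ^ 2 * E / 2 * |A| with hC₁
  set C₂ := (1 / 2 * E * |B| + E * |B|) * |t| with hC₂
  have hC₁0 : 0 ≤ C₁ := by positivity
  have hC₂0 : 0 ≤ C₂ := by positivity
  refine ⟨C₁ + C₂, fun N π hπ h0 hN δ hδ0 hδ => ?_⟩
  have hmem : ∀ k ≤ N, π k ∈ Icc 0 t := fun k hk => ⟨h0 ▸ hπ k.zero_le, hN ▸ hπ hk⟩
  have hKc : ContinuousOn (fun s => mulOp (expPrim α (W s)) (h' s)) (Icc 0 t) :=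
    ((mulOp.continuous.comp ((continuous_expPrim α).comp hW)).continuousOn).clm_apply hc
  have hii : ∀ (f : ℝ → EllTwo), ContinuousOn f (Icc 0 t) → ∀ k < N,
      IntervalIntegrable f volume (π k) (π (k + 1)) := fun f hf k hk => by
    refine (hf.mono ?_).intervalIntegrable
    rw [uIcc_of_le (hπ k.le_succ)]
    exact Icc_subset_Icc (hmem k hk.le).1 (hmem (k + 1) hk).2
  -- the error over one interval of the partition
  set D : ℕ → EllTwo := fun k => (W (π (k + 1)) - W (π k)) •
      ((1 / 2 : ℝ) • (expMul α (W (π k)) (h (π k)) + expMul α (W (π (k + 1))) (h (π (k + 1)))))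
      - (mulOp (expPrim α (W (π (k + 1)))) (h (π (k + 1))) - mulOp (expPrim α (W (π k))) (h (π k)))
      + ∫ s in (π k)..(π (k + 1)), mulOp (expPrim α (W s)) (h' s) with hD
  have hsum : (∑ k ∈ Finset.range N, (W (π (k + 1)) - W (π k)) •
          ((1 / 2 : ℝ) • (expMul α (W (π k)) (h (π k)) + expMul α (W (π (k + 1))) (h (π (k + 1))))))
        - (mulOp (expPrim α (W t)) (h t) - mulOp (expPrim α (W 0)) (h 0)
          - ∫ s in (0 : ℝ)..t, mulOp (expPrim α (W s)) (h' s)) = ∑ k ∈ Finset.range N, D k := by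
    simp only [hD]
    rw [Finset.sum_add_distrib, Finset.sum_sub_distrib, Finset.sum_range_sub
      (fun k => mulOp (expPrim α (W (π k))) (h (π k))),
      intervalIntegral.sum_integral_adjacent_intervals (fun k hk => hii _ hKc k hk), h0, hN]
    abel
  have hDk : ∀ k ∈ Finset.range N, ‖D k‖ ≤ C₁ * |W (π (k + 1)) - W (π k)| ^ 3
      + (1 / 2 * E * |B| + E * |B|) * δ * (π (k + 1) - π k) := fun k hk => by
    have hk := Finset.mem_range.1 hk
    have hle : π k ≤ π (k + 1) := hπ k.le_succ
    have hδk : |W (π (k + 1)) - W (π k)| ≤ δ := hδ k hk _ ⟨le_rfl, hle⟩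
    have hsub : ∀ s ∈ Icc (π k) (π (k + 1)), s ∈ Icc 0 t := fun s hs =>
      ⟨(hmem k hk.le).1.trans hs.1, hs.2.trans (hmem (k + 1) hk).2⟩
    have hWM : ∀ s ∈ Icc 0 t, |W s| ≤ M := hM
    have hftc : ∫ s in (π k)..(π (k + 1)), h' s = h (π (k + 1)) - h (π k) := by
      refine intervalIntegral.integral_eq_sub_of_hasDeriv_right_of_le hle
        (hhc.mono hsub) (fun s hs => ?_) (hii _ hc k hk)
      exact (hd s (hsub s (Ioo_subset_Icc_self hs))).mono
        (fun r hr => ((hsub s (Ioo_subset_Icc_self hs)).1.trans (le_of_lt hr) : (0 : ℝ) ≤ r))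
    -- the cubic error of the trapezoidal rule, the error of replacing `h(π_k)` by `h(π_{k+1})`, and
    -- the error of freezing `K(W)` in the integral of `K(W) h'`
    have hdec : D k = mulOp (((W (π (k + 1)) - W (π k)) / 2) •
          (expSeq α (W (π k)) + expSeq α (W (π (k + 1))))
          - (expPrim α (W (π (k + 1))) - expPrim α (W (π k)))) (h (π k))
        + ((W (π (k + 1)) - W (π k)) / 2) •
          mulOp (expSeq α (W (π (k + 1)))) (h (π (k + 1)) - h (π k))
        - ∫ s in (π k)..(π (k + 1)), mulOp (expPrim α (W (π (k + 1))) - expPrim α (W s)) (h' s) := by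
      have e1 : ∫ s in (π k)..(π (k + 1)), mulOp (expPrim α (W (π (k + 1))) - expPrim α (W s)) (h' s)
          = mulOp (expPrim α (W (π (k + 1)))) (h (π (k + 1)) - h (π k))
            - ∫ s in (π k)..(π (k + 1)), mulOp (expPrim α (W s)) (h' s) := by
        rw [← hftc, ← ContinuousLinearMap.intervalIntegral_comp_comm _ (hii _ hc k hk),
          ← intervalIntegral.integral_sub
            (hii _ (continuousOn_const.clm_apply hc) k hk) (hii _ hKc k hk)]
        refine intervalIntegral.integral_congr fun s _ => ?_
        simp only [map_sub, sub_apply]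
      rw [e1]
      simp only [hD, expMul_eq_mulOp, map_sub, map_add, map_smul, sub_apply, add_apply, smul_apply]
      module
    have b1 := norm_mulOp_apply_le (((W (π (k + 1)) - W (π k)) / 2) •
          (expSeq α (W (π k)) + expSeq α (W (π (k + 1))))
          - (expPrim α (W (π (k + 1))) - expPrim α (W (π k)))) (h (π k))
    have b2 := norm_trapezoid_sub_expPrim_le α (hWM _ (hmem k hk.le)) (hWM _ (hmem (k + 1) hk))
    have b3 : ‖h (π k)‖ ≤ |A| := (hA _ (hmem k hk.le)).trans (le_abs_self A)
    have b4 := mul_le_mul b2 b3 (norm_nonneg _) (by positivity)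
    have b5 : ‖h (π (k + 1)) - h (π k)‖ ≤ |B| * (π (k + 1) - π k) := by
      rw [← hftc, ← abs_of_nonneg (sub_nonneg.2 hle)]
      refine intervalIntegral.norm_integral_le_of_norm_le_const fun s hs => ?_
      rw [uIoc_of_le hle] at hs
      exact (hB s (hsub s (Ioc_subset_Icc_self hs))).trans (le_abs_self B)
    have b6 : ‖((W (π (k + 1)) - W (π k)) / 2) •
          mulOp (expSeq α (W (π (k + 1)))) (h (π (k + 1)) - h (π k))‖
        ≤ δ / 2 * (E * (|B| * (π (k + 1) - π k))) := by
      rw [norm_smul, norm_div, Real.norm_eq_abs, Real.norm_two]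
      have := (norm_mulOp_apply_le (expSeq α (W (π (k + 1)))) (h (π (k + 1)) - h (π k))).trans
        (mul_le_mul (norm_expSeq_le_of_abs_le α (hWM _ (hmem (k + 1) hk))) b5 (norm_nonneg _)
          (by positivity))
      gcongr
    have b7 : ‖∫ s in (π k)..(π (k + 1)), mulOp (expPrim α (W (π (k + 1))) - expPrim α (W s)) (h' s)‖
        ≤ E * δ * |B| * (π (k + 1) - π k) := by
      rw [← abs_of_nonneg (sub_nonneg.2 hle)]
      refine intervalIntegral.norm_integral_le_of_norm_le_const fun s hs => ?_
      rw [uIoc_of_le hle] at hs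
      have hs := Ioc_subset_Icc_self hs
      refine (norm_mulOp_apply_le _ _).trans (mul_le_mul ?_
        ((hB s (hsub s hs)).trans (le_abs_self B)) (norm_nonneg _) (by positivity))
      exact (norm_expPrim_sub_le α (hWM _ (hsub s hs)) (hWM _ (hmem (k + 1) hk))).trans
        (mul_le_mul_of_nonneg_left (hδ k hk s hs) (by positivity))
    rw [hdec]
    refine (norm_sub_le _ _).trans ((add_le_add ((norm_add_le _ _).trans
      (add_le_add (b1.trans b4) b6)) b7).trans (le_of_eq ?_))
    rw [hC₁]; ring
  rw [hsum]
  refine (norm_sum_le_of_le _ hDk).trans ?_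
  rw [Finset.sum_add_distrib, ← Finset.mul_sum, ← Finset.mul_sum, Finset.sum_range_sub, h0, hN,
    sub_zero]
  have e : (1 / 2 * E * |B| + E * |B|) * δ * t ≤ C₂ * δ := by
    rw [hC₂, mul_right_comm]
    exact mul_le_mul_of_nonneg_right (mul_le_mul_of_nonneg_left (le_abs_self t) (by positivity)) hδ0
  have hS : 0 ≤ ∑ k ∈ Finset.range N, |W (π (k + 1)) - W (π k)| ^ 3 :=
    Finset.sum_nonneg fun k _ => by positivity
  have := mul_nonneg hC₂0 hS
  have := mul_nonneg hC₁0 hδ0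
  linarith

/-! ### Convergence of the trapezoidal sums -/

theorem measurable_brownianPath (t : ℝ≥0) : Measurable (brownianPath t) :=
  (measurable_pathSpace_eval t).comp measurable_subtype_coe

theorem measurable_abs_brownianPath_sub_pow (s t : ℝ≥0) (n : ℕ) :
    Measurable fun ω => |brownianPath t ω - brownianPath s ω| ^ n :=
  ((measurable_brownianPath t).sub (measurable_brownianPath s)).abs.pow_const n

theorem measurable_sum_abs_brownianPath_sub_pow (N : ℕ) (π : ℕ → ℝ≥0) (n : ℕ) :
    Measurable fun ω => ∑ k ∈ Finset.range N,
      |brownianPath (π (k + 1)) ω - brownianPath (π k) ω| ^ n :=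
  Finset.measurable_fun_sum _ fun k _ => measurable_abs_brownianPath_sub_pow (π k) (π (k + 1)) n

theorem measurable_trapezoid_sum {X : ℝ≥0 → regularPaths → EllTwo} (hX : ∀ t, Measurable (X t))
    (N : ℕ) (π : ℕ → ℝ≥0) :
    Measurable fun ω => ∑ k ∈ Finset.range N, (brownianPath (π (k + 1)) ω - brownianPath (π k) ω) •
      ((1 / 2 : ℝ) • (X (π k) ω + X (π (k + 1)) ω)) := by
  refine Finset.measurable_fun_sum _ fun k _ => ?_
  have h1 : Measurable fun ω => brownianPath (π (k + 1)) ω - brownianPath (π k) ω :=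
    (measurable_brownianPath _).sub (measurable_brownianPath _)
  have h2 : Measurable fun ω => X (π k) ω + X (π (k + 1)) ω := (hX _).add (hX _)
  have h3 : Measurable fun ω => (1 / 2 : ℝ) • (X (π k) ω + X (π (k + 1)) ω) :=
    h2.const_smul (1 / 2 : ℝ)
  exact h1.smul h3

theorem IsWienerMeasure.lintegral_sum_abs_pow_three_le {P : Measure PathSpace}
    (hP : IsWienerMeasure P) {N : ℕ} {π : ℕ → ℝ≥0} (hπ : Monotone π) (h0 : π 0 = 0) {ε : ℝ}
    (hε : ∀ k < N, (π (k + 1) : ℝ) - π k < ε) :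
    ∫⁻ ω, ENNReal.ofReal (∑ k ∈ Finset.range N,
        |brownianPath (π (k + 1)) ω - brownianPath (π k) ω| ^ 3) ∂regularMeasure P
      ≤ ENNReal.ofReal (Real.sqrt ε * π N) * gaussianAbsMoment 3 := by
  have hle : ∀ k, (π k : ℝ) ≤ π (k + 1) := fun k => NNReal.coe_le_coe.2 (hπ k.le_succ)
  have h1 : ∀ k, ∫⁻ ω, ENNReal.ofReal (|brownianPath (π (k + 1)) ω - brownianPath (π k) ω| ^ 3)
      ∂regularMeasure P
      = ENNReal.ofReal (Real.sqrt (π (k + 1) - π k) ^ 3) * gaussianAbsMoment 3 := fun k => by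
    rw [← hP.lintegral_abs_sub_pow 3 (hle k)]
    conv_rhs => rw [← hP.map_val]
    rw [lintegral_map _ measurable_subtype_coe]
    · rfl
    · exact (((measurable_pathSpace_eval _).sub
        (measurable_pathSpace_eval _)).abs.pow_const 3).ennreal_ofReal
  have h2 : ∀ ω, ENNReal.ofReal (∑ k ∈ Finset.range N,
        |brownianPath (π (k + 1)) ω - brownianPath (π k) ω| ^ 3) = ∑ k ∈ Finset.range N,
        ENNReal.ofReal (|brownianPath (π (k + 1)) ω - brownianPath (π k) ω| ^ 3) := fun ω =>
    ENNReal.ofReal_sum_of_nonneg fun k _ => by positivity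
  simp only [h2]
  rw [lintegral_finsetSum _ fun k _ =>
    (measurable_abs_brownianPath_sub_pow (π k) (π (k + 1)) 3).ennreal_ofReal]
  simp only [h1]
  rw [← Finset.sum_mul, ← ENNReal.ofReal_sum_of_nonneg fun k _ => by positivity]
  refine mul_le_mul_left (ENNReal.ofReal_le_ofReal ?_) _
  have h3 : ∑ k ∈ Finset.range N, Real.sqrt ε * ((π (k + 1) : ℝ) - π k) = Real.sqrt ε * π N := by
    rw [← Finset.mul_sum, Finset.sum_range_sub (fun k => (π k : ℝ)), h0, NNReal.coe_zero, sub_zero]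
  rw [← h3]
  refine Finset.sum_le_sum fun k hk => ?_
  have h4 : (0 : ℝ) ≤ π (k + 1) - π k := sub_nonneg.2 (hle k)
  rw [pow_succ', Real.sq_sqrt h4]
  exact mul_le_mul_of_nonneg_right (Real.sqrt_le_sqrt (hε k (Finset.mem_range.1 hk)).le) h4

/-- The cubic variation of Brownian paths vanishes. -/
theorem IsWienerMeasure.tendstoInMeasure_sum_abs_pow_three {P : Measure PathSpace}
    (hP : IsWienerMeasure P) {t : ℝ≥0} {N : ℕ → ℕ} {π : ℕ → ℕ → ℝ≥0} (hπ : ∀ n, Monotone (π n))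
    (h0 : ∀ n, π n 0 = 0) (ht : ∀ n, π n (N n) = t)
    (hε : ∀ ε : ℝ, 0 < ε → ∀ᶠ n in atTop, ∀ k < N n, (π n (k + 1) : ℝ) - π n k < ε) :
    TendstoInMeasure (regularMeasure P) (fun n ω => ∑ k ∈ Finset.range (N n),
        |brownianPath (π n (k + 1)) ω - brownianPath (π n k) ω| ^ 3) atTop (fun _ => 0) := by
  refine tendstoInMeasure_of_tendsto_eLpNorm one_ne_zero
    (fun n => (measurable_sum_abs_brownianPath_sub_pow (N n) (π n) 3).aestronglyMeasurable)
    aestronglyMeasurable_const ?_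
  have e : ∀ n, eLpNorm ((fun ω => ∑ k ∈ Finset.range (N n),
        |brownianPath (π n (k + 1)) ω - brownianPath (π n k) ω| ^ 3) - fun _ => (0 : ℝ)) 1
        (regularMeasure P) = ∫⁻ ω, ENNReal.ofReal (∑ k ∈ Finset.range (N n),
        |brownianPath (π n (k + 1)) ω - brownianPath (π n k) ω| ^ 3) ∂regularMeasure P := fun n => by
    rw [eLpNorm_one_eq_lintegral_enorm]
    refine lintegral_congr fun ω => ?_
    rw [Pi.sub_apply, sub_zero, Real.enorm_eq_ofReal (Finset.sum_nonneg fun k _ => by positivity)]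
  simp only [e]
  -- the moments are at most `√ε t` times a constant as soon as the mesh is below `ε`
  have hlim : Tendsto (fun ε : ℝ => ENNReal.ofReal (Real.sqrt ε * t) * gaussianAbsMoment 3)
      (𝓝[>] 0) (𝓝 0) := by
    have h1 : Continuous fun ε : ℝ => ENNReal.ofReal (Real.sqrt ε * t) :=
      ENNReal.continuous_ofReal.comp (Real.continuous_sqrt.mul continuous_const)
    have h2 := (h1.tendsto 0).mono_left (nhdsWithin_le_nhds (s := Ioi 0))
    rw [Real.sqrt_zero, zero_mul, ENNReal.ofReal_zero] at h2
    have h3 := ENNReal.Tendsto.mul_const h2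
      (Or.inr (gaussianAbsMoment_ne_top (n := 3) (by norm_num)))
    rwa [zero_mul] at h3
  refine ENNReal.tendsto_nhds_zero.2 fun η hη => ?_
  obtain ⟨ε, h1, h2⟩ := ((ENNReal.tendsto_nhds_zero.1 hlim η hη).and self_mem_nhdsWithin).exists
  filter_upwards [hε ε h2] with n hn
  have h3 := hP.lintegral_sum_abs_pow_three_le (hπ n) (h0 n) hn
  rw [ht n] at h3
  exact h3.trans h1

/-- A pathwise bound of the error of the trapezoidal sums by the sum of the cubed increments and the
oscillation of the driving path identifies the Stratonovich integral. -/
theorem IsWienerMeasure.isStratonovichIntegral {P : Measure PathSpace} (hP : IsWienerMeasure P)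
    {X : ℝ≥0 → regularPaths → EllTwo} (hX : ∀ t, Measurable (X t)) {t : ℝ≥0}
    {J : regularPaths → EllTwo}
    (h : ∀ ω : regularPaths, ∃ C : ℝ, ∀ (N : ℕ) (π : ℕ → ℝ≥0), Monotone π → π 0 = 0 → π N = t →
      ∀ δ : ℝ, 0 ≤ δ → (∀ k < N, ∀ s ∈ Icc (π k : ℝ) (π (k + 1)),
        |ω.1.1 (π (k + 1)) - ω.1.1 s| ≤ δ) →
      ‖(∑ k ∈ Finset.range N, (brownianPath (π (k + 1)) ω - brownianPath (π k) ω) •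
          ((1 / 2 : ℝ) • (X (π k) ω + X (π (k + 1)) ω))) - J ω‖
      ≤ C * ((∑ k ∈ Finset.range N, |brownianPath (π (k + 1)) ω - brownianPath (π k) ω| ^ 3) + δ)) :
    IsStratonovichIntegral (regularMeasure P) brownianPath X t J := by
  intro N π hπ h0 ht hε
  have := hP.isMetricDynamicalSystem.isProbabilityMeasure
  refine (exists_seq_tendstoInMeasure_atTop_iff fun n =>
    (measurable_trapezoid_sum hX (N n) (π n)).aestronglyMeasurable).2 fun ns hns => ?_
  obtain ⟨ns', hns', hae⟩ := (exists_seq_tendstoInMeasure_atTop_iff fun n =>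
    (measurable_sum_abs_brownianPath_sub_pow (N n) (π n) 3).aestronglyMeasurable).1
    (hP.tendstoInMeasure_sum_abs_pow_three hπ h0 ht hε) ns hns
  refine ⟨ns', hns', ?_⟩
  -- along this subsequence the cubed increments tend to `0`; the oscillation does so by uniform
  -- continuity of the path
  filter_upwards [hae] with ω hω
  obtain ⟨C, hC⟩ := h ω
  rw [Metric.tendsto_atTop] at hω ⊢
  intro η hη
  set δ := η / (4 * (|C| + 1)) with hδ
  have hδ0 : 0 < δ := by positivity
  obtain ⟨i₀, hi₀⟩ := hω δ hδ0
  have huc := isCompact_Icc.uniformContinuousOn_of_continuous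
    (ω.1.1.continuous.continuousOn (s := Icc 0 (t : ℝ)))
  obtain ⟨ε, hε0, hucε⟩ := Metric.uniformContinuousOn_iff_le.1 huc δ hδ0
  obtain ⟨i₁, hi₁⟩ := eventually_atTop.1 ((hns.comp hns').tendsto_atTop.eventually (hε ε hε0))
  refine ⟨max i₀ i₁, fun i hi => ?_⟩
  have a1 := hi₀ i (le_trans (le_max_left _ _) hi)
  have a2 := hi₁ i (le_trans (le_max_right _ _) hi)
  rw [Real.dist_eq, sub_zero] at a1
  have hb := hC (N (ns (ns' i))) (π (ns (ns' i))) (hπ _) (h0 _) (ht _) δ hδ0.le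
    (fun k hk s hs => ?_)
  · rw [dist_eq_norm]
    refine hb.trans_lt ?_
    have a3 := (le_abs_self _).trans a1.le
    have hS : 0 ≤ ∑ k ∈ Finset.range (N (ns (ns' i))), |brownianPath (π (ns (ns' i)) (k + 1)) ω
        - brownianPath (π (ns (ns' i)) k) ω| ^ 3 := Finset.sum_nonneg fun k _ => by positivity
    have a4 := mul_le_mul (le_abs_self C) (add_le_add_left a3 δ) (by positivity) (abs_nonneg C)
    refine a4.trans_lt ?_
    have a5 : (|C| + 1) * δ = η / 4 := by rw [hδ]; field_simp
    nlinarith [abs_nonneg C]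
  · have b0 : (0 : ℝ) ≤ π (ns (ns' i)) k := NNReal.coe_nonneg _
    have b1 : (π (ns (ns' i)) (k + 1) : ℝ) ≤ t := by
      rw [← ht (ns (ns' i))]; exact NNReal.coe_le_coe.2 (hπ _ hk)
    refine hucε _ ⟨NNReal.coe_nonneg _, b1⟩ s ⟨b0.trans hs.1, hs.2.trans b1⟩ ?_
    rw [Real.dist_eq, abs_of_nonneg (sub_nonneg.2 hs.2)]
    have b2 := a2 k hk
    simp only [Function.comp] at b2
    linarith [hs.1]

/-! ### The Stratonovich equation -/

theorem measurable_wienerPast_eval {r : ℝ} {t : ℝ≥0} (h : r ≤ t) :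
    Measurable[wienerPast t] fun ω : regularPaths => ω.1.1 r :=
  (comap_measurable fun ω : regularPaths => ω.1.1 r).mono (le_iSup (fun r : Iic (t : ℝ) =>
    MeasurableSpace.comap (fun ω : regularPaths => ω.1.1 r.1) inferInstance) ⟨r, h⟩) le_rfl

theorem wienerPast_mono {s t : ℝ≥0} (h : s ≤ t) : wienerPast s ≤ wienerPast t :=
  iSup_le fun r => le_iSup_of_le
    ⟨r.1, le_trans (mem_Iic.1 r.2) (NNReal.coe_le_coe.2 h)⟩ le_rfl

theorem wienerPast_le (t : ℝ≥0) : wienerPast t ≤ Subtype.instMeasurableSpace :=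
  iSup_le fun r => ((measurable_pathSpace_eval r.1).comp measurable_subtype_coe).comap_le

namespace LatticeSystem

variable (S : LatticeSystem)

theorem continuousOn_field_conjFlow {w : ℝ → ℝ} (hw : Continuous w) (x : EllTwo) (t : ℝ) :
    ContinuousOn (fun s => S.field (w s) (S.conjFlow w x s)) (Icc 0 t) := by
  obtain ⟨n, hn⟩ := S.exists_forall_conjFlow_eq hw t ‖x‖
  refine ((S.continuous_truncField n).comp
    (hw.prodMk (S.continuous_conjFlow hw x))).continuousOn.congr fun s hs => ?_
  exact (S.truncField_eq_field ((hn n le_rfl x le_rfl s hs.2).2 hs.1)).symm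

theorem expMul_field (r : ℝ) (h : EllTwo) :
    expMul S.α r (S.field r h) = S.drift (expMul S.α r h) := expMul_expMul_neg _ _ _

/-- The Stratonovich integral `∫₀ᵗ u ∘ dw` of `u = e^{α w} h`, obtained from the chain rule as
`K(w_t) h(t) - ∫₀ᵗ K(w_s) h'(s) ds` with `K' = e^{α ·}` and `K(0) = 0`. -/
noncomputable def noiseIntegral (w : ℝ → ℝ) (x : EllTwo) (t : ℝ) : EllTwo :=
  mulOp (expPrim S.α (w t)) (S.conjFlow w x t)
    - ∫ s in (0 : ℝ)..t, mulOp (expPrim S.α (w s)) (S.field (w s) (S.conjFlow w x s))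

theorem mulOp_noiseIntegral {w : ℝ → ℝ} (hw : Continuous w) (x : EllTwo) {t : ℝ} (ht : 0 ≤ t) :
    mulOp S.α (S.noiseIntegral w x t)
      = S.pathFlow w x t - x - ∫ s in (0 : ℝ)..t, S.drift (S.pathFlow w x s) := by
  have hc := S.continuousOn_field_conjFlow hw x t
  have hii : ∀ (f : ℝ → EllTwo), ContinuousOn f (Icc 0 t) → IntervalIntegrable f volume 0 t :=
    fun f hf => by
      refine ContinuousOn.intervalIntegrable ?_
      rwa [uIcc_of_le ht]
  have hKc : ContinuousOn (fun s => mulOp (expPrim S.α (w s))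
      (S.field (w s) (S.conjFlow w x s))) (Icc 0 t) :=
    ((mulOp.continuous.comp ((continuous_expPrim S.α).comp hw)).continuousOn).clm_apply hc
  have hEc : ContinuousOn (fun s => expMul S.α (w s)
      (S.field (w s) (S.conjFlow w x s))) (Icc 0 t) :=
    (continuous_uncurry_expMul S.α).comp_continuousOn (hw.continuousOn.prodMk hc)
  have hftc : ∫ s in (0 : ℝ)..t, S.field (w s) (S.conjFlow w x s) = S.conjFlow w x t - x := by
    rw [intervalIntegral.integral_eq_sub_of_hasDeriv_right_of_le ht
      (S.continuous_conjFlow hw x).continuousOn (fun s hs =>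
        (S.hasDerivWithinAt_conjFlow hw x hs.1.le).mono fun r hr => hs.1.le.trans (le_of_lt hr))
      (hii _ hc), S.conjFlow_of_nonpos w x le_rfl]
  have hmul : ∀ (r : ℝ) (y : EllTwo),
      mulOp S.α (mulOp (expPrim S.α r) y) = expMul S.α r y - y := fun r y => by
    rw [← mulOp_mul_apply, mul_expPrim, map_sub, sub_apply, mulOp_one_apply, expMul_eq_mulOp]
  rw [noiseIntegral, map_sub, hmul, ← ContinuousLinearMap.intervalIntegral_comp_comm _ (hii _ hKc)]
  simp only [hmul]
  rw [intervalIntegral.integral_sub (hii _ hEc) (hii _ hc), hftc]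
  simp only [expMul_field, pathFlow]
  abel

theorem pathFlow_apply_eq {w : ℝ → ℝ} (hw : Continuous w) (x : EllTwo) {t : ℝ} (ht : 0 ≤ t)
    (i : ℤ) : S.pathFlow w x t i = x i
      + (∫ s in (0 : ℝ)..t, stochasticDrift S.p S.lam S.Φ S.g (S.pathFlow w x s) i)
      + S.α i * S.noiseIntegral w x t i := by
  have hi : IntervalIntegrable (fun s => S.drift (S.pathFlow w x s)) volume 0 t := by
    have h1 := (continuous_uncurry_expMul S.α).comp_continuousOn
      (hw.continuousOn.prodMk (S.continuousOn_field_conjFlow hw x t))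
    rw [← uIcc_of_le ht] at h1
    refine h1.intervalIntegrable.congr fun s _ => ?_
    exact S.expMul_field _ _
  have h := congrArg (EllTwo.coord i) (S.mulOp_noiseIntegral hw x ht)
  rw [map_sub, map_sub, ← ContinuousLinearMap.intervalIntegral_comp_comm _ hi] at h
  simp only [EllTwo.coord_apply, mulOp_apply_coe, drift_apply] at h
  linarith

theorem measurable_pathFlow_wienerPast {U₀ : regularPaths → EllTwo}
    (hU₀ : Measurable[wienerPast 0] U₀) (t : ℝ≥0) :
    Measurable[wienerPast t] fun ω : regularPaths => S.pathFlow (fun s => ω.1.1 s) (U₀ ω) t := by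
  have hc : ∀ ω : regularPaths, Continuous fun s : ℝ => ω.1.1 s := fun ω => ω.1.1.continuous
  -- stopping the path at time `t` does not change the solution at time `t`
  have e : (fun ω : regularPaths => S.pathFlow (fun s => ω.1.1 s) (U₀ ω) t)
      = fun ω : regularPaths => S.pathFlow (fun s => ω.1.1 (min s t)) (U₀ ω) t := by
    funext ω
    rw [pathFlow, pathFlow, min_self, S.conjFlow_congr (hc ω)
      ((hc ω).comp (continuous_id.min continuous_const)) (U₀ ω)
      fun s hs => congrArg ω.1.1 (min_eq_left hs.2).symm]
    rfl
  rw [e]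
  exact @measurable_pathFlow S regularPaths (wienerPast t) (fun ω s => ω.1.1 (min s t)) U₀
    (fun ω => (hc ω).comp (continuous_id.min continuous_const))
    (fun s => measurable_wienerPast_eval (min_le_right s (t : ℝ)))
    (hU₀.mono (wienerPast_mono zero_le) le_rfl) t

theorem isStratonovichSolution {P : Measure PathSpace} (hP : IsWienerMeasure P)
    {U₀ : regularPaths → EllTwo} (hU₀ : Measurable[wienerPast 0] U₀) :
    IsStratonovichSolution (regularMeasure P) wienerPast brownianPath S.p S.lam S.Φ S.α S.g U₀
      (fun t ω => S.pathFlow (fun s => ω.1.1 s) (U₀ ω) t) where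
  adapted t := S.measurable_pathFlow_wienerPast hU₀ t
  continuous ω := (S.continuous_pathFlow ω.1.1.continuous (U₀ ω)).comp NNReal.continuous_coe
  equation := by
    refine ⟨fun t ω => S.noiseIntegral (fun s => ω.1.1 s) (U₀ ω) t, fun t => ?_,
      Eventually.of_forall fun ω t i => ?_⟩
    · refine hP.isStratonovichIntegral (fun s => (S.measurable_pathFlow_wienerPast hU₀ s).mono
        (wienerPast_le s) le_rfl) fun ω => ?_
      obtain ⟨C, hC⟩ := exists_norm_trapezoid_sum_sub_le S.α (W := fun s => ω.1.1 s)
        ω.1.1.continuous (fun s hs =>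
          S.hasDerivWithinAt_conjFlow ω.1.1.continuous (U₀ ω) (mem_Icc.1 hs).1)
        (S.continuousOn_field_conjFlow ω.1.1.continuous (U₀ ω) t)
      refine ⟨C, fun N π hπ h0 hN δ hδ0 hδ => ?_⟩
      have h := hC N (fun k => π k) (fun i j hij => NNReal.coe_le_coe.2 (hπ hij))
        (by rw [h0, NNReal.coe_zero]) (by rw [hN]) δ hδ0 hδ
      have hz : mulOp (expPrim S.α (ω.1.1 0)) (S.conjFlow (fun s => ω.1.1 s) (U₀ ω) 0) = 0 := by
        rw [ω.1.2, expPrim_zero, _root_.map_zero]; rfl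
      rw [hz, sub_zero] at h
      exact h
    · have h : ∫ s in (0 : ℝ)..t, stochasticDrift S.p S.lam S.Φ S.g
            (S.pathFlow (fun r => ω.1.1 r) (U₀ ω) (s.toNNReal : ℝ≥0)) i
          = ∫ s in (0 : ℝ)..t, stochasticDrift S.p S.lam S.Φ S.g
            (S.pathFlow (fun r => ω.1.1 r) (U₀ ω) s) i := by
        refine intervalIntegral.integral_congr fun s hs => ?_
        rw [uIcc_of_le t.coe_nonneg] at hs
        simp only [Real.coe_toNNReal s hs.1]
      rw [h]
      exact S.pathFlow_apply_eq ω.1.1.continuous (U₀ ω) t.2 i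

end LatticeSystem

/-! ### The random equation and its random dynamical system -/

theorem measurable_ouVar : Measurable ouVar := by
  have h1 : Measurable (Function.uncurry fun (τ : ℝ) (ω : PathSpace) => ω.1 τ) :=
    measurable_uncurry_of_continuous_of_measurable (fun ω => ω.1.continuous)
      measurable_pathSpace_eval
  have h2 : Measurable fun q : PathSpace × ℝ => Real.exp q.2 * q.1.1 q.2 :=
    (Real.measurable_exp.comp measurable_snd).mul (h1.comp measurable_swap)
  exact (h2.stronglyMeasurable.integral_prod_right (ν := volume.restrict (Iic 0))).measurable.neg

theorem measurable_ouPath (t : ℝ) : Measurable fun ω => ouPath ω t :=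
  measurable_ouVar.comp (measurable_subtype_coe.comp
    (measurable_regularShift.comp measurable_prodMk_left))

theorem continuous_ouPath (ω : regularPaths) : Continuous (ouPath ω) := ω.2.continuous

theorem ouPath_regularShift (ω : regularPaths) (s t : ℝ) :
    ouPath (regularShift s ω) t = ouPath ω (t + s) :=
  congrArg ouVar (wienerShift_wienerShift t s ω.1)

theorem hasDerivAt_integral_ouPath (ω : regularPaths) (t : ℝ) :
    HasDerivAt (fun t => ∫ s in (0 : ℝ)..t, ouPath ω s) (ouPath ω t) t :=
  intervalIntegral.integral_hasDerivAt_right ((continuous_ouPath ω).intervalIntegrable _ _)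
    ((continuous_ouPath ω).stronglyMeasurableAtFilter _ _) (continuous_ouPath ω).continuousAt

/-- The Ornstein-Uhlenbeck equation `z(θ_t ω) - z(ω) = -∫₀ᵗ z(θ_s ω) ds + ω(t)`. -/
theorem regularPath_eq_ouPath (ω : regularPaths) (t : ℝ) :
    ω.1.1 t = ouPath ω t - ouPath ω 0 + ∫ s in (0 : ℝ)..t, ouPath ω s :=
  IsRegularPath.eq_ouVar ω.2 t

namespace LatticeSystem

variable (S : LatticeSystem)

theorem randomField_eq (z : ℝ) (v : EllTwo) (i : ℤ) :
    randomField S.p S.lam S.Φ S.α S.g z v i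
      = (expMul S.α (-z) (S.drift (expMul S.α z v)) + z • mulOp S.α v) i := by
  have h1 : Real.exp (S.α i * -z) * Real.exp (S.α i * z) = 1 := by
    rw [← Real.exp_add, mul_neg, neg_add_cancel, Real.exp_zero]
  have h2 : |Real.exp (S.α i * z) * v i| ^ (S.p - 1)
      = Real.exp (S.α i * (S.p - 1) * z) * |v i| ^ (S.p - 1) := by
    rw [abs_mul, Real.mul_rpow (abs_nonneg _) (abs_nonneg _), Real.abs_exp, ← Real.exp_mul]
    congr 2; ring
  change _ = Real.exp (S.α i * -z) * S.drift (expMul S.α z v) i + z * (S.α i * v i)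
  rw [drift_apply, stochasticDrift, randomField]
  simp only [expMul_apply]
  rw [h2, show -S.α i * z = S.α i * -z by ring]
  linear_combination (S.lam * v i + S.lam * Real.exp (S.α i * (S.p - 1) * z)
    * |v i| ^ (S.p - 1) * v i) * h1

/-- The solution map of the Stratonovich equation. -/
noncomputable def stratonovichFlow (t : ℝ≥0) (ω : regularPaths) (x : EllTwo) : EllTwo :=
  S.pathFlow (fun s => ω.1.1 s) x t

/-- The solution map of the random equation. -/
noncomputable def randomFlow (t : ℝ≥0) (ω : regularPaths) (v₀ : EllTwo) : EllTwo :=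
  expMul S.α (-ouPath ω t) (S.stratonovichFlow t ω (expMul S.α (ouPath ω 0) v₀))

theorem randomFlow_eq (ω : regularPaths) (v₀ : EllTwo) {t : ℝ} (ht : 0 ≤ t) :
    S.randomFlow t.toNNReal ω v₀ = expMul S.α ((∫ s in (0 : ℝ)..t, ouPath ω s) - ouPath ω 0)
      (S.conjFlow (fun s => ω.1.1 s) (expMul S.α (ouPath ω 0) v₀) t) := by
  rw [randomFlow, stratonovichFlow, pathFlow, ← expMul_add, Real.coe_toNNReal t ht,
    regularPath_eq_ouPath ω t]
  congr 1; ring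

theorem isRandomSolution_randomFlow (ω : regularPaths) (v₀ : EllTwo) :
    IsRandomSolution S.p S.lam S.Φ S.α S.g (ouPath ω) v₀ (Ici 0)
      (fun t => S.randomFlow t.toNNReal ω v₀) where
  initial := by
    rw [S.randomFlow_eq ω v₀ le_rfl, S.conjFlow_of_nonpos _ _ le_rfl,
      intervalIntegral.integral_same, zero_sub, expMul_neg_expMul]
  ode t ht := by
    refine ⟨expMul S.α (-ouPath ω t) (S.drift (expMul S.α (ouPath ω t)
      (S.randomFlow t.toNNReal ω v₀))) + ouPath ω t • mulOp S.α (S.randomFlow t.toNNReal ω v₀),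
      fun i => (S.randomField_eq _ _ i).symm, ?_⟩
    have h := ((hasDerivAt_integral_ouPath ω t).sub_const (ouPath ω 0)).hasDerivWithinAt.expMul S.α
      (S.hasDerivWithinAt_conjFlow ω.1.1.continuous (expMul S.α (ouPath ω 0) v₀) (mem_Ici.1 ht))
    refine (h.congr_of_mem (fun s hs => S.randomFlow_eq ω v₀ (mem_Ici.1 hs)) ht).congr_deriv ?_
    rw [S.randomFlow_eq ω v₀ (mem_Ici.1 ht), field, ← expMul_add]
    simp only [expMul_eq_mulOp, map_add, map_smul, ← mulOp_mul_apply, ← expSeq_add]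
    rw [regularPath_eq_ouPath ω t]
    ring_nf

theorem eq_randomFlow (ω : regularPaths) (v₀ : EllTwo) {T : ℝ} {v : ℝ → EllTwo}
    (hv : IsRandomSolution S.p S.lam S.Φ S.α S.g (ouPath ω) v₀ (Icc 0 T) v) {t : ℝ}
    (ht : t ∈ Icc 0 T) : v t = S.randomFlow t.toNNReal ω v₀ := by
  have key : expMul S.α (ouPath ω 0 - ∫ s in (0 : ℝ)..t, ouPath ω s) (v t)
      = S.conjFlow (fun s => ω.1.1 s) (expMul S.α (ouPath ω 0) v₀) t := by
    refine S.eq_conjFlow ω.1.1.continuous _ (T := T)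
      (f := fun t => expMul S.α (ouPath ω 0 - ∫ s in (0 : ℝ)..t, ouPath ω s) (v t))
      (by rw [intervalIntegral.integral_same, sub_zero, hv.initial]) (fun s hs => ?_) ht
    obtain ⟨v', hv', hd⟩ := hv.ode s hs
    have e : v' = expMul S.α (-ouPath ω s) (S.drift (expMul S.α (ouPath ω s) (v s)))
        + ouPath ω s • mulOp S.α (v s) :=
      EllTwo.ext_apply fun i => (hv' i).trans (S.randomField_eq _ _ i)
    rw [e] at hd
    refine (((hasDerivAt_integral_ouPath ω s).const_sub (ouPath ω 0)).hasDerivWithinAt.expMul S.α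
      hd).congr_deriv ?_
    rw [neg_smul, add_neg_cancel_right, field, ← expMul_add, ← expMul_add,
      regularPath_eq_ouPath ω s]
    ring_nf
  rw [S.randomFlow_eq ω v₀ ht.1, ← key, ← expMul_add]
  rw [show ∀ a b : ℝ, a - b + (b - a) = 0 from fun a b => by ring, expMul_zero]

theorem continuous_randomFlow (ω : regularPaths) (v₀ : EllTwo) :
    Continuous fun t : ℝ≥0 => S.randomFlow t ω v₀ :=
  ((continuous_ouPath ω).comp NNReal.continuous_coe).neg.expMul S.α
    ((S.continuous_pathFlow ω.1.1.continuous _).comp NNReal.continuous_coe)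

theorem measurable_randomFlow :
    Measurable fun q : ℝ≥0 × regularPaths × EllTwo => S.randomFlow q.1 q.2.1 q.2.2 := by
  refine measurable_uncurry_of_continuous_of_measurable
    (u := fun (t : ℝ≥0) (y : regularPaths × EllTwo) => S.randomFlow t y.1 y.2)
    (fun y => S.continuous_randomFlow y.1 y.2) fun t => ?_
  exact ((measurable_ouPath t).comp measurable_fst).neg.expMul S.α
    (S.measurable_pathFlow (fun y : regularPaths × EllTwo => y.1.1.1.continuous)
      (fun s => (measurable_pathSpace_eval s).comp (measurable_subtype_coe.comp measurable_fst))
      (((measurable_ouPath 0).comp measurable_fst).expMul S.α measurable_snd) t)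

theorem stratonovichFlow_add (s t : ℝ≥0) (ω : regularPaths) (x : EllTwo) :
    S.stratonovichFlow (s + t) ω x
      = S.stratonovichFlow t (regularShift s ω) (S.stratonovichFlow s ω x) := by
  rw [stratonovichFlow, NNReal.coe_add,
    S.pathFlow_add ω.1.1.continuous x s.coe_nonneg t.coe_nonneg]
  rfl

theorem isContinuousRDS_randomFlow {P : Measure PathSpace} (hP : IsWienerMeasure P) :
    IsContinuousRDS (regularMeasure P) regularShift S.randomFlow where
  toIsMetricDynamicalSystem := hP.isMetricDynamicalSystem
  measurable := S.measurable_randomFlow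
  continuous t ω := continuous_const.expMul S.α
    ((S.continuous_pathFlow_initial ω.1.1.continuous t).comp
      (continuous_const.expMul S.α continuous_id))
  zero ω := by
    funext v₀
    rw [randomFlow, stratonovichFlow, NNReal.coe_zero, S.pathFlow_zero ω.1.2, expMul_neg_expMul]
    rfl
  cocycle s t ω := by
    funext v₀
    change _ = S.randomFlow t (regularShift s ω) (S.randomFlow s ω v₀)
    rw [randomFlow, randomFlow, randomFlow, ouPath_regularShift, ouPath_regularShift, zero_add,
      expMul_expMul_neg, ← S.stratonovichFlow_add, NNReal.coe_add, add_comm (t : ℝ)]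

end LatticeSystem

theorem mainTheorem3 (p lam c₁ c₂ : ℝ) (hp : 1 < p) (hlam : 0 < lam) (hc₁ : 0 < c₁) (hc₂ : 0 < c₂)
    (Φ : ℝ → ℝ) (hΦ : Differentiable ℝ Φ) (hΦ0 : Φ 0 = 0)
    (hΦ_lower : ∀ u : ℝ, (p + 1) ^ 2 / 4 * c₂ * |u| ^ (p - 1) ≤ deriv Φ u)
    (hΦ_upper : ∀ u : ℝ, deriv Φ u ≤ c₁ * (1 + |u| ^ (p - 1)))
    (α : EllInfty) (hα : ∀ i : ℤ, 0 < α i) (g : EllTwo)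
    (P : Measure PathSpace) (hP : IsWienerMeasure P) :
    MeasurableSet regularPaths ∧ P regularPaths = 1 ∧
    ∃ φ u : ℝ≥0 → regularPaths → EllTwo → EllTwo,
      -- `t ↦ φ t ω v₀` is the unique solution of the random equation
      (∀ (ω : regularPaths) (v₀ : EllTwo),
        IsRandomSolution p lam Φ α g (ouPath ω) v₀ (Ici 0) (fun t => φ t.toNNReal ω v₀) ∧
        ∀ T : ℝ, 0 < T → ∀ v : ℝ → EllTwo,
          IsRandomSolution p lam Φ α g (ouPath ω) v₀ (Icc 0 T) v →
            ∀ t ∈ Icc 0 T, v t = φ t.toNNReal ω v₀) ∧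
      IsContinuousRDS (regularMeasure P) regularShift φ ∧
      -- `φ(t, ω, v₀) = e^{-α z(θ_t ω)} u(t, ω, e^{α z(ω)} v₀)`
      (∀ (t : ℝ≥0) (ω : regularPaths) (v₀ : EllTwo),
        φ t ω v₀ = expMul α (-ouPath ω t) (u t ω (expMul α (ouPath ω 0) v₀))) ∧
      -- `u` is the solution map of the stochastic equation
      (∀ U₀ : regularPaths → EllTwo, Measurable[wienerPast 0] U₀ →
        IsStratonovichSolution (regularMeasure P) wienerPast brownianPath p lam Φ α g U₀
          (fun t ω => u t ω (U₀ ω))) := by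
  let S : LatticeSystem := ⟨p, lam, c₁, Φ, α, g, hp, hlam, hc₁, hΦ, hΦ0,
    fun u => le_trans (by positivity) (hΦ_lower u), hΦ_upper⟩
  exact ⟨measurableSet_regularPaths, hP.measure_regularPaths, S.randomFlow, S.stratonovichFlow,
    fun ω v₀ => ⟨S.isRandomSolution_randomFlow ω v₀,
      fun _ _ _ hv _ ht => S.eq_randomFlow ω v₀ hv ht⟩,
    S.isContinuousRDS_randomFlow hP, fun _ _ _ => rfl,
    fun _ hU₀ => S.isStratonovichSolution hP hU₀⟩
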